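/- **Maps.** A plane map is an embedding of a finite connected graph (loops and multiple edges allowed) in the sphere, up to direct homeomorphisms. A quadrangulation with a simple boundary is a plane map rooted at an oriented edge, such that all faces have degree $4$ except possibly the external face (the face on the right of the root), and such that the boundary of the external face does not visit a vertex twice. Its area $|\mathbf q|$ is the number of its inner faces and its perimeter $\mathrm{per}(\mathbf q)$ is the degree of its external face. Let $\widetilde{\mathcal Q}_{n,p}$ be the set of those with area $n$ and perimeter $p$. Let $\tilde q_{n,p}=\#\widetilde{\mathcal Q}_{n,p}$ for integers $n\ge 1$ and $p\in\{2,4,\dots\}$, $\tilde q_{0,2}=1$ (the map with a single edge), and $\tilde q_{n,p}=0$ for all other $(n,p)\in\mathbb Z^2$. When $\widetilde{\mathcal Q}_{n,p}\neq\emptyset$, let $\widetilde Q^\bullet_{n,p}$ be uniform on $\widetilde{\mathcal Q}_{n,p}$ and pointed at a uniform vertex $\rho$. **Restriction.** Fix a sequence $(p_n)_{n\ge1}$ of even positive integers, $n\ge1$ and $\varepsilon>0$. Let $(\mathbf q,\rho)$ be a pointed quadrangulation with a simple boundary of perimeter $p$; number its boundary vertices $0,\dots,p-1$ from the origin of the root,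 following the orientation of the root. For $\ell\ge 1$, the ball $B_\ell$ consists of the inner faces incident to a vertex at graph distance at most $\ell-1$ from $\rho$, with their edges and vertices. Let $I$ be the set of the boundary vertices numbered from $\lfloor(\frac13-\varepsilon)p_n\rfloor$ to $\lfloor p_n/3\rfloor$. Assume that $\varepsilon<1/3$, that $p\ge p_n/2$, that some ball meets $I$ and, $B_{\varrho}$ denoting the ball of smallest radius that does, that $B_{\varrho}$ contains a boundary vertex with number in $\{\lfloor p_n/3\rfloor+1,\dots,p-1\}$. Let $v^-$ be the vertex of $I\cap B_{\varrho}$ with the largest number, and $v^+$ the vertex of $B_{\varrho}$ with the smallest number in $\{\lfloor p_n/3\rfloor+1,\dots,p-1\}$. Call two inner faces adjacent if they share an edge, and let $\mathfrak C$ be the set of the inner faces not in $B_{\varrho}$ that are connected, by a chain of adjacent inner faces not in $B_{\varrho}$, to a face incident to a boundary edge between $v^-$ and $v^+$ (so $\mathfrak C=\emptyset$ if all the inner faces incident to these edges are in $B_{\varrho}$). The restriction $\mathcal R^\varepsilon_n(\mathbf q,\rho)$ is the map $\mathbf r$ made of the inner faces of $\mathbf q$ that are not in $\mathfrak C$, with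 their edges and vertices, together with the distinguished vertices $\rho,v^-,v^+$. Its root is that of $\mathbf q$; if the root edge of $\mathbf q$ is not in $\mathbf r$ (which can only happen if $v^-$ is the origin of the root), $\mathbf r$ is rooted at the edge of its boundary with the same origin. If the above assumptions fail, $\mathcal R^\varepsilon_n(\mathbf q,\rho)$ is a cemetery point. An $(n,\varepsilon)$-restriction map is a map $\mathbf r=(\mathbf r,\rho,v^-,v^+)$ equal to $\mathcal R^\varepsilon_n(\mathbf q,\rho)$ for some pointed quadrangulation $(\mathbf q,\rho)$ with a simple boundary in which $v^-$ and $v^+$ are at distance $\varrho$ or $\varrho+1$ from $\rho$, where $\varrho$ is the radius used in the construction. For such a map, let $p_{\mathrm{left}}$ be the number of boundary edges of $\mathbf r$ from the origin of the root to $v^+$ in clockwise direction (against the orientation of the root), and $p_{\mathrm{in}}$ the number of boundary edges of $\mathbf r$ from $v^-$ to $v^+$ in counterclockwise direction (along the orientation of the root). **Lemma.** Let $n'\ge 1$ be an integer and let $p'\ge p_n/2$ be an even positive integer with $\widetilde{\mathcal Q}_{n',p'}\ne\emptyset$, and let $\mathbf r$ be an $(n,\varepsilon)$-restriction map. Then $$\mathbb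 P\big(\mathcal R^\varepsilon_n(\widetilde Q^\bullet_{n',p'})=\mathbf r\big)=\frac{\tilde q_{\,n'-|\mathbf r|,\;p'-\mathrm{per}(\mathbf r)+2p_{\mathrm{in}}}}{(n'+p'/2+1)\,\tilde q_{n',p'}}\;\mathbf 1_{\{p'-p_{\mathrm{left}}>p_n/3\}}.$$ -/

import Mathlib

open scoped ENNReal

noncomputable section

namespace PlaneQuad

/-! ### Rooted combinatorial maps

A rooted map is encoded on the set `D` of its oriented edges (darts): `σ` sends a dart to the next
one in counterclockwise order around its origin, `α` reverses a dart. -/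

/-- A rooted map with dart set `D`. -/
structure RootedMap (D : Type) where
  /-- counterclockwise rotation around the origin of a dart -/
  σ : Equiv.Perm D
  /-- reversal of a dart -/
  α : Equiv.Perm D
  /-- the root -/
  root : D
  α_α : ∀ d, α (α d) = d
  α_ne : ∀ d, α d ≠ d

namespace RootedMap

variable {D : Type}

/-- `φ d` is the dart following `d` along the boundary of the face on the right of `d`. -/
def φ (m : RootedMap D) : Equiv.Perm D := m.σ * m.α

/-- Vertices are the cycles of `σ`. -/
def Vertex (m : RootedMap D) : Type := Quotient (Equiv.Perm.SameCycle.setoid m.σ)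

/-- Faces are the cycles of `φ`. -/
def Face (m : RootedMap D) : Type := Quotient (Equiv.Perm.SameCycle.setoid m.φ)

/-- The origin of a dart. -/
def tail (m : RootedMap D) (d : D) : m.Vertex :=
  Quotient.mk (Equiv.Perm.SameCycle.setoid m.σ) d

/-- The face on the right of a dart, that is, the face to which the dart is incident. -/
def face (m : RootedMap D) (d : D) : m.Face :=
  Quotient.mk (Equiv.Perm.SameCycle.setoid m.φ) d

/-- The external face: the one on the right of the root. -/
def extFace (m : RootedMap D) : m.Face := m.face m.root

/-- The degree of a face. -/
def degree (m : RootedMap D) (f : m.Face) : ℕ := Nat.card {d : D // m.face d = f}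

/-- The perimeter: the degree of the external face. -/
def per (m : RootedMap D) : ℕ := m.degree m.extFace

/-- The area: the number of inner faces. -/
def area (m : RootedMap D) : ℕ := Nat.card {f : m.Face // f ≠ m.extFace}

/-- The underlying graph is connected. -/
def Connected (m : RootedMap D) : Prop :=
  ∀ d d' : D, Relation.EqvGen (fun x y => y = m.σ x ∨ y = m.α x) d d'

/-- Euler's relation `V - E + F = 2` (genus `0`), where `2E` is the number of darts. -/
def Planar (m : RootedMap D) : Prop :=
  2 * (Nat.card m.Vertex + Nat.card m.Face) = Nat.card D + 4

/-- Quadrangulations with a simple boundary, of area `n` and perimeter `p`: plane maps whose inner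
faces are all of degree `4` and whose boundary does not visit a vertex twice. -/
structure IsSimpleQuad (m : RootedMap D) (n p : ℕ) : Prop where
  connected : m.Connected
  planar : m.Planar
  degree_inner : ∀ f : m.Face, f ≠ m.extFace → m.degree f = 4
  per_eq : m.per = p
  area_eq : m.area = n
  simple : ∀ d d' : D, m.face d = m.extFace → m.face d' = m.extFace →
    m.tail d = m.tail d' → d = d'

/-- Isomorphism of rooted maps. -/
def Iso {D' : Type} (m : RootedMap D) (m' : RootedMap D') : Prop :=
  ∃ e : D ≃ D', (∀ d, e (m.σ d) = m'.σ (e d)) ∧ (∀ d, e (m.α d) = m'.α (e d)) ∧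
    e m.root = m'.root

end RootedMap

/-- Quadrangulations with a simple boundary, of area `n` and perimeter `p`, with darts labeled by
`Fin (4 * n + p)` (the sum of the degrees of the faces). -/
def LabeledQuad (n p : ℕ) : Type :=
  {m : RootedMap (Fin (4 * n + p)) // m.IsSimpleQuad n p}

/-- Labeled maps that differ by a relabeling of the darts. -/
def LabeledQuad.setoid (n p : ℕ) : Setoid (LabeledQuad n p) where
  r m m' := m.1.Iso m'.1
  iseqv :=
    { refl := fun m => ⟨Equiv.refl _, fun _ => rfl, fun _ => rfl, rfl⟩
      symm := by
        rintro m m' ⟨e, h1, h2, h3⟩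
        refine ⟨e.symm, fun d => ?_, fun d => ?_, ?_⟩
        · rw [Equiv.symm_apply_eq, h1, Equiv.apply_symm_apply]
        · rw [Equiv.symm_apply_eq, h2, Equiv.apply_symm_apply]
        · rw [Equiv.symm_apply_eq, h3]
      trans := by
        rintro m m' m'' ⟨e, h1, h2, h3⟩ ⟨e', h1', h2', h3'⟩
        refine ⟨e.trans e', fun d => ?_, fun d => ?_, ?_⟩
        · simp [h1, h1']
        · simp [h2, h2']
        · simp [h3, h3'] }

/-- The set of (isomorphism classes of) rooted quadrangulations with a simple boundary, with area
`n` and perimeter `p`. -/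
def SimpleQuad (n p : ℕ) : Type := Quotient (LabeledQuad.setoid n p)

/-- The number of quadrangulations with a simple boundary of area `n ≥ 1` and perimeter
`p ∈ {2, 4, 6, …}`, with value `1` at `(0, 2)` and `0` at all other pairs. -/
def qt (n p : ℤ) : ℕ :=
  if 1 ≤ n ∧ 1 ≤ p ∧ Even p then Nat.card (SimpleQuad n.toNat p.toNat)
  else if n = 0 ∧ p = 2 then 1 else 0

/-! ### Balls -/

namespace RootedMap

variable {D : Type}

/-- The graph on the vertex set of the map (loops and multiple edges are irrelevant to the graph
distance). -/
def graph (m : RootedMap D) : SimpleGraph m.Vertex :=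
  SimpleGraph.fromRel (fun u v => ∃ d, m.tail d = u ∧ m.tail (m.α d) = v)

/-- Graph distance. -/
def dist (m : RootedMap D) (u v : m.Vertex) : ℕ := m.graph.dist u v

/-- The inner faces of the ball of radius `l` around `ρ`: those incident to a vertex at distance at
most `l - 1` from `ρ` (none if `l = 0`). -/
def ballFaces (m : RootedMap D) (ρ : m.Vertex) (l : ℕ) : Set m.Face :=
  {f | f ≠ m.extFace ∧ ∃ d, m.face d = f ∧ m.dist ρ (m.tail d) < l}

/-- The vertices of the ball of radius `l` around `ρ`. -/
def ballVerts (m : RootedMap D) (ρ : m.Vertex) (l : ℕ) : Set m.Vertex :=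
  {v | ∃ d, m.tail d = v ∧ m.face d ∈ m.ballFaces ρ l}

/-- The `i`-th boundary edge, starting from the root. -/
def bEdge (m : RootedMap D) (i : ℕ) : D := (m.φ ^ i) m.root

/-- The `i`-th boundary vertex, starting from the origin of the root. -/
def bVert (m : RootedMap D) (i : ℕ) : m.Vertex := m.tail (m.bEdge i)

/-! ### The restriction

Below, `pn` is the value `p_n` of the reference sequence of perimeters. -/

/-- The indices of the boundary vertices of the set `I`. -/
def targetIdx (pn : ℕ) (ε : ℝ) : Set ℕ :=
  Set.Icc ⌊(1 / 3 - ε) * (pn : ℝ)⌋₊ ⌊(pn : ℝ) / 3⌋₊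

/-- The radii of the balls that intersect `I`. -/
def hitRadii (m : RootedMap D) (ρ : m.Vertex) (pn : ℕ) (ε : ℝ) : Set ℕ :=
  {l | ∃ i ∈ targetIdx pn ε, m.bVert i ∈ m.ballVerts ρ l}

/-- The smallest radius of a ball that intersects `I`. -/
def hitRadius (m : RootedMap D) (ρ : m.Vertex) (pn : ℕ) (ε : ℝ) : ℕ :=
  sInf (m.hitRadii ρ pn ε)

/-- The faces of the ball of radius `hitRadius`. -/
def hitFaces (m : RootedMap D) (ρ : m.Vertex) (pn : ℕ) (ε : ℝ) : Set m.Face :=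
  m.ballFaces ρ (m.hitRadius ρ pn ε)

/-- The vertices of the ball of radius `hitRadius`. -/
def hitVerts (m : RootedMap D) (ρ : m.Vertex) (pn : ℕ) (ε : ℝ) : Set m.Vertex :=
  m.ballVerts ρ (m.hitRadius ρ pn ε)

/-- The index of `v⁻`, the last vertex of `I` that is in the ball. -/
def idxMinus (m : RootedMap D) (ρ : m.Vertex) (pn : ℕ) (ε : ℝ) : ℕ :=
  sSup {i | i ∈ targetIdx pn ε ∧ m.bVert i ∈ m.hitVerts ρ pn ε}

/-- The indices of the boundary vertices in the ball lying strictly between the last vertex of `I`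
and the origin of the root. -/
def otherSide (m : RootedMap D) (ρ : m.Vertex) (pn : ℕ) (ε : ℝ) : Set ℕ :=
  {i | ⌊(pn : ℝ) / 3⌋₊ < i ∧ i < m.per ∧ m.bVert i ∈ m.hitVerts ρ pn ε}

/-- The index of `v⁺`, the first vertex in the ball after the last vertex of `I`. -/
def idxPlus (m : RootedMap D) (ρ : m.Vertex) (pn : ℕ) (ε : ℝ) : ℕ :=
  sInf (m.otherSide ρ pn ε)

/-- The vertex `v⁻`. -/
def vMinus (m : RootedMap D) (ρ : m.Vertex) (pn : ℕ) (ε : ℝ) : m.Vertex :=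
  m.bVert (m.idxMinus ρ pn ε)

/-- The vertex `v⁺`. -/
def vPlus (m : RootedMap D) (ρ : m.Vertex) (pn : ℕ) (ε : ℝ) : m.Vertex :=
  m.bVert (m.idxPlus ρ pn ε)

/-- The conditions under which the restriction is constructed. -/
def Restrictable (m : RootedMap D) (ρ : m.Vertex) (pn : ℕ) (ε : ℝ) : Prop :=
  ε < 1 / 3 ∧ (pn : ℝ) / 2 ≤ m.per ∧ (m.hitRadii ρ pn ε).Nonempty ∧ (m.otherSide ρ pn ε).Nonempty

/-- Adjacency of inner faces that are not in the ball. -/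
def OutAdj (m : RootedMap D) (ρ : m.Vertex) (pn : ℕ) (ε : ℝ) (f g : m.Face) : Prop :=
  (f ≠ m.extFace ∧ f ∉ m.hitFaces ρ pn ε) ∧ (g ≠ m.extFace ∧ g ∉ m.hitFaces ρ pn ε) ∧
    ∃ d, m.face d = f ∧ m.face (m.α d) = g

/-- The faces to suppress: the inner faces that are not in the ball and can be reached, through
adjacent faces that are not in the ball, from a face incident to the part of the boundary from `v⁻`
to `v⁺`. This set is empty when all the faces incident to that part of the boundary are in the
ball. -/
def outFaces (m : RootedMap D) (ρ : m.Vertex) (pn : ℕ) (ε : ℝ) : Set m.Face :=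
  {f | ∃ i, m.idxMinus ρ pn ε ≤ i ∧ i < m.idxPlus ρ pn ε ∧
    m.face (m.α (m.bEdge i)) ≠ m.extFace ∧ m.face (m.α (m.bEdge i)) ∉ m.hitFaces ρ pn ε ∧
    Relation.ReflTransGen (m.OutAdj ρ pn ε) (m.face (m.α (m.bEdge i))) f}

/-- The darts of the edges incident to at least one of the remaining inner faces. -/
def kept (m : RootedMap D) (ρ : m.Vertex) (pn : ℕ) (ε : ℝ) : Set D :=
  {d | (m.face d ≠ m.extFace ∧ m.face d ∉ m.outFaces ρ pn ε) ∨
    (m.face (m.α d) ≠ m.extFace ∧ m.face (m.α d) ∉ m.outFaces ρ pn ε)}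

lemma α_mem_kept (m : RootedMap D) (ρ : m.Vertex) (pn : ℕ) (ε : ℝ) (d : D) :
    m.α d ∈ m.kept ρ pn ε ↔ d ∈ m.kept ρ pn ε := by
  simp only [kept, Set.mem_ofPred_eq, m.α_α]
  exact or_comm

end RootedMap

/-! ### First return permutation -/

section FirstReturn

variable {D : Type} [Finite D]

lemma exists_return (σ : Equiv.Perm D) (K : Set D) (d : K) :
    {k : ℕ | 1 ≤ k ∧ (σ ^ k) (d : D) ∈ K}.Nonempty :=
  ⟨orderOf σ, orderOf_pos σ, by simp [pow_orderOf_eq_one]⟩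

/-- The number of iterations of `σ` needed to come back to `K`. -/
def returnTime (σ : Equiv.Perm D) (K : Set D) (d : K) : ℕ :=
  sInf {k : ℕ | 1 ≤ k ∧ (σ ^ k) (d : D) ∈ K}

lemma returnTime_spec (σ : Equiv.Perm D) (K : Set D) (d : K) :
    1 ≤ returnTime σ K d ∧ (σ ^ returnTime σ K d) (d : D) ∈ K :=
  Nat.sInf_mem (exists_return σ K d)

/-- The first element of `K` in the sequence `σ d, σ² d, …`. -/
def returnMap (σ : Equiv.Perm D) (K : Set D) (d : K) : K :=
  ⟨(σ ^ returnTime σ K d) (d : D), (returnTime_spec σ K d).2⟩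

lemma returnMap_aux (σ : Equiv.Perm D) (K : Set D) (x y : K)
    (h : returnMap σ K x = returnMap σ K y) (hle : returnTime σ K x ≤ returnTime σ K y) :
    x = y := by
  have h' : (σ ^ returnTime σ K x) (x : D) = (σ ^ returnTime σ K y) (y : D) :=
    congrArg Subtype.val h
  obtain ⟨c, hc⟩ := Nat.exists_eq_add_of_le hle
  rw [hc, pow_add, Equiv.Perm.mul_apply] at h'
  have hx : (x : D) = (σ ^ c) (y : D) := (σ ^ returnTime σ K x).injective h'
  rcases Nat.eq_zero_or_pos c with h0 | hpos
  · subst h0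
    exact Subtype.ext (by simpa using hx)
  · have hm : returnTime σ K y ≤ c := Nat.sInf_le ⟨hpos, hx ▸ x.2⟩
    have := (returnTime_spec σ K x).1
    omega

/-- The permutation induced by `σ` on `K`. -/
def firstReturn (σ : Equiv.Perm D) (K : Set D) : Equiv.Perm K :=
  Equiv.ofBijective (returnMap σ K) (Finite.injective_iff_bijective.1 (by
    intro x y h
    rcases le_total (returnTime σ K x) (returnTime σ K y) with hle | hle
    · exact returnMap_aux σ K x y h hle
    · exact (returnMap_aux σ K y x h.symm hle).symm))

end FirstReturn

/-- A finite rooted map with three distinguished vertices `ρ`, `v⁻` and `v⁺`. -/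
structure MarkedMap where
  Dart : Type
  finite : Finite Dart
  map : RootedMap Dart
  ρ : map.Vertex
  vm : map.Vertex
  vp : map.Vertex

namespace MarkedMap

/-- Isomorphisms preserve the root and the three distinguished vertices. -/
instance setoid : Setoid MarkedMap where
  r a b := ∃ e : a.Dart ≃ b.Dart, (∀ d, e (a.map.σ d) = b.map.σ (e d)) ∧
    (∀ d, e (a.map.α d) = b.map.α (e d)) ∧ e a.map.root = b.map.root ∧
    (∀ d, a.map.tail d = a.ρ ↔ b.map.tail (e d) = b.ρ) ∧
    (∀ d, a.map.tail d = a.vm ↔ b.map.tail (e d) = b.vm) ∧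
    (∀ d, a.map.tail d = a.vp ↔ b.map.tail (e d) = b.vp)
  iseqv :=
    { refl := fun a => ⟨Equiv.refl _, fun _ => rfl, fun _ => rfl, rfl,
        fun _ => Iff.rfl, fun _ => Iff.rfl, fun _ => Iff.rfl⟩
      symm := by
        rintro a b ⟨e, h1, h2, h3, h4, h5, h6⟩
        refine ⟨e.symm, fun d => ?_, fun d => ?_, ?_, fun d => ?_, fun d => ?_, fun d => ?_⟩
        · rw [Equiv.symm_apply_eq, h1, Equiv.apply_symm_apply]
        · rw [Equiv.symm_apply_eq, h2, Equiv.apply_symm_apply]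
        · rw [Equiv.symm_apply_eq, h3]
        · rw [h4, Equiv.apply_symm_apply]
        · rw [h5, Equiv.apply_symm_apply]
        · rw [h6, Equiv.apply_symm_apply]
      trans := by
        rintro a b c ⟨e, h1, h2, h3, h4, h5, h6⟩ ⟨f, k1, k2, k3, k4, k5, k6⟩
        refine ⟨e.trans f, fun d => ?_, fun d => ?_, ?_, fun d => ?_, fun d => ?_, fun d => ?_⟩
        · simp [h1, k1]
        · simp [h2, k2]
        · simp [h3, k3]
        · rw [h4, k4]; rfl
        · rw [h5, k5]; rfl
        · rw [h6, k6]; rfl }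

/-- Area of a marked map. -/
def area (r : MarkedMap) : ℕ := r.map.area

/-- Perimeter of a marked map. -/
def per (r : MarkedMap) : ℕ := r.map.per

/-- Number of boundary edges from the origin of the root to `v⁻`, counterclockwise (that is,
following the orientation given by the root). -/
def pRight (r : MarkedMap) : ℕ := sInf {i | r.map.tail ((r.map.φ ^ i) r.map.root) = r.vm}

/-- Number of boundary edges from the origin of the root to `v⁺`, clockwise. -/
def pLeft (r : MarkedMap) : ℕ := sInf {i | r.map.tail ((r.map.φ⁻¹ ^ i) r.map.root) = r.vp}

/-- Number of boundary edges from `v⁻` to `v⁺`, counterclockwise. -/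
def pIn (r : MarkedMap) : ℕ :=
  sInf {i | r.map.tail ((r.map.φ ^ (r.pRight + i)) r.map.root) = r.vp}

end MarkedMap

/-- Finite rooted maps with three distinguished vertices, up to isomorphism. -/
abbrev MarkedClass : Type 1 := Quotient MarkedMap.setoid

namespace RootedMap

variable {D : Type}

/-- A vertex of the map that is incident to a dart of `K`. -/
def Survives (m : RootedMap D) (K : Set D) (v : m.Vertex) : Prop := ∃ d ∈ K, m.tail d = v

/-- The map obtained by keeping the edges whose darts are in `K`. It is rooted at the first
kept dart in the sequence `root, σ root, σ² root, …` (this is the root itself if it is kept). -/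
def submap [Finite D] (m : RootedMap D) (K : Set D) (hα : ∀ d, m.α d ∈ K ↔ d ∈ K)
    (hroot : {k : ℕ | (m.σ ^ k) m.root ∈ K}.Nonempty) : RootedMap K where
  σ := firstReturn m.σ K
  α := m.α.subtypePerm hα
  root := ⟨(m.σ ^ sInf {k : ℕ | (m.σ ^ k) m.root ∈ K}) m.root, Nat.sInf_mem hroot⟩
  α_α := fun d => Subtype.ext (m.α_α d)
  α_ne := fun d h => m.α_ne d (congrArg Subtype.val h)

open Classical in
/-- The restriction of the map `m` pointed at `ρ`, marked at `ρ`, `v⁻` and `v⁺`; the value `none`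
stands for the cemetery point. The last four conditions in the test say that the origin of the root
and the three distinguished vertices are not suppressed; they hold for quadrangulations with a
simple boundary as soon as the first condition does. -/
def restriction [Finite D] (m : RootedMap D) (ρ : m.Vertex) (pn : ℕ) (ε : ℝ) : Option MarkedMap :=
  if h : m.Restrictable ρ pn ε ∧ {k : ℕ | (m.σ ^ k) m.root ∈ m.kept ρ pn ε}.Nonempty ∧
      m.Survives (m.kept ρ pn ε) ρ ∧ m.Survives (m.kept ρ pn ε) (m.vMinus ρ pn ε) ∧
      m.Survives (m.kept ρ pn ε) (m.vPlus ρ pn ε) then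
    let r : RootedMap (m.kept ρ pn ε) :=
      m.submap (m.kept ρ pn ε) (m.α_mem_kept ρ pn ε) h.2.1
    some
      { Dart := m.kept ρ pn ε
        finite := inferInstance
        map := r
        ρ := r.tail ⟨h.2.2.1.choose, h.2.2.1.choose_spec.1⟩
        vm := r.tail ⟨h.2.2.2.1.choose, h.2.2.2.1.choose_spec.1⟩
        vp := r.tail ⟨h.2.2.2.2.choose, h.2.2.2.2.choose_spec.1⟩ }
  else none

/-- The restriction, up to isomorphism. -/
def restrictionClass [Finite D] (m : RootedMap D) (ρ : m.Vertex) (pn : ℕ) (ε : ℝ) :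
    Option MarkedClass :=
  (m.restriction ρ pn ε).map (Quotient.mk MarkedMap.setoid)

end RootedMap

/-- `(n, ε)`-restriction maps (where `pn` is `p_n`): the marked maps that are the restriction of
some pointed quadrangulation with a simple boundary in which `v⁻` and `v⁺` are at distance `r` or
`r + 1` from the pointed vertex, `r` being the radius of the ball used to define the restriction. -/
def IsRestrictionMap (pn : ℕ) (ε : ℝ) (r : MarkedMap) : Prop :=
  ∃ (n p : ℕ) (q : LabeledQuad n p) (ρ : q.1.Vertex),
    q.1.restrictionClass ρ pn ε = some (Quotient.mk MarkedMap.setoid r) ∧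
    (q.1.dist ρ (q.1.vMinus ρ pn ε) = q.1.hitRadius ρ pn ε ∨
      q.1.dist ρ (q.1.vMinus ρ pn ε) = q.1.hitRadius ρ pn ε + 1) ∧
    (q.1.dist ρ (q.1.vPlus ρ pn ε) = q.1.hitRadius ρ pn ε ∨
      q.1.dist ρ (q.1.vPlus ρ pn ε) = q.1.hitRadius ρ pn ε + 1)

/-! ### Random pointed quadrangulations -/

instance {D : Type} [Finite D] : Finite (RootedMap D) :=
  Finite.of_injective (fun m : RootedMap D => (m.σ, m.α, m.root)) (by
    rintro ⟨s, a, r, h1, h2⟩ ⟨s', a', r', h1', h2'⟩ h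
    simp only [Prod.mk.injEq] at h
    obtain ⟨rfl, rfl, rfl⟩ := h
    rfl)

instance {D : Type} [Finite D] (m : RootedMap D) : Finite m.Vertex :=
  Quotient.finite (Equiv.Perm.SameCycle.setoid m.σ)

instance {D : Type} (m : RootedMap D) : Nonempty m.Vertex := ⟨m.tail m.root⟩

instance {D : Type} [Finite D] (m : RootedMap D) : Fintype m.Vertex := Fintype.ofFinite _

instance (n p : ℕ) : Finite (LabeledQuad n p) := Subtype.finite

instance (n p : ℕ) : Finite (SimpleQuad n p) := Quotient.finite (LabeledQuad.setoid n p)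

instance (n p : ℕ) : Fintype (SimpleQuad n p) := Fintype.ofFinite _

/-- A representative of a quadrangulation. -/
def SimpleQuad.rep {n p : ℕ} (q : SimpleQuad n p) : RootedMap (Fin (4 * n + p)) :=
  (Quotient.out q : LabeledQuad n p).1

/-- Pointed quadrangulations with a simple boundary. -/
def PointedQuad (n p : ℕ) : Type := Σ q : SimpleQuad n p, q.rep.Vertex

/-- The law of a uniform quadrangulation with a simple boundary of area `n` and perimeter `p`
pointed uniformly at random on one of its vertices. -/
def pointedLaw (n p : ℕ) [Nonempty (SimpleQuad n p)] : PMF (PointedQuad n p) :=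
  (PMF.uniformOfFintype (SimpleQuad n p)).bind fun q =>
    (PMF.uniformOfFintype q.rep.Vertex).map fun ρ => (⟨q, ρ⟩ : PointedQuad n p)

/-- The law of its restriction. -/
def restrictionLaw (n p : ℕ) [Nonempty (SimpleQuad n p)] (pn : ℕ) (ε : ℝ) :
    PMF (Option MarkedClass) :=
  (pointedLaw n p).map fun q => q.1.rep.restrictionClass q.2 pn ε

end PlaneQuad

end

/-!
A pointed quadrangulation `q` with restriction `r` is obtained from `r` by gluing, along the path
from `v⁻` to `v⁺` on the boundary of `r`, a quadrangulation with a simple boundary `c`: the part of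
`q` that was suppressed, or a single edge if nothing was. If the path has `k` edges, if `v⁻` is the
boundary vertex number `a` of `r`, and if the boundary of `r` has `l` edges after `v⁺`, then `c` has
area `|q| - |r|` and perimeter `m + k`, where `per q = a + m + l`. Conversely, filling `r` with any
such `c` gives a quadrangulation whose restriction is `r`, provided that its vertex `v⁺` is not
in `I`, that is, `⌊p_n / 3⌋ < a + m`. So `q ↦ c` is a bijection, and the probability is the number
of fillings divided by the number of pointed quadrangulations, all of which are equally likely since
Euler's relation fixes the number of vertices.

The topological content is that cutting `q` along the boundary of the suppressed part gives two
plane maps. Maps being encoded by permutations of their darts, the planarity of `q` is only known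
through Euler's relation, and it is used in the form of a duality modulo `2`: every set of edges
that is even at each vertex is the boundary of a set of faces, and every set of edges that crosses
each face an even number of times is the coboundary of a set of vertices
(`RootedMap.Planar.exists_face_potential`, `RootedMap.Planar.exists_vertex_potential`). The
suppressed faces and the remaining inner faces form two sets that are connected by adjacency
(`RootedMap.Restrictable.arcCut`). With the duality, this implies that the suppressed part meets the
boundary of `q` only between `v⁻` and `v⁺`, and that the edges between the two parts contain no
cycle (`RootedMap.ArcCut.nonarc`, `RootedMap.ArcCut.acyclic`); hence these edges form a simple
path, and `q` is a gluing of the two parts along this path (`RootedMap.ArcCut.gluing`).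

A gluing is handled through the embeddings of the darts of the two maps in those of `q`
(`Gluing`): its vertices, its faces and Euler's relation are computed from those of the two maps,
and the rotations of the two maps are first-return maps of the rotation of `q`. The gluing with the
roots that are used here is a `Completion`, and an embedding of `r` as the restriction of `q` is
`Carries`.

That the restriction of a completion of `r` is `r` relies on properties of `r` alone (`Core`). The
path is at distance at least the radius `R` of the ball from `ρ`; this is where the condition on the
distances of `v⁻` and `v⁺` is used, in the case where nothing is suppressed. So the distances
smaller than `R` are the same in `r` and in any completion of it, as are the balls of radius at
most `R`. All the inner faces along the path are in the ball of radius `R`, so that the suppressed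
faces are those of the filling (`Completion.hit`, `Completion.mem_outFaces_iff`,
`Completion.carries`). The gluing exists, is unique, and determines the filling, a connected rooted
map having no symmetries (`Gluing.gluing_glueMap`, `Completion.exists_isIso`,
`Completion.exists_isIso_filling`); this gives the bijection `card_restriction_eq`.
-/

namespace PlaneQuad

/-! ### Homology modulo two -/

section Homology

variable {D : Type}

/-- The functions modulo `2` that are constant on the cycles of a permutation. -/
def invFun (π : Equiv.Perm D) : Submodule (ZMod 2) (D → ZMod 2) where
  carrier := {f | ∀ d, f (π d) = f d}
  add_mem' hf hg d := by simp [hf d, hg d]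
  zero_mem' _ := rfl
  smul_mem' c f hf d := by simp [hf d]

lemma mem_invFun {π : Equiv.Perm D} {f : D → ZMod 2} :
    f ∈ invFun π ↔ ∀ d, f (π d) = f d := Iff.rfl

lemma apply_eq_of_sameCycle {T : Type*} {π : Equiv.Perm D} {f : D → T}
    (hf : ∀ d, f (π d) = f d) {x y : D} (h : π.SameCycle x y) : f x = f y := by
  obtain ⟨i, rfl⟩ := h
  have hinv : ∀ d, f (π⁻¹ d) = f d := fun d => by
    rw [← hf (π⁻¹ d)]
    exact congrArg f (π.apply_symm_apply d)
  induction i using Int.induction_on with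
  | zero => rfl
  | succ i ih => rw [ih, add_comm, zpow_add, zpow_one, Equiv.Perm.mul_apply, hf]
  | pred i ih =>
    rw [ih, sub_eq_add_neg, add_comm, zpow_add, zpow_neg_one, Equiv.Perm.mul_apply, hinv]

lemma finrank_invFun [Finite D] (π : Equiv.Perm D) :
    Module.finrank (ZMod 2) (invFun π) =
      Nat.card (Quotient (Equiv.Perm.SameCycle.setoid π)) := by
  classical
  let Q := Quotient (Equiv.Perm.SameCycle.setoid π)
  have : Finite Q := Quotient.finite _
  have : Fintype Q := Fintype.ofFinite _
  let e : (Q → ZMod 2) ≃ₗ[ZMod 2] invFun π :=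
    { toFun := fun g => ⟨fun d => g (Quotient.mk _ d), fun d => congrArg g (Quotient.sound (by
        exact Equiv.Perm.sameCycle_apply_left.2 (Equiv.Perm.SameCycle.refl π d)))⟩
      map_add' := fun _ _ => rfl
      map_smul' := fun _ _ => rfl
      invFun := fun f => Quotient.lift f.1 fun _ _ h => apply_eq_of_sameCycle f.2 h
      left_inv := fun g => by
        funext x
        induction x using Quotient.inductionOn with
        | h d => rfl
      right_inv := fun f => rfl }
  rw [← e.finrank_eq, Module.finrank_fintype_fun_eq_card, Nat.card_eq_fintype_card]

/-- The symmetrization `f ↦ f + f ∘ α`: the (co)boundary of a function on darts. -/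
def symmetrize (α : Equiv.Perm D) : (D → ZMod 2) →ₗ[ZMod 2] (D → ZMod 2) where
  toFun f d := f d + f (α d)
  map_add' f g := by funext d; simp only [Pi.add_apply]; ring
  map_smul' c f := by funext d; simp only [Pi.smul_apply, smul_eq_mul, RingHom.id_apply]; ring

lemma symmetrize_apply (α : Equiv.Perm D) (f : D → ZMod 2) (d : D) :
    symmetrize α f d = f d + f (α d) := rfl

lemma zmod_two_add_eq_zero {a b : ZMod 2} : a + b = 0 ↔ a = b := by
  revert a b; decide

lemma zmod_two_add_self (a : ZMod 2) : a + a = 0 := zmod_two_add_eq_zero.2 rfl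

lemma ker_symmetrize (α : Equiv.Perm D) : LinearMap.ker (symmetrize α) = invFun α := by
  ext f
  rw [LinearMap.mem_ker, mem_invFun, funext_iff]
  refine forall_congr' fun d => ?_
  rw [symmetrize_apply, Pi.zero_apply, zmod_two_add_eq_zero, eq_comm]

variable {α : Equiv.Perm D}

lemma range_symmetrize (hα : ∀ d, α (α d) = d) (hne : ∀ d, α d ≠ d) :
    LinearMap.range (symmetrize α) = invFun α := by
  classical
  ext h
  constructor
  · rintro ⟨f, rfl⟩ d
    rw [symmetrize_apply, symmetrize_apply, hα, add_comm]
  · intro hh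
    let Q := Quotient (Equiv.Perm.SameCycle.setoid α)
    let o : D → D := fun d => (Quotient.mk (Equiv.Perm.SameCycle.setoid α) d : Q).out
    have ho : ∀ d, o (α d) = o d := fun d =>
      congrArg Quotient.out (Quotient.sound
        (Equiv.Perm.sameCycle_apply_left.2 (Equiv.Perm.SameCycle.refl α d)))
    have hor : ∀ d, o d = d ∨ o d = α d := fun d => by
      have hs : α.SameCycle d (o d) :=
        Equiv.Perm.SameCycle.symm (Quotient.mk_out (s := Equiv.Perm.SameCycle.setoid α) d)
      have key : ∀ x, (x = d ∨ x = α d) = (α x = d ∨ α x = α d) := fun x => by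
        have h1 : α x = d ↔ x = α d := ⟨fun h => by rw [← h, hα], fun h => by rw [h, hα]⟩
        rw [h1, α.injective.eq_iff, or_comm]
      have := apply_eq_of_sameCycle (f := fun x => (x = d ∨ x = α d)) (fun x => (key x).symm) hs
      simpa using this
    refine ⟨fun d => if o d = d then h d else 0, funext fun d => ?_⟩
    rw [symmetrize_apply, ho]
    rcases hor d with h1 | h1
    · rw [if_pos h1, if_neg (by rw [h1]; exact (hne d).symm), add_zero]
    · rw [if_neg (by rw [h1]; exact hne d), if_pos h1, zero_add, hh d]

lemma finrank_inf_invFun [Nonempty D] {σ : Equiv.Perm D}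
    (hc : ∀ f : D → ZMod 2, f ∈ invFun σ → f ∈ invFun α → ∀ d d', f d = f d') :
    Module.finrank (ZMod 2) (invFun σ ⊓ invFun α : Submodule (ZMod 2) (D → ZMod 2)) = 1 := by
  let one : (invFun σ ⊓ invFun α : Submodule (ZMod 2) (D → ZMod 2)) :=
    ⟨fun _ => 1, fun _ => rfl, fun _ => rfl⟩
  have hone : one ≠ 0 := fun h => by
    have := congrFun (congrArg Subtype.val h) (Classical.arbitrary D)
    exact one_ne_zero this
  refine (finrank_eq_one_iff_of_nonzero' one hone).2 fun w =>
    ⟨w.1 (Classical.arbitrary D), Subtype.ext (funext fun d => ?_)⟩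
  rw [hc w.1 w.2.1 w.2.2 d (Classical.arbitrary D)]
  exact mul_one _

variable [Fintype D]

lemma two_mul_finrank_invFun (hα : ∀ d, α (α d) = d) (hne : ∀ d, α d ≠ d) :
    2 * Module.finrank (ZMod 2) (invFun α) = Fintype.card D := by
  have h := (symmetrize α).finrank_range_add_finrank_ker
  rw [ker_symmetrize, range_symmetrize hα hne, Module.finrank_fintype_fun_eq_card] at h
  omega

/-- The dot product on functions on darts. -/
noncomputable def dotForm (D : Type) [Fintype D] : LinearMap.BilinForm (ZMod 2) (D → ZMod 2) :=
  dotProductBilin (ZMod 2) (ZMod 2)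

lemma dotForm_apply (f g : D → ZMod 2) : dotForm D f g = ∑ d, f d * g d := rfl

lemma dotForm_nondegenerate : (dotForm D).Nondegenerate := by
  classical
  have h : ∀ f : D → ZMod 2, (∀ g, dotForm D f g = 0) → f = 0 := fun f hf => by
    funext d
    have := hf (Pi.single d 1)
    rw [dotForm_apply] at this
    simpa [Pi.single_apply] using this
  refine ⟨h, fun f hf => h f fun g => ?_⟩
  rw [← hf g, dotForm_apply, dotForm_apply]
  exact Finset.sum_congr rfl fun d _ => mul_comm _ _

/-- Functions on the vertices are orthogonal to the symmetrizations of functions on the faces. -/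
lemma sum_mul_symmetrize (hα : ∀ d, α (α d) = d) {σ φ : Equiv.Perm D} (hφ : ∀ d, φ d = σ (α d))
    {f g : D → ZMod 2} (hf : f ∈ invFun σ) (hg : g ∈ invFun φ) :
    ∑ d, f d * symmetrize α g d = 0 := by
  have h : ∀ d, f d * symmetrize α g d = f d * g d + f (σ d) * g (σ d) := fun d => by
    have h1 : g (α d) = g (σ d) := by rw [← hg (α d), hφ, hα]
    rw [symmetrize_apply, hf d, h1, mul_add]
  rw [Finset.sum_congr rfl fun d _ => h d, Finset.sum_add_distrib,
    Equiv.sum_comp σ fun d => f d * g d, zmod_two_add_self]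

/-- The functions orthogonal to all the functions on the vertices and to all the functions on the
edges are the symmetric functions (that is, the sets of edges) orthogonal to all the functions on
the vertices (that is, even at each vertex). -/
lemma mem_orthogonal_sup (hα : ∀ d, α (α d) = d) (hne : ∀ d, α d ≠ d) {σ : Equiv.Perm D}
    {h : D → ZMod 2} :
    h ∈ (dotForm D).orthogonal (invFun σ ⊔ invFun α) ↔
      h ∈ invFun α ∧ ∀ f ∈ invFun σ, ∑ d, f d * h d = 0 := by
  classical
  constructor
  · intro hh
    refine ⟨fun d => ?_, fun f hf => hh f (Submodule.mem_sup_left hf)⟩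
    have hm : (Pi.single d 1 + Pi.single (α d) 1 : D → ZMod 2) ∈ invFun α := fun x => by
      have h1 : α x = d ↔ x = α d := ⟨fun h => by rw [← h, hα], fun h => by rw [h, hα]⟩
      simp only [Pi.add_apply, Pi.single_apply, α.injective.eq_iff, h1]
      exact add_comm _ _
    have : dotForm D _ h = 0 := hh _ (Submodule.mem_sup_right hm)
    rw [dotForm_apply] at this
    simp only [Pi.add_apply, Pi.single_apply, add_mul, ite_mul, one_mul, zero_mul,
      Finset.sum_add_distrib, Finset.sum_ite_eq', Finset.mem_univ, if_true] at this
    exact (zmod_two_add_eq_zero.1 this).symm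
  · rintro ⟨h1, h2⟩ f hf
    obtain ⟨x, hx, y, hy, rfl⟩ := Submodule.mem_sup.1 hf
    change dotForm D (x + y) h = 0
    rw [dotForm_apply]
    simp only [Pi.add_apply, add_mul, Finset.sum_add_distrib]
    rw [h2 x hx, zero_add]
    -- `y = z + z ∘ α`, so that each edge contributes twice the same term
    obtain ⟨z, rfl⟩ : y ∈ LinearMap.range (symmetrize α) := by rwa [range_symmetrize hα hne]
    have h3 : ∀ d, symmetrize α z d * h d = z d * h d + z (α d) * h (α d) := fun d => by
      rw [symmetrize_apply, h1 d, add_mul]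
    rw [Finset.sum_congr rfl fun d _ => h3 d, Finset.sum_add_distrib,
      Equiv.sum_comp α fun d => z d * h d, zmod_two_add_self]

lemma finrank_map_symmetrize [Nonempty D] {φ : Equiv.Perm D}
    (hc : ∀ f : D → ZMod 2, f ∈ invFun φ → f ∈ invFun α → ∀ d d', f d = f d') :
    Module.finrank (ZMod 2) ((invFun φ).map (symmetrize α)) + 1 =
      Module.finrank (ZMod 2) (invFun φ) := by
  have h := ((symmetrize α).domRestrict (invFun φ)).finrank_range_add_finrank_ker
  rw [LinearMap.range_domRestrict, LinearMap.ker_domRestrict, ker_symmetrize] at h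
  rw [← h, ← finrank_inf_invFun hc, ← Submodule.map_comap_subtype,
    Submodule.finrank_map_subtype_eq]

lemma finrank_orthogonal_sup [Nonempty D] (hα : ∀ d, α (α d) = d) (hne : ∀ d, α d ≠ d)
    {σ : Equiv.Perm D} (hc : ∀ f : D → ZMod 2, f ∈ invFun σ → f ∈ invFun α → ∀ d d', f d = f d') :
    2 * (Module.finrank (ZMod 2) ((dotForm D).orthogonal (invFun σ ⊔ invFun α)) +
      Module.finrank (ZMod 2) (invFun σ)) = Fintype.card D + 2 := by
  have h1 := LinearMap.BilinForm.finrank_orthogonal (dotForm_nondegenerate (D := D))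
    (invFun σ ⊔ invFun α)
  have h2 := Submodule.finrank_sup_add_finrank_inf_eq (invFun σ) (invFun α)
  have h3 := Submodule.finrank_le (invFun σ ⊔ invFun α)
  rw [finrank_inf_invFun hc] at h2
  rw [Module.finrank_fintype_fun_eq_card] at h1 h3
  have h4 := two_mul_finrank_invFun hα hne
  omega

lemma map_symmetrize_le (hα : ∀ d, α (α d) = d) (hne : ∀ d, α d ≠ d) {σ φ : Equiv.Perm D}
    (hφ : ∀ d, φ d = σ (α d)) :
    (invFun φ).map (symmetrize α) ≤ (dotForm D).orthogonal (invFun σ ⊔ invFun α) := by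
  rintro _ ⟨g, hg, rfl⟩
  refine (mem_orthogonal_sup hα hne).2 ⟨?_, fun f hf => sum_mul_symmetrize hα hφ hf hg⟩
  rw [← range_symmetrize hα hne]
  exact LinearMap.mem_range_self _ _

end Homology

namespace RootedMap

variable {D : Type} (m : RootedMap D)

lemma φ_apply (d : D) : m.φ d = m.σ (m.α d) := rfl

lemma φ_α (d : D) : m.φ (m.α d) = m.σ d := by rw [φ_apply, m.α_α]

/-- A function that is constant along rotations and edges is constant on a connected map. -/
lemma Connected.apply_eq {m : RootedMap D} (hc : m.Connected) {T : Type*} {f : D → T}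
    (hσ : ∀ d, f (m.σ d) = f d) (hα : ∀ d, f (m.α d) = f d) (d d' : D) : f d = f d' := by
  induction hc d d' with
  | rel x y h => rcases h with rfl | rfl <;> simp [hσ, hα]
  | refl => rfl
  | symm _ _ _ ih => exact ih.symm
  | trans _ _ _ _ _ ih1 ih2 => exact ih1.trans ih2

lemma Connected.apply_eq_of_φ {m : RootedMap D} (hc : m.Connected) {T : Type*} {f : D → T}
    (hφ : ∀ d, f (m.φ d) = f d) (hα : ∀ d, f (m.α d) = f d) (d d' : D) : f d = f d' :=
  hc.apply_eq (fun x => by rw [← φ_α, hφ, hα]) hα d d'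

variable [Finite D]

/-- Euler's inequality: the genus of a connected map is nonnegative. -/
theorem Connected.euler_le {m : RootedMap D} (hc : m.Connected) :
    2 * (Nat.card m.Vertex + Nat.card m.Face) ≤ Nat.card D + 4 := by
  have : Fintype D := Fintype.ofFinite D
  have : Nonempty D := ⟨m.root⟩
  have h1 := finrank_map_symmetrize (α := m.α) (φ := m.φ) fun f h h' => hc.apply_eq_of_φ h h'
  have h2 := finrank_orthogonal_sup m.α_α m.α_ne (σ := m.σ) fun f h h' => hc.apply_eq h h'
  have h3 := Submodule.finrank_mono (map_symmetrize_le m.α_α m.α_ne (σ := m.σ) m.φ_apply)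
  rw [finrank_invFun] at h1 h2
  rw [Vertex, Face, Nat.card_eq_fintype_card (α := D)]
  omega

/-- On a plane map, every set of edges that is even at each vertex is the boundary of a set of
faces. -/
theorem Planar.exists_face_potential [Fintype D] {m : RootedMap D} (hp : m.Planar)
    (hc : m.Connected) {h : D → ZMod 2} (hα : ∀ d, h (m.α d) = h d)
    (hσ : ∀ f : D → ZMod 2, (∀ d, f (m.σ d) = f d) → ∑ d, f d * h d = 0) :
    ∃ g : D → ZMod 2, (∀ d, g (m.φ d) = g d) ∧ ∀ d, h d = g d + g (m.α d) := by
  have : Nonempty D := ⟨m.root⟩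
  have h1 := finrank_map_symmetrize (α := m.α) (φ := m.φ) fun f h h' => hc.apply_eq_of_φ h h'
  have h2 := finrank_orthogonal_sup m.α_α m.α_ne (σ := m.σ) fun f h h' => hc.apply_eq h h'
  rw [finrank_invFun] at h1 h2
  rw [Planar, Vertex, Face, Nat.card_eq_fintype_card (α := D)] at hp
  have h3 := Submodule.eq_of_le_of_finrank_eq
    (map_symmetrize_le m.α_α m.α_ne (σ := m.σ) m.φ_apply) (by omega)
  obtain ⟨g, hg, rfl⟩ : h ∈ (invFun m.φ).map (symmetrize m.α) := by
    rw [h3, mem_orthogonal_sup m.α_α m.α_ne]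
    exact ⟨hα, hσ⟩
  exact ⟨g, hg, fun d => rfl⟩

/-- On a plane map, every set of edges that crosses the boundary of each face an even number of
times is the set of edges between a set of vertices and its complement. -/
theorem Planar.exists_vertex_potential [Fintype D] {m : RootedMap D} (hp : m.Planar)
    (hc : m.Connected) {h : D → ZMod 2} (hα : ∀ d, h (m.α d) = h d)
    (hφ : ∀ f : D → ZMod 2, (∀ d, f (m.φ d) = f d) → ∑ d, f d * h d = 0) :
    ∃ g : D → ZMod 2, (∀ d, g (m.σ d) = g d) ∧ ∀ d, h d = g d + g (m.α d) := by
  have : Nonempty D := ⟨m.root⟩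
  have h1 := finrank_map_symmetrize (α := m.α) (φ := m.σ) fun f h h' => hc.apply_eq h h'
  have h2 := finrank_orthogonal_sup m.α_α m.α_ne (σ := m.φ) fun f h h' => hc.apply_eq_of_φ h h'
  rw [finrank_invFun] at h1 h2
  rw [Planar, Vertex, Face, Nat.card_eq_fintype_card (α := D)] at hp
  have h3 := Submodule.eq_of_le_of_finrank_eq
    (map_symmetrize_le m.α_α m.α_ne (σ := m.φ) (φ := m.σ) fun d => (m.φ_α d).symm) (by omega)
  obtain ⟨g, hg, rfl⟩ : h ∈ (invFun m.σ).map (symmetrize m.α) := by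
    rw [h3, mem_orthogonal_sup m.α_α m.α_ne]
    exact ⟨hα, hφ⟩
  exact ⟨g, hg, fun d => rfl⟩

end RootedMap

/-! ### First returns -/

section Returns

variable {D : Type}

/-- `y` is reached from `x` after at least one iteration of `σ`, the iterates strictly between
being outside `K`. -/
def Returns (σ : Equiv.Perm D) (K : Set D) (x y : D) : Prop :=
  ∃ n : ℕ, 1 ≤ n ∧ (σ ^ n) x = y ∧ ∀ l, 1 ≤ l → l < n → (σ ^ l) x ∉ K

lemma Returns.single {σ : Equiv.Perm D} {K : Set D} {x y : D} (h : σ x = y) : Returns σ K x y :=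
  ⟨1, le_rfl, by simpa using h, fun l h1 h2 => by omega⟩

lemma Returns.sameCycle {σ : Equiv.Perm D} {K : Set D} {x y : D} (h : Returns σ K x y) :
    σ.SameCycle x y := by
  obtain ⟨n, -, rfl, -⟩ := h
  exact Equiv.Perm.sameCycle_pow_right.2 (Equiv.Perm.SameCycle.refl σ x)

variable [Finite D]

lemma firstReturn_eq_of_returns {σ : Equiv.Perm D} {K : Set D} {x : K} {y : D}
    (h : Returns σ K x y) (hy : y ∈ K) : (firstReturn σ K x : D) = y := by
  obtain ⟨n, hn, rfl, hl⟩ := h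
  have h1 : returnTime σ K x ≤ n := Nat.sInf_le ⟨hn, hy⟩
  have h2 := returnTime_spec σ K x
  rcases h1.lt_or_eq with h3 | h3
  · exact absurd h2.2 (hl _ h2.1 h3)
  · change (σ ^ returnTime σ K x) (x : D) = _
    rw [h3]

lemma firstReturn_eq_apply {σ : Equiv.Perm D} {K : Set D} {x : K} (h : σ x ∈ K) :
    (firstReturn σ K x : D) = σ x :=
  firstReturn_eq_of_returns (Returns.single rfl) h

lemma returns_firstReturn (σ : Equiv.Perm D) (K : Set D) (x : K) :
    Returns σ K x (firstReturn σ K x) := by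
  refine ⟨returnTime σ K x, (returnTime_spec σ K x).1, rfl, fun l h1 h2 h3 => ?_⟩
  have : returnTime σ K x ≤ l := Nat.sInf_le ⟨h1, h3⟩
  omega

/-- The cycles of the induced permutation are the traces of the cycles. -/
lemma sameCycle_firstReturn {σ : Equiv.Perm D} {K : Set D} {x y : K} :
    (firstReturn σ K).SameCycle x y ↔ σ.SameCycle (x : D) y := by
  constructor
  · rintro h
    exact apply_eq_of_sameCycle (f := fun z : K => σ.SameCycle (x : D) z) (fun z => propext
      ⟨fun h => h.trans (returns_firstReturn σ K z).sameCycle.symm,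
        fun h => h.trans (returns_firstReturn σ K z).sameCycle⟩) h ▸
      Equiv.Perm.SameCycle.refl σ (x : D)
  · intro h
    obtain ⟨n, hn⟩ := h.exists_nat_pow_eq
    induction n using Nat.strong_induction_on generalizing x with
    | _ n ih =>
      rcases Nat.eq_zero_or_pos n with rfl | hpos
      · rw [Subtype.ext (by simpa using hn : (x : D) = y)]
      · have hle : returnTime σ K x ≤ n := Nat.sInf_le ⟨hpos, hn ▸ y.2⟩
        have h1 := (returnTime_spec σ K x).1
        obtain ⟨c, rfl⟩ := Nat.exists_eq_add_of_le hle
        rw [add_comm, pow_add, Equiv.Perm.mul_apply] at hn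
        have := ih c (by omega) (x := firstReturn σ K x)
          (h := ⟨c, hn⟩) hn
        exact Equiv.Perm.sameCycle_apply_left.1 this

end Returns

/-! ### Vertices, faces and boundary edges -/

namespace RootedMap

variable {D : Type} (m : RootedMap D)

lemma tail_eq_iff {d d' : D} : m.tail d = m.tail d' ↔ m.σ.SameCycle d d' :=
  Quotient.eq (r := Equiv.Perm.SameCycle.setoid m.σ)

lemma face_eq_iff {d d' : D} : m.face d = m.face d' ↔ m.φ.SameCycle d d' :=
  Quotient.eq (r := Equiv.Perm.SameCycle.setoid m.φ)

lemma tail_surjective (v : m.Vertex) : ∃ d, m.tail d = v := Quotient.exists_rep v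

lemma face_surjective (f : m.Face) : ∃ d, m.face d = f := Quotient.exists_rep f

@[simp] lemma tail_σ (d : D) : m.tail (m.σ d) = m.tail d :=
  m.tail_eq_iff.2 (Equiv.Perm.sameCycle_apply_left.2 (Equiv.Perm.SameCycle.refl _ d))

@[simp] lemma face_φ (d : D) : m.face (m.φ d) = m.face d :=
  m.face_eq_iff.2 (Equiv.Perm.sameCycle_apply_left.2 (Equiv.Perm.SameCycle.refl _ d))

lemma tail_φ (d : D) : m.tail (m.φ d) = m.tail (m.α d) := m.tail_σ _

lemma face_σ (d : D) : m.face (m.σ d) = m.face (m.α d) := by rw [← φ_α, face_φ]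

@[simp] lemma face_φ_pow (d : D) (t : ℕ) : m.face ((m.φ ^ t) d) = m.face d :=
  m.face_eq_iff.2 (Equiv.Perm.sameCycle_pow_left.2 (Equiv.Perm.SameCycle.refl _ d))

lemma φ_pow_succ (d : D) (t : ℕ) : (m.φ ^ (t + 1)) d = m.φ ((m.φ ^ t) d) := by
  rw [pow_succ', Equiv.Perm.mul_apply]

lemma φ_pow_succ_apply (d : D) (t : ℕ) : (m.φ ^ (t + 1)) d = (m.φ ^ t) (m.φ d) := by
  rw [pow_succ, Equiv.Perm.mul_apply]

lemma φ_pow_add (d : D) (s t : ℕ) : (m.φ ^ (s + t)) d = (m.φ ^ s) ((m.φ ^ t) d) := by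
  rw [pow_add, Equiv.Perm.mul_apply]

/-- A function on darts that is constant on the orbits of `σ` factors through `tail`. -/
lemma apply_eq_of_tail_eq {T : Type*} {f : D → T} (hf : ∀ d, f (m.σ d) = f d) {d d' : D}
    (h : m.tail d = m.tail d') : f d = f d' :=
  apply_eq_of_sameCycle hf (m.tail_eq_iff.1 h)

lemma apply_eq_of_face_eq {T : Type*} {f : D → T} (hf : ∀ d, f (m.φ d) = f d) {d d' : D}
    (h : m.face d = m.face d') : f d = f d' :=
  apply_eq_of_sameCycle hf (m.face_eq_iff.1 h)

lemma face_bEdge (i : ℕ) : m.face (m.bEdge i) = m.extFace := m.face_φ_pow _ _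

lemma φ_bEdge (i : ℕ) : m.φ (m.bEdge i) = m.bEdge (i + 1) := (m.φ_pow_succ _ _).symm

lemma φ_pow_bEdge (i j : ℕ) : (m.φ ^ i) (m.bEdge j) = m.bEdge (i + j) := (m.φ_pow_add _ _ _).symm

lemma tail_α_bEdge (i : ℕ) : m.tail (m.α (m.bEdge i)) = m.bVert (i + 1) := by
  rw [bVert, ← φ_bEdge, tail_φ]

variable [Finite D]

lemma degree_face (d : D) : m.degree (m.face d) = Function.minimalPeriod m.φ d := by
  have hp : ∀ i : ℕ, (m.φ ^ i) d = m.φ^[i] d := fun i => by rw [Equiv.Perm.iterate_eq_pow]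
  have hpos : 0 < Function.minimalPeriod m.φ d := by
    refine Function.minimalPeriod_pos_of_mem_periodicPts ⟨orderOf m.φ, orderOf_pos _, ?_⟩
    rw [Function.IsPeriodicPt, Function.IsFixedPt, ← hp, pow_orderOf_eq_one]
    rfl
  rw [degree, ← Nat.card_fin (Function.minimalPeriod m.φ d)]
  symm
  refine Nat.card_congr (Equiv.ofBijective (fun i => ⟨(m.φ ^ (i : ℕ)) d, m.face_φ_pow d i⟩)
    ⟨fun i j hij => Fin.ext ?_, fun y => ?_⟩)
  · have h := congrArg Subtype.val hij
    simp only [hp] at h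
    exact Function.iterate_injOn_Iio_minimalPeriod i.2 j.2 h
  · obtain ⟨n, hn⟩ := (m.face_eq_iff.1 y.2.symm).exists_nat_pow_eq
    refine ⟨⟨n % Function.minimalPeriod m.φ d, Nat.mod_lt _ hpos⟩, Subtype.ext ?_⟩
    simp only [hp, Function.iterate_mod_minimalPeriod_eq]
    rw [← hp, hn]

lemma degree_pos (f : m.Face) : 0 < m.degree f := by
  obtain ⟨d, rfl⟩ := m.face_surjective f
  have : Nonempty {d' : D // m.face d' = m.face d} := ⟨⟨d, rfl⟩⟩
  exact Nat.card_pos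

/-- The darts of a face are obtained by iterating `φ`. -/
lemma exists_φ_pow {d d' : D} (h : m.face d' = m.face d) :
    ∃ i, i < m.degree (m.face d) ∧ (m.φ ^ i) d = d' := by
  obtain ⟨n, hn⟩ := (m.face_eq_iff.1 h.symm).exists_nat_pow_eq
  refine ⟨n % Function.minimalPeriod m.φ d, ?_, ?_⟩
  · rw [← degree_face]
    exact Nat.mod_lt _ (m.degree_pos _)
  · rw [← hn, ← Equiv.Perm.iterate_eq_pow, ← Equiv.Perm.iterate_eq_pow,
      Function.iterate_mod_minimalPeriod_eq]

lemma φ_pow_injOn {d : D} {i j : ℕ} (hi : i < m.degree (m.face d)) (hj : j < m.degree (m.face d))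
    (h : (m.φ ^ i) d = (m.φ ^ j) d) : i = j := by
  rw [degree_face] at hi hj
  rw [← Equiv.Perm.iterate_eq_pow, ← Equiv.Perm.iterate_eq_pow] at h
  exact Function.iterate_injOn_Iio_minimalPeriod hi hj h

lemma φ_pow_degree (d : D) : (m.φ ^ m.degree (m.face d)) d = d := by
  rw [degree_face, ← Equiv.Perm.iterate_eq_pow]
  exact Function.iterate_minimalPeriod

lemma per_pos : 0 < m.per := m.degree_pos _

lemma exists_bEdge {d : D} (h : m.face d = m.extFace) : ∃ i, i < m.per ∧ m.bEdge i = d :=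
  m.exists_φ_pow h

lemma bEdge_injOn {i j : ℕ} (hi : i < m.per) (hj : j < m.per) (h : m.bEdge i = m.bEdge j) :
    i = j :=
  m.φ_pow_injOn hi hj h

lemma bEdge_per : m.bEdge m.per = m.root := m.φ_pow_degree _

lemma bEdge_add_per (i : ℕ) : m.bEdge (i + m.per) = m.bEdge i := by
  rw [← φ_pow_bEdge, bEdge_per]
  rfl

/-- The number of darts is the sum of the degrees of the faces. -/
lemma card_eq_of_degree_inner (h : ∀ f : m.Face, f ≠ m.extFace → m.degree f = 4) :
    Nat.card D = 4 * m.area + m.per := by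
  classical
  have : Fintype D := Fintype.ofFinite D
  have : Finite m.Face := Quotient.finite _
  have : Fintype m.Face := Fintype.ofFinite _
  rw [← Nat.card_congr (Equiv.sigmaFiberEquiv m.face), Nat.card_sigma,
    ← Finset.add_sum_erase _ (fun f => Nat.card {d // m.face d = f}) (Finset.mem_univ m.extFace),
    add_comm, per, degree, area]
  congr 1
  have h4 : ∀ f ∈ Finset.univ.erase m.extFace, Nat.card {d // m.face d = f} = 4 :=
    fun f hf => h f (Finset.ne_of_mem_erase hf)
  rw [Finset.sum_congr rfl h4, Finset.sum_const, smul_eq_mul, mul_comm, Nat.card_eq_fintype_card,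
    Fintype.card_subtype]
  congr 2
  ext f
  simp

lemma card_face : Nat.card m.Face = m.area + 1 := by
  classical
  have : Finite m.Face := Quotient.finite _
  have : Fintype m.Face := Fintype.ofFinite _
  rw [area, Nat.card_eq_fintype_card, Nat.card_eq_fintype_card, Fintype.card_subtype_compl,
    Fintype.card_subtype_eq]
  have : 0 < Fintype.card m.Face := Fintype.card_pos_iff.2 ⟨m.extFace⟩
  omega

end RootedMap

/-! ### Simple boundaries and dual connectivity -/

namespace RootedMap

variable {D : Type} {m : RootedMap D}

/-- The boundary of the external face does not visit a vertex twice. -/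
def SimpleBoundary (m : RootedMap D) : Prop :=
  ∀ d d' : D, m.face d = m.extFace → m.face d' = m.extFace → m.tail d = m.tail d' → d = d'

/-- A property of the faces that is preserved when crossing the edges at a vertex `v` between inner
faces takes the same value at all the inner faces around `v`: since the boundary is simple, the
external face interrupts the fan of the faces around `v` at most once. -/
lemma SimpleBoundary.fan [Finite D] (hs : m.SimpleBoundary) {P : m.Face → Prop} {v : m.Vertex}
    (hP : ∀ d, m.tail d = v → m.face d ≠ m.extFace → m.face (m.α d) ≠ m.extFace →
      (P (m.face d) ↔ P (m.face (m.α d)))) {d d' : D} (hd : m.tail d = v) (hd' : m.tail d' = v)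
    (hf : m.face d ≠ m.extFace) (hf' : m.face d' ≠ m.extFace) :
    P (m.face d) ↔ P (m.face d') := by
  have htail : ∀ (x : D) (l : ℕ), m.tail ((m.σ ^ l) x) = m.tail x := fun x l =>
    m.tail_eq_iff.2 (Equiv.Perm.sameCycle_pow_left.2 (Equiv.Perm.SameCycle.refl _ _))
  have hpow : ∀ (x : D) (l : ℕ), (m.σ ^ (l + 1)) x = m.σ ((m.σ ^ l) x) := fun x l => by
    rw [pow_succ', Equiv.Perm.mul_apply]
  by_cases hext : ∃ y, m.tail y = v ∧ m.face y = m.extFace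
  · obtain ⟨y, hy, hye⟩ := hext
    have key : ∀ l : ℕ, m.face ((m.σ ^ (l + 1)) y) ≠ m.extFace →
        (P (m.face ((m.σ ^ (l + 1)) y)) ↔ P (m.face (m.σ y))) := fun l => by
      induction l with
      | zero => intro _; simp
      | succ l ih =>
        intro hl
        by_cases h1 : m.face ((m.σ ^ (l + 1)) y) = m.extFace
        · have h2 : (m.σ ^ (l + 1)) y = y := hs _ _ h1 hye (htail _ _)
          rw [hpow, h2]
        · rw [hpow, face_σ] at hl
          rw [← ih h1, hpow, face_σ]
          exact (hP _ (by rw [htail, hy]) h1 hl).symm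
    have key' : ∀ x, m.tail x = v → m.face x ≠ m.extFace →
        (P (m.face x) ↔ P (m.face (m.σ y))) := fun x hx hxe => by
      obtain ⟨n, rfl⟩ := (m.tail_eq_iff.1 (hy.trans hx.symm)).exists_nat_pow_eq
      rcases n with _ | n
      · exact absurd hye (by simpa using hxe)
      · exact key n hxe
    rw [key' d hd hf, key' d' hd' hf']
  · push Not at hext
    obtain ⟨n, rfl⟩ := (m.tail_eq_iff.1 (hd.trans hd'.symm)).exists_nat_pow_eq
    clear hd' hf'
    induction n with
    | zero => simp
    | succ l ih =>
      refine ih.trans ?_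
      rw [hpow, face_σ]
      have h1 : m.tail ((m.σ ^ l) d) = v := by rw [htail, hd]
      refine hP _ h1 (hext _ h1) ?_
      rw [← face_σ]
      exact hext _ (by rw [tail_σ, h1])

/-- If there is an inner face, then every edge is incident to an inner face. -/
lemma SimpleBoundary.face_α_ne (hs : m.SimpleBoundary) (hc : m.Connected) {e : D}
    (he : m.face e ≠ m.extFace) {d : D} (hd : m.face d = m.extFace) :
    m.face (m.α d) ≠ m.extFace := by
  intro hd'
  have h1 : m.σ (m.α d) = m.α d := by
    rw [← φ_apply]
    exact hs _ _ (by rw [face_φ, hd]) hd' (m.tail_φ d)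
  have h2 : m.σ d = d := by
    rw [← φ_α]
    exact hs _ _ (by rw [face_φ, hd']) hd (by rw [tail_φ, m.α_α])
  have h3 : ∀ x, m.α x = d ↔ x = m.α d := fun x =>
    ⟨fun h => by rw [← h, m.α_α], fun h => by rw [h, m.α_α]⟩
  have := hc.apply_eq (f := fun x => (x = d ∨ x = m.α d))
    (fun x => propext (or_congr
      ⟨fun h => m.σ.injective (h.trans h2.symm), fun h => by rw [h, h2]⟩
      ⟨fun h => m.σ.injective (h.trans h1.symm), fun h => by rw [h, h1]⟩))
    (fun x => propext (by rw [h3, m.α.injective.eq_iff, or_comm])) d e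
  simp only [true_or, eq_iff_iff, true_iff] at this
  rcases this with rfl | rfl
  · exact he hd
  · exact he hd'

/-- The inner faces are connected by adjacency. -/
lemma SimpleBoundary.inner_connected [Finite D] (hs : m.SimpleBoundary) (hc : m.Connected)
    {P : m.Face → Prop}
    (hP : ∀ d, m.face d ≠ m.extFace → m.face (m.α d) ≠ m.extFace →
      (P (m.face d) ↔ P (m.face (m.α d)))) {d d' : D}
    (hf : m.face d ≠ m.extFace) (hf' : m.face d' ≠ m.extFace) :
    P (m.face d) ↔ P (m.face d') := by
  classical
  have hne : ∀ {x : D}, m.face x = m.extFace → m.face (m.α x) ≠ m.extFace :=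
    fun hx => hs.face_α_ne hc hf hx
  let s : D → Prop := fun x => if m.face x ≠ m.extFace then P (m.face x) else P (m.face (m.α x))
  have hsα : ∀ x, s (m.α x) = s x := fun x => by
    simp only [s, m.α_α]
    by_cases h1 : m.face x = m.extFace
    · simp [h1, hne h1]
    · by_cases h2 : m.face (m.α x) = m.extFace
      · simp [h1, h2]
      · simp [h1, h2, hP x h1 h2]
  have hsσ : ∀ x, s (m.σ x) = s x := fun x => by
    by_cases h2 : m.face (m.α x) = m.extFace
    · have h1 : m.face x ≠ m.extFace := by
        have := hne h2
        rwa [m.α_α] at this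
      have h3 : m.face (m.σ x) = m.extFace := by rw [face_σ, h2]
      have h4 := hne h3
      simp only [s, h1, h3, ne_eq, not_true_eq_false, not_false_eq_true, if_true, if_false]
      rw [← face_σ] at h4 ⊢
      exact propext (hs.fan (P := P) (v := m.tail x) (fun y _ => hP y)
        (by rw [tail_σ, tail_σ]) rfl h4 h1)
    · by_cases h1 : m.face x = m.extFace
      · simp [s, face_σ, h1, h2]
      · simp [s, face_σ, h1, h2, hP x h1 h2]
  have := hc.apply_eq hsσ hsα d d'
  simp only [s, ne_eq, hf, hf', not_false_eq_true, if_true] at this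
  rw [this]

lemma IsSimpleQuad.simpleBoundary {n p : ℕ} (h : m.IsSimpleQuad n p) : m.SimpleBoundary :=
  h.simple

end RootedMap

/-! ### The graph distance -/

namespace RootedMap

variable {D : Type} {m : RootedMap D}

lemma Connected.graph_connected (hc : m.Connected) : m.graph.Connected := by
  have : Nonempty m.Vertex := ⟨m.tail m.root⟩
  refine ⟨fun u v => ?_⟩
  obtain ⟨d, rfl⟩ := m.tail_surjective u
  obtain ⟨d', rfl⟩ := m.tail_surjective v
  have h : ∀ x, m.graph.Reachable (m.tail d) (m.tail (m.α x)) ↔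
      m.graph.Reachable (m.tail d) (m.tail x) := fun x => by
    by_cases hx : m.tail x = m.tail (m.α x)
    · rw [hx]
    · have hadj : m.graph.Adj (m.tail x) (m.tail (m.α x)) :=
        (SimpleGraph.fromRel_adj _ _ _).2 ⟨hx, Or.inl ⟨x, rfl, rfl⟩⟩
      exact ⟨fun h => h.trans hadj.symm.reachable, fun h => h.trans hadj.reachable⟩
  have := hc.apply_eq (f := fun x => m.graph.Reachable (m.tail d) (m.tail x))
    (fun x => by rw [tail_σ]) (fun x => propext (h x)) d d'
  exact this ▸ SimpleGraph.Reachable.refl _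

lemma Connected.dist_tail_α_le (hc : m.Connected) (ρ : m.Vertex) (d : D) :
    m.dist ρ (m.tail (m.α d)) ≤ m.dist ρ (m.tail d) + 1 := by
  by_cases hx : m.tail d = m.tail (m.α d)
  · rw [← hx]
    omega
  · have hadj : m.graph.Adj (m.tail d) (m.tail (m.α d)) :=
      (SimpleGraph.fromRel_adj _ _ _).2 ⟨hx, Or.inl ⟨d, rfl, rfl⟩⟩
    have h := hc.graph_connected.dist_triangle (u := ρ) (v := m.tail d) (w := m.tail (m.α d))
    rwa [SimpleGraph.dist_eq_one_iff_adj.2 hadj] at h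

lemma dist_self (ρ : m.Vertex) : m.dist ρ ρ = 0 := SimpleGraph.dist_self

lemma Connected.dist_eq_zero (hc : m.Connected) {ρ v : m.Vertex} (h : m.dist ρ v = 0) : ρ = v :=
  hc.graph_connected.dist_eq_zero_iff.1 h

/-- Induction along the geodesics from `ρ`. -/
lemma Connected.dist_induction (hc : m.Connected) {ρ : m.Vertex} {R : ℕ} {Q : m.Vertex → Prop}
    (h0 : Q ρ) (hstep : ∀ d, m.dist ρ (m.tail d) + 1 = m.dist ρ (m.tail (m.α d)) →
      m.dist ρ (m.tail (m.α d)) < R → Q (m.tail d) → Q (m.tail (m.α d)))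
    (v : m.Vertex) (hv : m.dist ρ v < R) : Q v := by
  generalize hk : m.dist ρ v = k at hv
  induction k generalizing v with
  | zero => rwa [← hc.dist_eq_zero hk]
  | succ k ih =>
    obtain ⟨w, hw⟩ := hc.graph_connected.exists_walk_length_eq_dist ρ v
    obtain ⟨w', hw'⟩ : ∃ w' : m.graph.Walk v ρ, w'.length = k + 1 :=
      ⟨w.reverse, by rw [SimpleGraph.Walk.length_reverse, hw]; exact hk⟩
    cases w' with
    | nil => simp at hw'
    | @cons _ u _ hadj w'' =>
      rw [SimpleGraph.Walk.length_cons, add_left_inj] at hw'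
      have hle : m.dist ρ u ≤ k := by
        have := SimpleGraph.dist_le w''.reverse
        rwa [SimpleGraph.Walk.length_reverse, hw'] at this
      have hex : ∃ d, m.tail d = u ∧ m.tail (m.α d) = v := by
        rcases ((SimpleGraph.fromRel_adj _ _ _).1 hadj).2 with ⟨d, h1, h2⟩ | ⟨d, h1, h2⟩
        · exact ⟨m.α d, h2, by rw [m.α_α, h1]⟩
        · exact ⟨d, h1, h2⟩
      obtain ⟨d, rfl, rfl⟩ := hex
      have h1 := hc.dist_tail_α_le ρ d
      exact hstep d (by omega) (by omega) (ih _ (by omega) (by omega))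

end RootedMap

/-! ### The faces cut off by an arc of the boundary -/

namespace RootedMap

variable {D : Type} {m : RootedMap D}

/-- The edges incident to a face of `T`, as a set of darts. -/
def edgesOf (m : RootedMap D) (T : Set m.Face) : Set D :=
  {d | m.face d ∈ T ∨ m.face (m.α d) ∈ T}

/-- A property of the faces of `T` that is preserved when crossing an edge between two faces of `T`
is constant on `T`. -/
def DualConnected (m : RootedMap D) (T : Set m.Face) : Prop :=
  ∀ P : m.Face → Prop, (∀ d, m.face d ∈ T → m.face (m.α d) ∈ T →
    (P (m.face d) ↔ P (m.face (m.α d)))) →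
    ∀ d d', m.face d ∈ T → m.face d' ∈ T → (P (m.face d) ↔ P (m.face d'))

/-- The inner faces that are not in `T`. -/
def innerCompl (m : RootedMap D) (T : Set m.Face) : Set m.Face := {f | f ≠ m.extFace ∧ f ∉ T}

/-- The inner faces are split into two dual connected sets `T` and `innerCompl T`; `T` is incident
to the boundary edges `a, …, b - 1` and to no vertex of `innerCompl T` strictly between the ends `a`
and `b` of this arc, while these two ends are incident to `innerCompl T`. -/
structure ArcCut (m : RootedMap D) (T : Set m.Face) (a b : ℕ) : Prop where
  ext_notMem : m.extFace ∉ T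
  a_lt : a < b
  b_lt : b < m.per
  arc_mem : ∀ i, a ≤ i → i < b → m.face (m.α (m.bEdge i)) ∈ T
  conn : m.DualConnected T
  conn_compl : m.DualConnected (m.innerCompl T)
  interior : ∀ i d, a < i → i < b → m.tail d = m.bVert i → m.face d ∉ m.innerCompl T
  left : ∃ d, m.tail d = m.bVert a ∧ m.face d ∈ m.innerCompl T
  right : ∃ d, m.tail d = m.bVert b ∧ m.face d ∈ m.innerCompl T

namespace ArcCut

variable {T : Set m.Face} {a b : ℕ}

lemma face_cases (m : RootedMap D) (T : Set m.Face) (d : D) :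
    m.face d = m.extFace ∨ m.face d ∈ T ∨ m.face d ∈ m.innerCompl T := by
  by_cases h1 : m.face d = m.extFace
  · exact Or.inl h1
  · by_cases h2 : m.face d ∈ T
    · exact Or.inr (Or.inl h2)
    · exact Or.inr (Or.inr ⟨h1, h2⟩)

/-- A function on the vertices that is constant along the edges incident to `innerCompl T` takes the
same value at the two ends of the arc. -/
lemma potential_eq [Finite D] (h : m.ArcCut T a b) {f : D → ZMod 2} (hσ : ∀ d, f (m.σ d) = f d)
    (hN : ∀ d, m.face d ∈ m.innerCompl T → f (m.α d) = f d) :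
    f (m.bEdge a) = f (m.bEdge b) := by
  obtain ⟨x, hx, hxN⟩ := h.left
  obtain ⟨y, hy, hyN⟩ := h.right
  rw [← m.apply_eq_of_tail_eq hσ hx, ← m.apply_eq_of_tail_eq hσ hy]
  have hφ : ∀ d, m.face d ∈ m.innerCompl T → ∀ d', m.face d' = m.face d → f d' = f d := by
    intro d hd d' hd'
    obtain ⟨i, -, rfl⟩ := m.exists_φ_pow hd'
    clear hd'
    induction i with
    | zero => rfl
    | succ i ih =>
      rw [φ_pow_succ, ← ih, m.apply_eq_of_tail_eq hσ (m.tail_φ _)]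
      exact hN _ (by rwa [face_φ_pow])
  have := h.conn_compl (fun g => ∀ d, m.face d = g → f d = f x) (fun d hd hd' => ?_) x y hxN hyN
  · exact ((this.1 fun d hd => hφ x hxN d hd) y rfl).symm
  · constructor
    · intro H d' h'
      rw [hφ _ hd' d' h', hN d hd, H d rfl]
    · intro H d' h'
      rw [hφ _ hd d' h', ← hN d hd, H _ rfl]

/-- Two faces of `T` are joined by a dual path in `T`; the function `c` is the indicator of the set
of the edges that it crosses. -/
lemma exists_dual_path [Fintype D] (h : m.ArcCut T a b) {x y : D} (hx : m.face x ∈ T)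
    (hy : m.face y ∈ T) :
    ∃ c : D → ZMod 2, (∀ d, c (m.α d) = c d) ∧ (∀ d, m.face d ∉ T → c d = 0) ∧
      ∀ f : D → ZMod 2, (∀ d, f (m.φ d) = f d) → ∑ d, f d * c d = f x + f y := by
  classical
  have := h.conn (fun g => ∃ c : D → ZMod 2, (∀ d, c (m.α d) = c d) ∧
    (∀ d, m.face d ∉ T → c d = 0) ∧
    ∀ f : D → ZMod 2, (∀ d, f (m.φ d) = f d) → ∀ y, m.face y = g → ∑ d, f d * c d = f x + f y)
    ?_ x y hx hy
  · obtain ⟨c, h1, h2, h3⟩ := this.1 ⟨0, fun _ => rfl, fun _ _ => rfl, fun f hf y hy => by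
      rw [m.apply_eq_of_face_eq hf hy, zmod_two_add_self]; simp⟩
    exact ⟨c, h1, h2, fun f hf => h3 f hf y rfl⟩
  · have key : ∀ d, m.face d ∈ T → m.face (m.α d) ∈ T → (∃ c : D → ZMod 2,
        (∀ d, c (m.α d) = c d) ∧ (∀ d, m.face d ∉ T → c d = 0) ∧
        ∀ f : D → ZMod 2, (∀ d, f (m.φ d) = f d) → ∀ y, m.face y = m.face d →
          ∑ d, f d * c d = f x + f y) → ∃ c : D → ZMod 2,
        (∀ d, c (m.α d) = c d) ∧ (∀ d, m.face d ∉ T → c d = 0) ∧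
        ∀ f : D → ZMod 2, (∀ d, f (m.φ d) = f d) → ∀ y, m.face y = m.face (m.α d) →
          ∑ d, f d * c d = f x + f y := by
      rintro d hd hd' ⟨c, h1, h2, h3⟩
      refine ⟨c + (Pi.single d 1 + Pi.single (m.α d) 1), fun z => ?_, fun z hz => ?_,
        fun f hf y hy => ?_⟩
      · have e1 : m.α z = d ↔ z = m.α d :=
          ⟨fun h => by rw [← h, m.α_α], fun h => by rw [h, m.α_α]⟩
        simp only [Pi.add_apply, Pi.single_apply, m.α.injective.eq_iff, e1, h1]
        ring
      · have e1 : z ≠ d := by rintro rfl; exact hz hd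
        have e2 : z ≠ m.α d := by rintro rfl; exact hz hd'
        simp [h2 z hz, e1, e2]
      · simp only [Pi.add_apply, mul_add, Finset.sum_add_distrib, Pi.single_apply, mul_ite, mul_one,
          mul_zero, Finset.sum_ite_eq', Finset.mem_univ, if_true]
        rw [h3 f hf d rfl, m.apply_eq_of_face_eq hf hy]
        linear_combination zmod_two_add_self (f d)
    intro d hd hd'
    refine ⟨key d hd hd', fun H => ?_⟩
    have := key (m.α d) hd' (by rwa [m.α_α])
    rw [m.α_α] at this
    exact this H

/-- The faces of `T` are not incident to the boundary outside the arc: otherwise, a closed dual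
curve through `T` and the external face would separate the two ends of the arc. -/
lemma nonarc [Finite D] (h : m.ArcCut T a b) (hp : m.Planar) (hc : m.Connected) {i : ℕ}
    (hi : i < m.per) (hi' : i < a ∨ b ≤ i) : m.face (m.α (m.bEdge i)) ∉ T := by
  classical
  intro hT
  have : Fintype D := Fintype.ofFinite D
  have hab := h.a_lt
  have hbp := h.b_lt
  obtain ⟨c, h1, h2, h3⟩ := h.exists_dual_path hT (h.arc_mem a le_rfl hab)
  have hext : ∀ j, m.face (m.bEdge j) ∉ T := fun j => by
    rw [face_bEdge]; exact h.ext_notMem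
  have hsym : ∀ z d, m.α z = d ↔ z = m.α d := fun z d =>
      ⟨fun h => by rw [← h, m.α_α], fun h => by rw [h, m.α_α]⟩
  let c' : D → ZMod 2 := c + (Pi.single (m.bEdge i) 1 + Pi.single (m.α (m.bEdge i)) 1) +
    (Pi.single (m.bEdge a) 1 + Pi.single (m.α (m.bEdge a)) 1)
  have hc'a : ∀ z, c' z = c z + ((if z = m.bEdge i then 1 else 0) +
      (if z = m.α (m.bEdge i) then 1 else 0)) + ((if z = m.bEdge a then 1 else 0) +
      (if z = m.α (m.bEdge a) then 1 else 0)) := fun z => by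
    simp only [c', Pi.add_apply, Pi.single_apply]
  obtain ⟨f, hf, hfc⟩ := hp.exists_vertex_potential hc (h := c') (fun z => by
    simp only [hc'a, h1, hsym, m.α_α]
    ring) (fun f hf => by
    simp only [hc'a, mul_add, Finset.sum_add_distrib, mul_ite, mul_one,
      mul_zero, Finset.sum_ite_eq', Finset.mem_univ, if_true]
    rw [h3 f hf, m.apply_eq_of_face_eq hf ((m.face_bEdge i).trans (m.face_bEdge a).symm)]
    linear_combination zmod_two_add_self (f (m.α (m.bEdge i))) +
      zmod_two_add_self (f (m.α (m.bEdge a))) + zmod_two_add_self (f (m.bEdge a)))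
  -- the curve crosses no edge incident to the complement of `T`
  have hN : ∀ d, m.face d ∈ m.innerCompl T → f (m.α d) = f d := fun d hd => by
    have hne : ∀ j, d ≠ m.bEdge j := fun j hj => hd.1 (by rw [hj, face_bEdge])
    have e1 : d ≠ m.α (m.bEdge i) := by rintro rfl; exact hd.2 hT
    have e2 : d ≠ m.α (m.bEdge a) := by rintro rfl; exact hd.2 (h.arc_mem a le_rfl hab)
    have := hfc d
    rw [hc'a, h2 d hd.2, if_neg (hne _), if_neg (hne _), if_neg e1, if_neg e2] at this
    simp only [add_zero] at this
    exact (zmod_two_add_eq_zero.1 this.symm).symm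
  -- and it crosses the arc once
  have harc : ∀ j, j < m.per → j ≠ i → c' (m.bEdge j) = if j = a then 1 else 0 := by
    intro j hj hji
    have e1 : m.bEdge j ≠ m.bEdge i := fun hh => hji (m.bEdge_injOn hj hi hh)
    have e2 : m.bEdge j ≠ m.α (m.bEdge i) := fun hh => hext j (hh ▸ hT)
    have e3 : m.bEdge j ≠ m.α (m.bEdge a) := fun hh =>
      hext j (hh ▸ h.arc_mem a le_rfl hab)
    have e4 : m.bEdge j = m.bEdge a ↔ j = a :=
      ⟨fun hh => m.bEdge_injOn hj (by omega) hh, fun hh => by rw [hh]⟩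
    rw [hc'a, h2 _ (hext j), if_neg e1, if_neg e2, if_neg e3]
    simp only [e4]
    ring
  have hnext : ∀ j, f (m.α (m.bEdge j)) = f (m.bEdge (j + 1)) := fun j =>
    m.apply_eq_of_tail_eq hf (m.tail_α_bEdge j)
  have hwalk : ∀ l, a + 1 + l ≤ b → f (m.bEdge (a + 1 + l)) = f (m.bEdge a) + 1 := fun l => by
    induction l with
    | zero =>
      intro _
      have h4 := hfc (m.bEdge a)
      rw [harc a (by omega) (by omega), if_pos rfl, hnext] at h4
      rw [add_zero, h4]
      linear_combination -zmod_two_add_self (f (m.bEdge a))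
    | succ l ih =>
      intro hl
      have h4 := hfc (m.bEdge (a + 1 + l))
      rw [harc _ (by omega) (by omega), if_neg (by omega), hnext] at h4
      rw [← ih (by omega)]
      exact (zmod_two_add_eq_zero.1 h4.symm).symm
  have h5 := hwalk (b - a - 1) (by omega)
  rw [show a + 1 + (b - a - 1) = b by omega, ← h.potential_eq hf hN] at h5
  simp at h5

/-- The edges between `T` and `innerCompl T` contain no cycle: a set of such edges that is even at
each vertex is empty. -/
lemma acyclic [Fintype D] (h : m.ArcCut T a b) (hp : m.Planar) (hc : m.Connected)
    (hs : m.SimpleBoundary) {z : D → ZMod 2} (hα : ∀ d, z (m.α d) = z d)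
    (hz : ∀ d, z d ≠ 0 → (m.face d ∈ T ∧ m.face (m.α d) ∈ m.innerCompl T) ∨
      (m.face d ∈ m.innerCompl T ∧ m.face (m.α d) ∈ T))
    (hσ : ∀ f : D → ZMod 2, (∀ d, f (m.σ d) = f d) → ∑ d, f d * z d = 0) : z = 0 := by
  obtain ⟨g, hg, hgz⟩ := hp.exists_face_potential hc hα hσ
  have hab := h.a_lt
  have hbp := h.b_lt
  have hsame : ∀ d, z d = 0 → g (m.α d) = g d := fun d hd => by
    rw [hgz] at hd
    exact (zmod_two_add_eq_zero.1 hd).symm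
  have hNT : ∀ d, m.face d ∈ m.innerCompl T → m.face d ∉ T := fun d hd => hd.2
  have hext : ∀ d, m.face d = m.extFace → m.face d ∉ T ∧ m.face d ∉ m.innerCompl T :=
    fun d hd => ⟨fun h' => h.ext_notMem (hd ▸ h'), fun h' => h'.1 hd⟩
  have hzero : ∀ d, (m.face d = m.extFace ∨ (m.face d ∈ T ∧ m.face (m.α d) ∈ T) ∨
      (m.face d ∈ m.innerCompl T ∧ m.face (m.α d) ∈ m.innerCompl T)) → z d = 0 := by
    intro d hd
    by_contra hne
    have h1 := hz d hne
    have h2 := hext d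
    have h3 := hNT d
    have h4 := hNT (m.α d)
    tauto
  have hb : ∀ j, g (m.α (m.bEdge j)) = g m.root := fun j => by
    rw [hsame _ (hzero _ (Or.inl (m.face_bEdge j)))]
    exact m.apply_eq_of_face_eq hg (m.face_bEdge j)
  have hconn : ∀ S : Set m.Face, m.DualConnected S →
      (∀ d, m.face d ∈ S → m.face (m.α d) ∈ S → z d = 0) →
      ∀ j, m.face (m.α (m.bEdge j)) ∈ S → ∀ d, m.face d ∈ S → g d = g m.root := by
    intro S hS hS0 j hj d hd
    have := hS (fun f => ∀ d, m.face d = f → g d = g m.root) (fun x hx hx' => ?_) _ _ hj hd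
    · exact this.1 (fun y hy => by rw [m.apply_eq_of_face_eq hg hy, hb]) d rfl
    · have hxx := hsame x (hS0 x hx hx')
      exact ⟨fun H y hy => by rw [m.apply_eq_of_face_eq hg hy, hxx, H x rfl],
        fun H y hy => by rw [m.apply_eq_of_face_eq hg hy, ← hxx, H _ rfl]⟩
  have hT := hconn T h.conn (fun d h1 h2 => hzero d (Or.inr (Or.inl ⟨h1, h2⟩))) a
    (h.arc_mem a le_rfl hab)
  obtain ⟨y, -, hy⟩ := h.right
  have hN := hconn (m.innerCompl T) h.conn_compl
    (fun d h1 h2 => hzero d (Or.inr (Or.inr ⟨h1, h2⟩))) b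
    ⟨hs.face_α_ne hc hy.1 (m.face_bEdge b), h.nonarc hp hc hbp (Or.inr le_rfl)⟩
  have hall : ∀ d, g d = g m.root := fun d => by
    rcases face_cases m T d with h1 | h1 | h1
    · exact m.apply_eq_of_face_eq hg h1
    · exact hT d h1
    · exact hN d h1
  funext d
  rw [hgz, hall, hall (m.α d), zmod_two_add_self]
  rfl

/-- The same, for a set `Z` of darts on the same side: it is empty as soon as each vertex is the
origin of as many darts of `Z` as it is the end. -/
lemma closed_eq_empty [Finite D] (h : m.ArcCut T a b) (hp : m.Planar) (hc : m.Connected)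
    (hs : m.SimpleBoundary) {Z : Finset D}
    (hZ : (∀ d ∈ Z, m.face d ∈ T ∧ m.face (m.α d) ∈ m.innerCompl T) ∨
      (∀ d ∈ Z, m.face d ∈ m.innerCompl T ∧ m.face (m.α d) ∈ T))
    (hσ : ∀ f : D → ZMod 2, (∀ d, f (m.σ d) = f d) → ∑ d ∈ Z, f (m.α d) = ∑ d ∈ Z, f d) :
    Z = ∅ := by
  classical
  have : Fintype D := Fintype.ofFinite D
  have hdisj : ∀ d ∈ Z, m.α d ∉ Z := by
    intro d hd hd'
    rcases hZ with hZ | hZ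
    · exact (hZ d hd).2.2 (hZ _ hd').1
    · exact (hZ _ hd').1.2 (hZ d hd).2
  have hz := h.acyclic hp hc hs (z := fun d => (if d ∈ Z then 1 else 0) +
    (if m.α d ∈ Z then 1 else 0)) (fun d => by rw [m.α_α, add_comm]) (fun d hd => ?_)
    (fun f hf => ?_)
  · rw [Finset.eq_empty_iff_forall_notMem]
    intro d hd
    have := congrFun hz d
    simp [hd, hdisj d hd] at this
  · by_cases h1 : d ∈ Z
    · rcases hZ with hZ | hZ
      · exact Or.inl (hZ d h1)
      · exact Or.inr (hZ d h1)
    · by_cases h2 : m.α d ∈ Z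
      · rcases hZ with hZ | hZ
        · have := hZ _ h2
          rw [m.α_α] at this
          exact Or.inr ⟨this.2, this.1⟩
        · have := hZ _ h2
          rw [m.α_α] at this
          exact Or.inl ⟨this.2, this.1⟩
      · simp [h1, h2] at hd
  · simp only [mul_add, Finset.sum_add_distrib]
    rw [← Equiv.sum_comp m.α fun d => f d * (if m.α d ∈ Z then 1 else 0)]
    simp only [m.α_α, mul_ite, mul_one, mul_zero, Finset.sum_ite_mem, Finset.univ_inter]
    rw [hσ f hf, zmod_two_add_self]

end ArcCut

end RootedMap

/-! ### The restriction as a cut along an arc -/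

namespace RootedMap

variable {D : Type} {m : RootedMap D} {ρ : m.Vertex} {pn : ℕ} {ε : ℝ}

lemma bddAbove_targetIdx (S : Set ℕ) : BddAbove {i | i ∈ targetIdx pn ε ∧ i ∈ S} :=
  ⟨⌊(pn : ℝ) / 3⌋₊, fun _ hi => hi.1.2⟩

section Indices

variable (h : m.Restrictable ρ pn ε)
include h

lemma Restrictable.hitRadius_mem : m.hitRadius ρ pn ε ∈ m.hitRadii ρ pn ε := Nat.sInf_mem h.2.2.1

lemma Restrictable.idxMinus_mem :
    m.idxMinus ρ pn ε ∈ targetIdx pn ε ∧ m.bVert (m.idxMinus ρ pn ε) ∈ m.hitVerts ρ pn ε := by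
  obtain ⟨i, hi, hi'⟩ := h.hitRadius_mem
  have hne : {i | i ∈ targetIdx pn ε ∧ m.bVert i ∈ m.hitVerts ρ pn ε}.Nonempty := ⟨i, hi, hi'⟩
  exact Nat.sSup_mem hne (bddAbove_targetIdx {i | m.bVert i ∈ m.hitVerts ρ pn ε})

lemma Restrictable.idxPlus_mem : m.idxPlus ρ pn ε ∈ m.otherSide ρ pn ε := Nat.sInf_mem h.2.2.2

lemma Restrictable.idxMinus_lt : m.idxMinus ρ pn ε < m.idxPlus ρ pn ε :=
  h.idxMinus_mem.1.2.trans_lt h.idxPlus_mem.1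

lemma Restrictable.notMem_hitVerts {i : ℕ} (h1 : m.idxMinus ρ pn ε < i)
    (h2 : i < m.idxPlus ρ pn ε) : m.bVert i ∉ m.hitVerts ρ pn ε := by
  intro hi
  by_cases h3 : i ≤ ⌊(pn : ℝ) / 3⌋₊
  · have : i ≤ m.idxMinus ρ pn ε :=
      le_csSup (bddAbove_targetIdx {i | m.bVert i ∈ m.hitVerts ρ pn ε})
        ⟨⟨h.idxMinus_mem.1.1.trans h1.le, h3⟩, hi⟩
    omega
  · have : m.idxPlus ρ pn ε ≤ i :=
      Nat.sInf_le ⟨not_le.1 h3, h2.trans h.idxPlus_mem.2.1, hi⟩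
    omega

lemma Restrictable.hitRadius_pos : 0 < m.hitRadius ρ pn ε := by
  obtain ⟨d, -, -, d', -, hd'⟩ := h.idxMinus_mem.2
  exact (Nat.zero_le _).trans_lt hd'

end Indices

lemma mem_hitVerts_of_tail {d : D} (h : m.face d ∈ m.hitFaces ρ pn ε) :
    m.tail d ∈ m.hitVerts ρ pn ε := ⟨d, rfl, h⟩

lemma mem_hitFaces_of_dist {d : D} (h : m.face d ≠ m.extFace)
    (hd : m.dist ρ (m.tail d) < m.hitRadius ρ pn ε) : m.face d ∈ m.hitFaces ρ pn ε :=
  ⟨h, d, rfl, hd⟩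

lemma mem_outFaces {f : m.Face} (h : f ∈ m.outFaces ρ pn ε) :
    f ≠ m.extFace ∧ f ∉ m.hitFaces ρ pn ε := by
  obtain ⟨i, -, -, h1, h2, h3⟩ := h
  rcases Relation.ReflTransGen.cases_tail h3 with rfl | ⟨g, -, hg⟩
  · exact ⟨h1, h2⟩
  · exact hg.2.1

lemma mem_outFaces_of_adj {d : D} (h : m.face d ∈ m.outFaces ρ pn ε)
    (hd : m.face (m.α d) ≠ m.extFace) (hd' : m.face (m.α d) ∉ m.hitFaces ρ pn ε) :
    m.face (m.α d) ∈ m.outFaces ρ pn ε := by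
  have h0 := mem_outFaces h
  obtain ⟨i, hi, hi', h1, h2, h3⟩ := h
  exact ⟨i, hi, hi', h1, h2, h3.tail ⟨h0, ⟨hd, hd'⟩, d, rfl, rfl⟩⟩

lemma kept_eq : m.kept ρ pn ε = m.edgesOf (m.innerCompl (m.outFaces ρ pn ε)) := rfl

lemma hitFaces_subset_innerCompl :
    m.hitFaces ρ pn ε ⊆ m.innerCompl (m.outFaces ρ pn ε) :=
  fun _ hf => ⟨hf.1, fun hf' => (mem_outFaces hf').2 hf⟩

/-- The inner faces that are not suppressed are connected by adjacency: the faces of the ball are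
connected through the vertices near `ρ`, and a remaining face that would not be connected to the
ball would not be connected to the rest of the map. -/
lemma Restrictable.dualConnected_innerCompl [Finite D] (h : m.Restrictable ρ pn ε)
    (hc : m.Connected) (hs : m.SimpleBoundary) :
    m.DualConnected (m.innerCompl (m.outFaces ρ pn ε)) := by
  intro P hP
  obtain ⟨x₀, hx₀, hx₀f⟩ := h.idxMinus_mem.2
  have hne : ∀ {x : D}, m.face x = m.extFace → m.face (m.α x) ≠ m.extFace :=
    fun hx => hs.face_α_ne hc hx₀f.1 hx
  have hnear : ∀ d, m.dist ρ (m.tail d) < m.hitRadius ρ pn ε → m.face d ≠ m.extFace →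
      m.face d ∈ m.innerCompl (m.outFaces ρ pn ε) := fun d hd hd' =>
    hitFaces_subset_innerCompl (mem_hitFaces_of_dist hd' hd)
  have hfan : ∀ d d', m.tail d = m.tail d' → m.dist ρ (m.tail d) < m.hitRadius ρ pn ε →
      m.face d ≠ m.extFace → m.face d' ≠ m.extFace → (P (m.face d) ↔ P (m.face d')) :=
    fun d d' hdd hd h1 h2 => hs.fan (v := m.tail d) (fun y hy hy1 hy2 => by
      refine hP y (hnear y (by rwa [hy]) hy1) ?_
      rw [← face_σ] at hy2 ⊢
      exact hnear _ (by rwa [tail_σ, hy]) hy2) rfl hdd.symm h1 h2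
  obtain ⟨y₀, hy₀, hy₀e⟩ : ∃ y, m.tail y = ρ ∧ m.face y ≠ m.extFace := by
    obtain ⟨y, hy⟩ := m.tail_surjective ρ
    by_cases hye : m.face y = m.extFace
    · exact ⟨m.σ y, by rw [tail_σ, hy], by rw [face_σ]; exact hne hye⟩
    · exact ⟨y, hy, hye⟩
  have hR := h.hitRadius_pos
  have hball : ∀ v, m.dist ρ v < m.hitRadius ρ pn ε → ∀ d, m.tail d = v →
      m.face d ≠ m.extFace → (P (m.face d) ↔ P (m.face y₀)) :=
    hc.dist_induction (fun d hd hde => hfan d y₀ (hd.trans hy₀.symm)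
      (by rw [hd, dist_self]; exact hR) hde hy₀e) (fun e he1 he2 ih d hd hde => by
      have he3 : m.dist ρ (m.tail e) < m.hitRadius ρ pn ε := by omega
      by_cases h1 : m.face e = m.extFace
      · rw [← ih (m.σ e) (by rw [tail_σ]) (by rw [face_σ]; exact hne h1), face_σ]
        exact hfan _ _ hd (by rwa [hd]) hde (hne h1)
      · by_cases h2 : m.face (m.α e) = m.extFace
        · rw [← ih e rfl h1]
          have h3 : m.face (m.σ (m.α e)) = m.face e := by rw [face_σ, m.α_α]
          rw [← h3] at h1 ⊢
          exact hfan _ _ (by rw [hd, tail_σ]) (by rwa [hd]) hde h1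
        · rw [← ih e rfl h1, hP e (hnear e he3 h1) (hnear _ he2 h2)]
          exact hfan _ _ hd (by rwa [hd]) hde h2)
  have hball' : ∀ d, m.face d ∈ m.hitFaces ρ pn ε → (P (m.face d) ↔ P (m.face y₀)) := by
    rintro d ⟨hd, d', hd', hdist⟩
    rw [← hd']
    exact hball _ hdist d' rfl (hd' ▸ hd)
  have hy₀h : m.face y₀ ∈ m.hitFaces ρ pn ε :=
    mem_hitFaces_of_dist hy₀e (by rw [hy₀, dist_self]; exact hR)
  suffices hall : ∀ d, m.face d ∈ m.innerCompl (m.outFaces ρ pn ε) →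
      (P (m.face d) ↔ P (m.face y₀)) from
    fun d d' hd hd' => (hall d hd).trans (hall d' hd').symm
  -- the remaining faces that would violate the claim
  let Q : m.Face → Prop := fun f => f ∈ m.innerCompl (m.outFaces ρ pn ε) ∧ ¬ (P f ↔ P (m.face y₀))
  have hQ : ∀ d, m.face d ≠ m.extFace → m.face (m.α d) ≠ m.extFace →
      Q (m.face d) → Q (m.face (m.α d)) := by
    rintro d h1 h2 ⟨h3, h4⟩
    have h5 : m.face (m.α d) ∉ m.outFaces ρ pn ε := fun h6 => by
      have := mem_outFaces_of_adj h6 (by rwa [m.α_α])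
        (by rw [m.α_α]; exact fun h7 => h4 (hball' d h7))
      rw [m.α_α] at this
      exact h3.2 this
    exact ⟨⟨h2, h5⟩, fun h6 => h4 ((hP d h3 ⟨h2, h5⟩).trans h6)⟩
  intro d hd
  by_contra hcon
  have := hs.inner_connected hc (P := Q) (fun d h1 h2 => ⟨hQ d h1 h2, fun h3 => by
    have := hQ (m.α d) h2 (by rwa [m.α_α]) h3
    rwa [m.α_α] at this⟩) hd.1 hy₀e
  exact (this.1 ⟨hd, hcon⟩).2 Iff.rfl

lemma Restrictable.exists_inner (h : m.Restrictable ρ pn ε) : ∃ x, m.face x ≠ m.extFace := by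
  obtain ⟨x, -, hx⟩ := h.idxMinus_mem.2
  exact ⟨x, hx.1⟩

/-- If some face is suppressed, then all the faces incident to the arc are. -/
lemma Restrictable.arc_mem_outFaces (h : m.Restrictable ρ pn ε)
    (hc : m.Connected) (hs : m.SimpleBoundary) (hne : (m.outFaces ρ pn ε).Nonempty) {i : ℕ}
    (hi : m.idxMinus ρ pn ε ≤ i) (hi' : i < m.idxPlus ρ pn ε) :
    m.face (m.α (m.bEdge i)) ∈ m.outFaces ρ pn ε := by
  obtain ⟨x, hx⟩ := h.exists_inner
  have hin := hs.face_α_ne hc hx (m.face_bEdge i)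
  refine ⟨i, hi, hi', hin, fun hmem => ?_, Relation.ReflTransGen.refl⟩
  -- a face of the ball incident to an edge of the arc would be incident to an interior vertex
  by_cases h1 : m.idxMinus ρ pn ε < i
  · refine h.notMem_hitVerts h1 hi' ?_
    have := mem_hitVerts_of_tail (m := m) (d := m.φ (m.α (m.bEdge i))) (by rwa [face_φ])
    rwa [tail_φ, m.α_α] at this
  · by_cases h2 : i + 1 < m.idxPlus ρ pn ε
    · refine h.notMem_hitVerts (by omega) h2 ?_
      rw [← tail_α_bEdge]
      exact mem_hitVerts_of_tail hmem
    · obtain ⟨f, j, hj, hj', -, h3, -⟩ := hne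
      obtain rfl : j = i := by omega
      exact h3 hmem

lemma Restrictable.arcCut [Finite D] (h : m.Restrictable ρ pn ε)
    (hc : m.Connected) (hs : m.SimpleBoundary) (hne : (m.outFaces ρ pn ε).Nonempty) :
    m.ArcCut (m.outFaces ρ pn ε) (m.idxMinus ρ pn ε) (m.idxPlus ρ pn ε) where
  ext_notMem h' := (mem_outFaces h').1 rfl
  a_lt := h.idxMinus_lt
  b_lt := h.idxPlus_mem.2.1
  arc_mem i hi hi' := h.arc_mem_outFaces hc hs hne hi hi'
  conn := by
    intro P hP
    have hface : ∀ f, f ∈ m.outFaces ρ pn ε → ∃ i, m.idxMinus ρ pn ε ≤ i ∧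
        i < m.idxPlus ρ pn ε ∧ (P f ↔ P (m.face (m.α (m.bEdge i)))) := by
      rintro f ⟨i, hi, hi', h1, h2, h3⟩
      refine ⟨i, hi, hi', ?_⟩
      have : f ∈ m.outFaces ρ pn ε ∧ (P f ↔ P (m.face (m.α (m.bEdge i)))) := by
        induction h3 with
        | refl => exact ⟨h.arc_mem_outFaces hc hs hne hi hi', Iff.rfl⟩
        | tail _ hbc ih =>
          obtain ⟨-, hg, d, rfl, rfl⟩ := hbc
          have h4 := mem_outFaces_of_adj ih.1 hg.1 hg.2
          exact ⟨h4, (hP d ih.1 h4).symm.trans ih.2⟩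
      exact this.2
    have harc : ∀ l, m.idxMinus ρ pn ε + l < m.idxPlus ρ pn ε →
        (P (m.face (m.α (m.bEdge (m.idxMinus ρ pn ε + l)))) ↔
          P (m.face (m.α (m.bEdge (m.idxMinus ρ pn ε))))) := by
      intro l
      induction l with
      | zero => intro _; rfl
      | succ l ih =>
        intro hl
        rw [← ih (by omega)]
        set i := m.idxMinus ρ pn ε + l with hi
        have h1 := h.arc_mem_outFaces hc hs hne (i := i) (by omega) (by omega)
        have h2 := h.arc_mem_outFaces hc hs hne (i := i + 1) (by omega) (by omega)
        have hout : ∀ y, m.tail y = m.bVert (i + 1) → m.face y ∉ m.hitFaces ρ pn ε :=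
          fun y hy hy' => h.notMem_hitVerts (i := i + 1) (by omega) (by omega)
            (hy ▸ mem_hitVerts_of_tail hy')
        have hfan := hs.fan (P := fun f => f ∈ m.outFaces ρ pn ε ∧ P f) (v := m.bVert (i + 1))
          (fun y hy hy1 hy2 => ?_) (d := m.α (m.bEdge i)) (d' := m.σ (m.bEdge (i + 1)))
          (m.tail_α_bEdge i) (m.tail_σ _) (mem_outFaces h1).1
          (by rw [face_σ]; exact (mem_outFaces h2).1)
        · rw [face_σ] at hfan
          have e : m.idxMinus ρ pn ε + (l + 1) = i + 1 := by omega
          rw [e]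
          exact ⟨fun hh => (hfan.2 ⟨h2, hh⟩).2, fun hh => (hfan.1 ⟨h1, hh⟩).2⟩
        · have h3 := hout y hy
          have h4 : m.face (m.α y) ∉ m.hitFaces ρ pn ε := by
            rw [← face_σ]; exact hout _ (by rw [tail_σ, hy])
          constructor
          · rintro ⟨h5, h6⟩
            have h7 := mem_outFaces_of_adj h5 hy2 h4
            exact ⟨h7, (hP y h5 h7).1 h6⟩
          · rintro ⟨h5, h6⟩
            have h7 := mem_outFaces_of_adj h5 (by rwa [m.α_α]) (by rwa [m.α_α])
            rw [m.α_α] at h7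
            exact ⟨h7, (hP y h7 h5).2 h6⟩
    intro d d' hd hd'
    obtain ⟨i, hi, hi', h1⟩ := hface _ hd
    obtain ⟨j, hj, hj', h2⟩ := hface _ hd'
    obtain ⟨l, rfl⟩ := Nat.exists_eq_add_of_le hi
    obtain ⟨k, rfl⟩ := Nat.exists_eq_add_of_le hj
    rw [h1, h2, harc l hi', harc k hj']
  conn_compl := h.dualConnected_innerCompl hc hs
  interior i d hi hi' hd hdN := by
    obtain ⟨x, hx⟩ := h.exists_inner
    have hout : ∀ y, m.tail y = m.bVert i → m.face y ∉ m.hitFaces ρ pn ε :=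
      fun y hy hy' => h.notMem_hitVerts hi hi' (hy ▸ mem_hitVerts_of_tail hy')
    have h2 := h.arc_mem_outFaces hc hs hne hi.le hi'
    have hfan := hs.fan (P := fun f => f ∈ m.outFaces ρ pn ε) (v := m.bVert i)
      (fun y hy hy1 hy2 => ?_) (d := d) (d' := m.σ (m.bEdge i)) hd (m.tail_σ _) hdN.1
      (by rw [face_σ]; exact (mem_outFaces h2).1)
    · rw [face_σ] at hfan
      exact hdN.2 (hfan.2 h2)
    · have h3 := hout y hy
      have h4 : m.face (m.α y) ∉ m.hitFaces ρ pn ε := by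
        rw [← face_σ]; exact hout _ (by rw [tail_σ, hy])
      refine ⟨fun h5 => mem_outFaces_of_adj h5 hy2 h4, fun h5 => ?_⟩
      have h7 := mem_outFaces_of_adj h5 (by rwa [m.α_α]) (by rwa [m.α_α])
      rwa [m.α_α] at h7
  left := by
    obtain ⟨d, hd, hd'⟩ := h.idxMinus_mem.2
    exact ⟨d, hd, hitFaces_subset_innerCompl hd'⟩
  right := by
    obtain ⟨d, hd, hd'⟩ := h.idxPlus_mem.2.2
    exact ⟨d, hd, hitFaces_subset_innerCompl hd'⟩

/-- If no face is suppressed, then the arc consists of a single edge. -/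
lemma Restrictable.idxPlus_eq (h : m.Restrictable ρ pn ε)
    (hc : m.Connected) (hs : m.SimpleBoundary) (hne : m.outFaces ρ pn ε = ∅) :
    m.idxPlus ρ pn ε = m.idxMinus ρ pn ε + 1 := by
  have hlt := h.idxMinus_lt
  by_contra hcon
  obtain ⟨x, hx⟩ := h.exists_inner
  set i := m.idxMinus ρ pn ε with hi
  have hin := hs.face_α_ne hc hx (m.face_bEdge i)
  have hmem : m.face (m.α (m.bEdge i)) ∈ m.hitFaces ρ pn ε := by
    by_contra hout
    have : m.face (m.α (m.bEdge i)) ∈ m.outFaces ρ pn ε :=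
      ⟨i, le_rfl, hlt, hin, hout, Relation.ReflTransGen.refl⟩
    rw [hne] at this
    exact this
  refine h.notMem_hitVerts (i := i + 1) (by omega) (by omega) ?_
  rw [← tail_α_bEdge]
  exact mem_hitVerts_of_tail hmem

end RootedMap

/-! ### Gluing two maps along a path -/

/-- The map `q` is obtained by gluing the maps `X` and `Y` along a path of `k` edges of their
external faces: `φ x, …, φ ^ k x` in `X`, which is glued, in the opposite direction, to
`φ y, …, φ ^ k y` in `Y`. The darts of `X` and of `Y` are embedded in those of `q` by `i` and `j`;
each edge of the path has the dart of `X` on the external side identified with the dart of `Y` on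
the inner side, and conversely. The boundary of `q` goes from `x` to `φ ^ (k + 1) y` and from `y`
to `φ ^ (k + 1) x`. The path has to visit `k + 1` distinct vertices. -/
structure Gluing {D E F : Type} (q : RootedMap D) (X : RootedMap E) (Y : RootedMap F) (k : ℕ)
    (x : E) (y : F) (i : E → D) (j : F → D) : Prop where
  k_pos : 0 < k
  i_inj : Function.Injective i
  j_inj : Function.Injective j
  i_α : ∀ d, i (X.α d) = q.α (i d)
  j_α : ∀ d, j (Y.α d) = q.α (j d)
  cover : ∀ z, (∃ d, i d = z) ∨ ∃ e, j e = z
  overlap : ∀ d e, i d = j e → ∃ t, t < k ∧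
    ((d = (X.φ ^ (t + 1)) x ∧ e = Y.α ((Y.φ ^ (k - t)) y)) ∨
      (d = X.α ((X.φ ^ (t + 1)) x) ∧ e = (Y.φ ^ (k - t)) y))
  glue : ∀ t, t < k → i ((X.φ ^ (t + 1)) x) = j (Y.α ((Y.φ ^ (k - t)) y))
  φ_i : ∀ d, (∀ t, t ≤ k → d ≠ (X.φ ^ t) x) → q.φ (i d) = i (X.φ d)
  φ_j : ∀ e, (∀ t, t ≤ k → e ≠ (Y.φ ^ t) y) → q.φ (j e) = j (Y.φ e)
  φ_i_start : q.φ (i x) = j ((Y.φ ^ (k + 1)) y)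
  φ_j_start : q.φ (j y) = i ((X.φ ^ (k + 1)) x)
  tail_X : ∀ s t, s ≤ k → t ≤ k →
    X.tail ((X.φ ^ (s + 1)) x) = X.tail ((X.φ ^ (t + 1)) x) → s = t
  tail_Y : ∀ s t, s ≤ k → t ≤ k →
    Y.tail ((Y.φ ^ (s + 1)) y) = Y.tail ((Y.φ ^ (t + 1)) y) → s = t

namespace Gluing

variable {D E F : Type} {q : RootedMap D} {X : RootedMap E} {Y : RootedMap F} {k : ℕ} {x : E}
  {y : F} {i : E → D} {j : F → D}

lemma symm (g : Gluing q X Y k x y i j) : Gluing q Y X k y x j i where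
  k_pos := g.k_pos
  i_inj := g.j_inj
  j_inj := g.i_inj
  i_α := g.j_α
  j_α := g.i_α
  cover z := (g.cover z).symm
  overlap d e h := by
    obtain ⟨t, ht, h'⟩ := g.overlap e d h.symm
    refine ⟨k - 1 - t, by omega, ?_⟩
    rw [show k - 1 - t + 1 = k - t by omega, show k - (k - 1 - t) = t + 1 by omega]
    rcases h' with h' | h'
    · exact Or.inr ⟨h'.2, h'.1⟩
    · exact Or.inl ⟨h'.2, h'.1⟩
  glue t ht := by
    have := g.glue (k - 1 - t) (by omega)
    rw [show k - 1 - t + 1 = k - t by omega, show k - (k - 1 - t) = t + 1 by omega] at this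
    rw [g.i_α, this, ← g.j_α, Y.α_α]
  φ_i := g.φ_j
  φ_j := g.φ_i
  φ_i_start := g.φ_j_start
  φ_j_start := g.φ_i_start
  tail_X := g.tail_Y
  tail_Y := g.tail_X

lemma tail_α_pow (X : RootedMap E) (x : E) (t : ℕ) :
    X.tail (X.α ((X.φ ^ t) x)) = X.tail ((X.φ ^ (t + 1)) x) := by
  rw [X.φ_pow_succ, X.tail_φ]

/-- An edge of the path is not visited twice. -/
lemma α_ne (g : Gluing q X Y k x y i j) {s t : ℕ} (hs : s < k) (ht : t < k) :
    X.α ((X.φ ^ (s + 1)) x) ≠ (X.φ ^ (t + 1)) x := by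
  intro h
  have h1 := g.tail_X (s + 1) t (by omega) (by omega) (by rw [← tail_α_pow, h])
  have h2 := g.tail_X (t + 1) s (by omega) (by omega) (by rw [← tail_α_pow, ← h, X.α_α])
  omega

lemma pow_ne (g : Gluing q X Y k x y i j) {t : ℕ} (ht : t < k) : x ≠ (X.φ ^ (t + 1)) x := by
  intro h
  have := g.tail_X 0 (t + 1) (by omega) (by omega) (by
    rw [X.φ_pow_succ x (t + 1), ← h]
    rfl)
  omega

lemma σ_i (g : Gluing q X Y k x y i j) {d : E} (h : ∀ t, t ≤ k → X.α d ≠ (X.φ ^ t) x) :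
    q.σ (i d) = i (X.σ d) := by
  rw [← q.φ_α, ← g.i_α, g.φ_i _ h, X.φ_α]

lemma σ_i_start (g : Gluing q X Y k x y i j) {d : E} (h : X.α d = x) :
    q.σ (i d) = j ((Y.φ ^ (k + 1)) y) := by
  rw [← q.φ_α, ← g.i_α, h, g.φ_i_start]

lemma i_eq_j (g : Gluing q X Y k x y i j) {d : E} {t : ℕ} (ht : t < k)
    (h : X.α d = (X.φ ^ (t + 1)) x) : i d = j ((Y.φ ^ (k - t)) y) := by
  have h1 := g.glue t ht
  rw [← h, g.i_α, g.j_α] at h1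
  exact q.α.injective h1

/-- The rotation around a vertex of the path, restricted to the darts of `Y`. -/
lemma rotate [Finite F] (g : Gluing q X Y k x y i j) {s : ℕ} (hs : s ≤ k) :
    ∃ n, (∀ l, l ≤ n → (q.σ ^ l) (j ((Y.φ ^ (s + 1)) y)) = j ((Y.σ ^ l) ((Y.φ ^ (s + 1)) y))) ∧
      (Y.σ ^ n) ((Y.φ ^ (s + 1)) y) = Y.α ((Y.φ ^ s) y) ∧
      (∀ l, l < n → ∀ t, t ≤ k → Y.α ((Y.σ ^ l) ((Y.φ ^ (s + 1)) y)) ≠ (Y.φ ^ t) y) ∧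
      ∀ l, l < n → (1 ≤ l ∨ s = k) → ∀ d, i d ≠ j ((Y.σ ^ l) ((Y.φ ^ (s + 1)) y)) := by
  classical
  set e := (Y.φ ^ (s + 1)) y with he
  have hex : ∃ n, ∃ t, t ≤ k ∧ Y.α ((Y.σ ^ n) e) = (Y.φ ^ t) y := by
    have : Y.σ.SameCycle e (Y.α ((Y.φ ^ s) y)) := by
      rw [he, ← Y.tail_eq_iff, tail_α_pow]
    obtain ⟨n, hn⟩ := this.exists_nat_pow_eq
    exact ⟨n, s, hs, by rw [hn, Y.α_α]⟩
  set n := Nat.find hex with hn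
  have hmin : ∀ l, l < n → ∀ t, t ≤ k → Y.α ((Y.σ ^ l) e) ≠ (Y.φ ^ t) y := fun l hl t ht h =>
    Nat.find_min hex hl ⟨t, ht, h⟩
  have htail : ∀ l, Y.tail ((Y.σ ^ l) e) = Y.tail e := fun l =>
    Y.tail_eq_iff.2 (Equiv.Perm.sameCycle_pow_left.2 (Equiv.Perm.SameCycle.refl _ _))
  refine ⟨n, fun l => ?_, ?_, hmin, fun l hl hls d hd => ?_⟩
  · induction l with
    | zero => intro _; rfl
    | succ l ih =>
      intro hl
      rw [pow_succ', Equiv.Perm.mul_apply, ih (by omega), pow_succ', Equiv.Perm.mul_apply]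
      exact g.symm.σ_i (hmin l (by omega))
  · obtain ⟨t, ht, h⟩ := Nat.find_spec hex
    rw [← hn] at h
    have h1 : (Y.σ ^ n) e = Y.α ((Y.φ ^ t) y) := by rw [← h, Y.α_α]
    have := g.tail_Y t s ht hs (by rw [← tail_α_pow, ← h1, htail])
    rw [h1, this]
  · obtain ⟨t, ht, h | h⟩ := g.overlap _ _ hd
    · exact hmin l hl (k - t) (by omega) (by rw [h.2, Y.α_α])
    · obtain ⟨u, hu⟩ : ∃ u, k - t = u + 1 := ⟨k - t - 1, by omega⟩
      rw [hu] at h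
      have hsu := g.tail_Y u s (by omega) hs (by rw [← h.2, htail])
      have hl1 : 1 ≤ l := by
        rcases hls with h1 | h1 <;> omega
      -- the rotation would be periodic of period `l`
      have hper : (Y.σ ^ l) e = e := by rw [h.2, he, hsu]
      obtain ⟨t', ht', h'⟩ := Nat.find_spec hex
      rw [← hn] at h'
      refine hmin (n - l) (by omega) t' ht' ?_
      rw [← h']
      conv_rhs => rw [show n = (n - l) + l by omega, pow_add, Equiv.Perm.mul_apply, hper]

/-- The rotation of `X` is the first return of the rotation of `q` to the darts of `X`. -/
lemma returns_i [Finite F] (g : Gluing q X Y k x y i j) (d : E) :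
    Returns q.σ (Set.range i) (i d) (i (X.σ d)) := by
  by_cases h0 : X.α d = x
  · obtain ⟨n, h1, h2, h2', h3⟩ := g.rotate (s := k) le_rfl
    refine ⟨n + 1, by omega, ?_, fun l hl hl' => ?_⟩
    · rw [pow_succ, Equiv.Perm.mul_apply, g.σ_i_start h0, h1 n le_rfl, h2, ← X.φ_α, h0]
      exact (g.glue 0 g.k_pos).symm
    · obtain ⟨l, rfl⟩ : ∃ u, l = u + 1 := ⟨l - 1, by omega⟩
      rw [pow_succ, Equiv.Perm.mul_apply, g.σ_i_start h0, h1 l (by omega)]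
      rintro ⟨d', hd'⟩
      exact h3 l (by omega) (Or.inr rfl) d' hd'
  · by_cases h : ∃ t, t < k ∧ X.α d = (X.φ ^ (t + 1)) x
    · obtain ⟨t, ht, h⟩ := h
      obtain ⟨s, hs⟩ : ∃ s, k - t = s + 1 := ⟨k - t - 1, by omega⟩
      obtain ⟨n, h1, h2, h2', h3⟩ := g.rotate (s := s) (by omega)
      have hid := g.i_eq_j ht h
      rw [hs] at hid
      rcases Nat.eq_zero_or_pos s with rfl | hspos
      · -- the end of the path: the rotation goes on through the boundary of `q`
        refine ⟨n + 1, by omega, ?_, fun l hl hl' => ?_⟩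
        · rw [pow_succ', Equiv.Perm.mul_apply, hid, h1 n le_rfl, h2,
            g.symm.σ_i_start (by rw [Y.α_α]; rfl), ← X.φ_α, h, ← X.φ_pow_succ,
            show t + 1 = k by omega]
        · rw [hid, h1 l (by omega)]
          rintro ⟨d', hd'⟩
          rcases (Nat.lt_succ_iff.1 hl').lt_or_eq with hln | rfl
          · exact h3 l hln (Or.inl hl) d' hd'
          · rw [h2] at hd'
            obtain ⟨u, hu, h4 | h4⟩ := g.overlap _ _ hd'
            · have h5 := Y.α.injective h4.2
              obtain ⟨v, hv⟩ : ∃ v, k - u = v + 1 := ⟨k - u - 1, by omega⟩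
              rw [hv] at h5
              exact g.symm.pow_ne (t := v) (by omega) h5
            · obtain ⟨v, hv⟩ : ∃ v, k - u = v + 1 := ⟨k - u - 1, by omega⟩
              rw [hv] at h4
              have hv0 := g.tail_Y 0 v (by omega) (by omega) (by rw [← h4.2, tail_α_pow])
              subst hv0
              refine h2' 0 (by omega) 0 (by omega) ?_
              rw [← h4.2, pow_zero, pow_zero, Equiv.Perm.one_apply, Equiv.Perm.one_apply, Y.α_α]
      · refine ⟨n, ?_, ?_, fun l hl hl' => ?_⟩
        · by_contra hn
          obtain rfl : n = 0 := by omega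
          obtain ⟨u, rfl⟩ : ∃ u, s = u + 1 := ⟨s - 1, by omega⟩
          exact g.symm.α_ne (s := u) (t := u + 1) (by omega) (by omega) h2.symm
        · rw [hid, h1 n le_rfl, h2, ← X.φ_α, h, ← X.φ_pow_succ, g.glue (t + 1) (by omega),
            show k - (t + 1) = s by omega]
        · rw [hid, h1 l (by omega)]
          rintro ⟨d', hd'⟩
          exact h3 l hl' (Or.inl hl) d' hd'
    · refine Returns.single (g.σ_i fun t ht h' => ?_)
      rcases t with _ | t
      · exact h0 h'
      · exact h ⟨t, by omega, h'⟩

/-! #### Vertices of a gluing -/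

lemma tail_i [Finite F] (g : Gluing q X Y k x y i j) {d d' : E} (h : X.tail d = X.tail d') :
    q.tail (i d) = q.tail (i d') :=
  X.apply_eq_of_tail_eq (f := fun d => q.tail (i d))
    (fun d => (q.tail_eq_iff.2 (g.returns_i d).sameCycle).symm) h

/-- The vertices of the path are identified. -/
lemma tail_path [Finite E] [Finite F] (g : Gluing q X Y k x y i j) {t : ℕ} (ht : t ≤ k) :
    q.tail (i ((X.φ ^ (t + 1)) x)) = q.tail (j ((Y.φ ^ (k - t + 1)) y)) := by
  rcases ht.lt_or_eq with ht | rfl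
  · rw [g.glue t ht]
    exact g.symm.tail_i (tail_α_pow _ _ _)
  · obtain ⟨t, rfl⟩ : ∃ u, t = u + 1 := ⟨t - 1, by have := g.k_pos; omega⟩
    have := g.symm.glue 0 (by omega)
    rw [Nat.sub_self, this]
    exact (g.tail_i (tail_α_pow _ _ _)).symm

/-- A function on the vertices of `q` is given by functions on the vertices of `X` and of `Y` that
agree on the path. -/
lemma exists_desc (g : Gluing q X Y k x y i j) {T : Type*} {f₁ : E → T} {f₂ : F → T}
    (h₁ : ∀ d, f₁ (X.σ d) = f₁ d) (h₂ : ∀ e, f₂ (Y.σ e) = f₂ e)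
    (h : ∀ t, t ≤ k → f₁ ((X.φ ^ (t + 1)) x) = f₂ ((Y.φ ^ (k - t + 1)) y)) :
    ∃ f : D → T, (∀ z, f (q.σ z) = f z) ∧ (∀ d, f (i d) = f₁ d) ∧ ∀ e, f (j e) = f₂ e := by
  classical
  have hα : ∀ (e : F) (t : ℕ), f₂ (Y.α ((Y.φ ^ t) e)) = f₂ ((Y.φ ^ (t + 1)) e) := fun e t =>
    Y.apply_eq_of_tail_eq h₂ (tail_α_pow _ _ _)
  have hα' : ∀ (d : E) (t : ℕ), f₁ (X.α ((X.φ ^ t) d)) = f₁ ((X.φ ^ (t + 1)) d) := fun d t =>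
    X.apply_eq_of_tail_eq h₁ (tail_α_pow _ _ _)
  have hij : ∀ d e, i d = j e → f₁ d = f₂ e := fun d e hde => by
    obtain ⟨t, ht, ⟨rfl, rfl⟩ | ⟨rfl, rfl⟩⟩ := g.overlap d e hde
    · rw [hα, h t ht.le]
    · rw [hα', h (t + 1) ht, show k - (t + 1) + 1 = k - t by omega]
  let f : D → T := fun z => if hz : ∃ d, i d = z then f₁ hz.choose else
    f₂ ((g.cover z).resolve_left hz).choose
  have hfi : ∀ d, f (i d) = f₁ d := fun d => by
    have hz : ∃ d', i d' = i d := ⟨d, rfl⟩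
    simp only [f, dif_pos hz]
    rw [g.i_inj hz.choose_spec]
  have hfj : ∀ e, f (j e) = f₂ e := fun e => by
    by_cases hz : ∃ d, i d = j e
    · obtain ⟨d, hd⟩ := hz
      rw [← hd, hfi, hij d e hd]
    · simp only [f, dif_neg hz]
      rw [g.j_inj ((g.cover (j e)).resolve_left hz).choose_spec]
  -- the step is symmetric in `X` and `Y`
  have hstep : ∀ {E F : Type} {X : RootedMap E} {Y : RootedMap F} {x : E} {y : F} {i : E → D}
      {j : F → D} {f₁ : E → T} {f₂ : F → T}, Gluing q X Y k x y i j →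
      (∀ d, f₁ (X.σ d) = f₁ d) → (∀ e, f₂ (Y.σ e) = f₂ e) →
      (∀ t, t ≤ k → f₁ ((X.φ ^ (t + 1)) x) = f₂ ((Y.φ ^ (k - t + 1)) y)) →
      (∀ d, f (i d) = f₁ d) → (∀ e, f (j e) = f₂ e) → ∀ d, f (q.σ (i d)) = f (i d) := by
    intro E F X Y x y i j f₁ f₂ g h₁ h₂ h hfi hfj d
    have hd : f₁ d = f₁ (X.φ (X.α d)) := by rw [X.φ_α, h₁]
    by_cases h0 : X.α d = x
    · rw [g.σ_i_start h0, hfj, hfi, hd, h0]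
      exact (h 0 (Nat.zero_le _)).symm
    · by_cases h' : ∃ t, t < k ∧ X.α d = (X.φ ^ (t + 1)) x
      · obtain ⟨t, ht, h'⟩ := h'
        have hid := g.i_eq_j ht h'
        by_cases hy : Y.α ((Y.φ ^ (k - t)) y) = y
        · rw [hid, g.symm.σ_i_start hy, hfi, ← hid, hfi, hd, h', ← X.φ_pow_succ]
          obtain ⟨v, hv⟩ : ∃ v, k - t = v + 1 := ⟨k - t - 1, by omega⟩
          have : 0 = v := by
            refine g.tail_Y 0 v (by omega) (by omega) ?_
            rw [← hv, ← tail_α_pow]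
            refine Eq.trans ?_ (congrArg Y.tail (Y.α_α _))
            rw [hy]
            rfl
          rw [show t + 1 = k by omega]
        · rw [hid, g.symm.σ_i, hfj, h₂, ← hfj]
          intro s hs hs'
          rcases s with _ | s
          · exact hy hs'
          · obtain ⟨v, hv⟩ : ∃ v, k - t = v + 1 := ⟨k - t - 1, by omega⟩
            rw [hv] at hs'
            exact g.symm.α_ne (s := v) (t := s) (by omega) (by omega) hs'
      · rw [g.σ_i, hfi, hfi, h₁]
        intro t ht ht'
        rcases t with _ | t
        · exact h0 ht'
        · exact h' ⟨t, by omega, ht'⟩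
  refine ⟨f, fun z => ?_, hfi, hfj⟩
  rcases g.cover z with ⟨d, rfl⟩ | ⟨e, rfl⟩
  · exact hstep g h₁ h₂ h hfi hfj d
  · refine hstep g.symm h₂ h₁ (fun t ht => ?_) hfj hfi e
    rw [h (k - t) (by omega), show k - (k - t) = t by omega]

/-- The vertices of `q` are those of `X` and those of `Y` that are not on the path. -/
lemma exists_vertex_code (g : Gluing q X Y k x y i j) :
    ∃ f : D → X.Vertex ⊕ Y.Vertex, (∀ z, f (q.σ z) = f z) ∧
      (∀ d, f (i d) = Sum.inl (X.tail d)) ∧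
      ∀ e, (∃ t, t ≤ k ∧ Y.tail e = Y.tail ((Y.φ ^ (k - t + 1)) y) ∧
        f (j e) = Sum.inl (X.tail ((X.φ ^ (t + 1)) x))) ∨
        ((∀ t, t ≤ k → Y.tail e ≠ Y.tail ((Y.φ ^ (t + 1)) y)) ∧ f (j e) = Sum.inr (Y.tail e)) := by
  classical
  let f₂ : F → X.Vertex ⊕ Y.Vertex := fun e =>
    if h : ∃ t, t ≤ k ∧ Y.tail e = Y.tail ((Y.φ ^ (k - t + 1)) y) then
      Sum.inl (X.tail ((X.φ ^ (h.choose + 1)) x)) else Sum.inr (Y.tail e)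
  obtain ⟨f, h1, h2, h3⟩ := g.exists_desc
    (f₁ := fun d => (Sum.inl (X.tail d) : X.Vertex ⊕ Y.Vertex))
    (f₂ := f₂) (fun d => by rw [X.tail_σ]) (fun e => by simp only [f₂, Y.tail_σ]) (fun t ht => by
      have h : ∃ u, u ≤ k ∧ Y.tail ((Y.φ ^ (k - t + 1)) y) = Y.tail ((Y.φ ^ (k - u + 1)) y) :=
        ⟨t, ht, rfl⟩
      simp only [f₂, dif_pos h]
      have := g.tail_Y _ _ (by omega) (by omega) h.choose_spec.2
      have := h.choose_spec.1
      rw [show h.choose = t by omega])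
  refine ⟨f, h1, h2, fun e => ?_⟩
  by_cases h : ∃ t, t ≤ k ∧ Y.tail e = Y.tail ((Y.φ ^ (k - t + 1)) y)
  · refine Or.inl ⟨h.choose, h.choose_spec.1, h.choose_spec.2, ?_⟩
    rw [h3]
    simp only [f₂, dif_pos h]
  · refine Or.inr ⟨fun t ht hte => h ⟨k - t, by omega, ?_⟩, ?_⟩
    · rw [show k - (k - t) = t by omega, hte]
    · rw [h3]
      simp only [f₂, dif_neg h]

lemma tail_i_iff [Finite F] (g : Gluing q X Y k x y i j) {d d' : E} :
    q.tail (i d) = q.tail (i d') ↔ X.tail d = X.tail d' := by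
  refine ⟨fun h => ?_, g.tail_i⟩
  obtain ⟨f, h1, h2, -⟩ := g.exists_vertex_code
  have := q.apply_eq_of_tail_eq h1 h
  rw [h2, h2] at this
  exact Sum.inl_injective this

/-- A vertex that comes both from `X` and from `Y` is on the path. -/
lemma exists_of_tail_eq (g : Gluing q X Y k x y i j) {d : E} {e : F}
    (h : q.tail (i d) = q.tail (j e)) : ∃ t, t ≤ k ∧ X.tail d = X.tail ((X.φ ^ (t + 1)) x) ∧
      Y.tail e = Y.tail ((Y.φ ^ (k - t + 1)) y) := by
  obtain ⟨f, h1, h2, h3⟩ := g.exists_vertex_code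
  have := q.apply_eq_of_tail_eq h1 h
  rw [h2] at this
  rcases h3 e with ⟨t, ht, h4, h5⟩ | ⟨-, h5⟩
  · rw [h5] at this
    exact ⟨t, ht, Sum.inl_injective this, h4⟩
  · rw [h5] at this
    cases this

lemma card_vertex [Finite D] [Finite E] [Finite F] (g : Gluing q X Y k x y i j) :
    Nat.card q.Vertex + (k + 1) = Nat.card X.Vertex + Nat.card Y.Vertex := by
  classical
  let S : Set Y.Vertex := {w | ∃ t, t ≤ k ∧ w = Y.tail ((Y.φ ^ (t + 1)) y)}
  have hS : Nat.card S = k + 1 := by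
    rw [← Nat.card_fin (k + 1)]
    symm
    refine Nat.card_congr (Equiv.ofBijective
      (fun t : Fin (k + 1) => (⟨_, t, Nat.lt_succ_iff.1 t.2, rfl⟩ : S)) ⟨fun s t hst => ?_, ?_⟩)
    · exact Fin.ext (g.tail_Y s t (Nat.lt_succ_iff.1 s.2) (Nat.lt_succ_iff.1 t.2)
        (congrArg Subtype.val hst))
    · rintro ⟨w, t, ht, rfl⟩
      exact ⟨⟨t, Nat.lt_succ_iff.2 ht⟩, rfl⟩
  have hY : Nat.card S + Nat.card (Sᶜ : Set Y.Vertex) = Nat.card Y.Vertex := by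
    rw [← Nat.card_sum]
    exact Nat.card_congr (Equiv.Set.sumCompl S)
  obtain ⟨f, h1, h2, h3⟩ := g.exists_vertex_code
  choose c hc using X.tail_surjective
  choose c' hc' using Y.tail_surjective
  let π : X.Vertex ⊕ (Sᶜ : Set Y.Vertex) → q.Vertex :=
    Sum.elim (fun v => q.tail (i (c v))) (fun w => q.tail (j (c' w)))
  have hf2 : ∀ w : (Sᶜ : Set Y.Vertex), f (j (c' w)) = Sum.inr (w : Y.Vertex) := fun w => by
    rcases h3 (c' w) with ⟨t, ht, h4, -⟩ | ⟨-, h5⟩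
    · exact absurd ⟨k - t, by omega, by rw [← hc' w, h4]⟩ w.2
    · rw [h5, hc']
  have hπ : Function.Bijective π := by
    constructor
    · rintro (v | w) (v' | w') hvw
      · have := q.apply_eq_of_tail_eq h1 hvw
        rw [h2, h2, hc, hc] at this
        rw [Sum.inl_injective this]
      · have := q.apply_eq_of_tail_eq h1 hvw
        rw [h2, hf2] at this
        cases this
      · have := q.apply_eq_of_tail_eq h1 hvw
        rw [h2, hf2] at this
        cases this
      · have := q.apply_eq_of_tail_eq h1 hvw
        rw [hf2, hf2] at this
        rw [Subtype.ext (Sum.inr_injective this)]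
    · intro v
      obtain ⟨z, rfl⟩ := q.tail_surjective v
      rcases g.cover z with ⟨d, rfl⟩ | ⟨e, rfl⟩
      · exact ⟨Sum.inl (X.tail d), g.tail_i (hc _)⟩
      · by_cases h : Y.tail e ∈ S
        · obtain ⟨t, ht, h⟩ := h
          refine ⟨Sum.inl (X.tail ((X.φ ^ (k - t + 1)) x)), (g.tail_i (hc _)).trans ?_⟩
          rw [g.tail_path (by omega), show k - (k - t) = t by omega]
          exact g.symm.tail_i h.symm
        · exact ⟨Sum.inr ⟨Y.tail e, h⟩, g.symm.tail_i (hc' _)⟩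
  have := Nat.card_congr (Equiv.ofBijective π hπ)
  rw [Nat.card_sum] at this
  omega

lemma connected [Finite E] [Finite F] (g : Gluing q X Y k x y i j) (hX : X.Connected)
    (hY : Y.Connected) : q.Connected := by
  let s := Relation.EqvGen fun x y => y = q.σ x ∨ y = q.α x
  have hs : Equivalence s := Relation.EqvGen.is_equivalence _
  have hσ : ∀ z z', q.σ.SameCycle z z' → s z z' := fun z z' h => by
    have := apply_eq_of_sameCycle (f := fun z' => s z z') (fun d => propext
      ⟨fun h => hs.trans h (hs.symm (Relation.EqvGen.rel _ _ (Or.inl rfl))),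
        fun h => hs.trans h (Relation.EqvGen.rel _ _ (Or.inl rfl))⟩) h
    exact this ▸ hs.refl z
  have hα : ∀ z, s z (q.α z) := fun z => Relation.EqvGen.rel _ _ (Or.inr rfl)
  have hside : ∀ {E F : Type} {X : RootedMap E} {Y : RootedMap F} {x : E} {y : F} {i : E → D}
      {j : F → D} [Finite E] [Finite F], Gluing q X Y k x y i j → X.Connected →
      ∀ d d', s (i d) (i d') := by
    intro E F X Y x y i j _ _ g hX d d'
    have := hX.apply_eq (f := fun d' => s (i d) (i d')) (fun e => propext ?_)
      (fun e => propext ?_) d d'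
    · exact this ▸ hs.refl _
    · have h1 := hσ _ _ (q.tail_eq_iff.1 (g.tail_i (X.tail_σ e)))
      exact ⟨fun h => hs.trans h h1, fun h => hs.trans h (hs.symm h1)⟩
    · have h1 : s (i e) (i (X.α e)) := by rw [g.i_α]; exact hα _
      exact ⟨fun h => hs.trans h (hs.symm h1), fun h => hs.trans h h1⟩
  have hcross : ∀ d e, s (i d) (j e) := fun d e => by
    have h1 := hside g hX d ((X.φ ^ (0 + 1)) x)
    rw [g.glue 0 g.k_pos] at h1
    exact hs.trans h1 (hside g.symm hY _ _)
  intro z z'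
  rcases g.cover z with ⟨d, rfl⟩ | ⟨e, rfl⟩ <;> rcases g.cover z' with ⟨d', rfl⟩ | ⟨e', rfl⟩
  · exact hside g hX _ _
  · exact hcross _ _
  · exact hs.symm (hcross _ _)
  · exact hside g.symm hY _ _

/-- The two sides of the edges of the path are counted twice. -/
lemma card_dart [Finite E] [Finite F] (g : Gluing q X Y k x y i j) :
    Nat.card D + 2 * k = Nat.card E + Nat.card F := by
  classical
  let S : Set F := {e | ∃ d, i d = j e}
  have hb : ∀ s t : Fin k, (Y.φ ^ ((s : ℕ) + 1)) y = (Y.φ ^ ((t : ℕ) + 1)) y → s = t := fun s t h =>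
    Fin.ext (g.tail_Y s t s.2.le t.2.le (by rw [h]))
  have hS : Nat.card S = 2 * k := by
    have hcard : Nat.card (Fin k ⊕ Fin k) = 2 * k := by
      rw [Nat.card_sum, Nat.card_fin, two_mul]
    rw [← hcard]
    symm
    have hmem1 : ∀ t : Fin k, (Y.φ ^ ((t : ℕ) + 1)) y ∈ S := fun t => by
      have := g.symm.glue t t.2
      exact ⟨_, this.symm⟩
    have hmem2 : ∀ t : Fin k, Y.α ((Y.φ ^ ((t : ℕ) + 1)) y) ∈ S := fun t => by
      obtain ⟨d, hd⟩ := hmem1 t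
      exact ⟨X.α d, by rw [g.i_α, hd, g.j_α]⟩
    refine Nat.card_congr (Equiv.ofBijective
      (Sum.elim (fun t => (⟨_, hmem1 t⟩ : S)) (fun t => ⟨_, hmem2 t⟩)) ⟨?_, ?_⟩)
    · rintro (s | s) (t | t) hst
      · rw [hb s t (congrArg Subtype.val hst)]
      · exact absurd (congrArg Subtype.val hst).symm (g.symm.α_ne t.2 s.2)
      · exact absurd (congrArg Subtype.val hst) (g.symm.α_ne s.2 t.2)
      · rw [hb s t (Y.α.injective (congrArg Subtype.val hst))]
    · rintro ⟨e, d, hd⟩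
      obtain ⟨t, ht, h | h⟩ := g.overlap d e hd
      · refine ⟨Sum.inr ⟨k - t - 1, by omega⟩, Subtype.ext ?_⟩
        simp only [Sum.elim_inr]
        rw [h.2, show k - t - 1 + 1 = k - t by omega]
      · refine ⟨Sum.inl ⟨k - t - 1, by omega⟩, Subtype.ext ?_⟩
        simp only [Sum.elim_inl]
        rw [h.2, show k - t - 1 + 1 = k - t by omega]
  have hF : Nat.card S + Nat.card (Sᶜ : Set F) = Nat.card F := by
    rw [← Nat.card_sum]
    exact Nat.card_congr (Equiv.Set.sumCompl S)
  have hD : Nat.card (E ⊕ (Sᶜ : Set F)) = Nat.card D := by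
    refine Nat.card_congr (Equiv.ofBijective (Sum.elim i fun e => j e) ⟨?_, fun z => ?_⟩)
    · rintro (d | e) (d' | e') h
      · rw [g.i_inj h]
      · exact absurd ⟨d, h⟩ e'.2
      · exact absurd ⟨d', h.symm⟩ e.2
      · rw [Subtype.ext (g.j_inj h)]
    · rcases g.cover z with ⟨d, rfl⟩ | ⟨e, rfl⟩
      · exact ⟨Sum.inl d, rfl⟩
      · by_cases h : e ∈ S
        · obtain ⟨d, hd⟩ := h
          exact ⟨Sum.inl d, hd⟩
        · exact ⟨Sum.inr ⟨e, h⟩, rfl⟩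
  rw [Nat.card_sum] at hD
  omega

end Gluing

namespace Gluing

/-! #### Faces of a gluing -/

variable {D E F : Type} {q : RootedMap D} {X : RootedMap E} {Y : RootedMap F} {k : ℕ} {x : E}
  {y : F} {i : E → D} {j : F → D}

lemma φ_i_inner (g : Gluing q X Y k x y i j) (hx : X.face x = X.extFace) {d : E}
    (hd : X.face d ≠ X.extFace) : q.φ (i d) = i (X.φ d) :=
  g.φ_i d fun t _ h => hd (by rw [h, X.face_φ_pow, hx])

lemma φ_pow_i_inner (g : Gluing q X Y k x y i j) (hx : X.face x = X.extFace) {d : E}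
    (hd : X.face d ≠ X.extFace) (t : ℕ) : (q.φ ^ t) (i d) = i ((X.φ ^ t) d) := by
  induction t with
  | zero => rfl
  | succ t ih => rw [q.φ_pow_succ, ih, g.φ_i_inner hx (by rwa [X.face_φ_pow]), X.φ_pow_succ]

lemma degree_inner [Finite D] [Finite E] (g : Gluing q X Y k x y i j)
    (hx : X.face x = X.extFace) {d : E} (hd : X.face d ≠ X.extFace) :
    q.degree (q.face (i d)) = X.degree (X.face d) := by
  rw [q.degree_face, X.degree_face]
  refine Function.minimalPeriod_eq_minimalPeriod_iff.2 fun n => ?_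
  rw [Function.IsPeriodicPt, Function.IsFixedPt, Function.IsPeriodicPt, Function.IsFixedPt,
    Equiv.Perm.iterate_eq_pow, Equiv.Perm.iterate_eq_pow, g.φ_pow_i_inner hx hd,
    g.i_inj.eq_iff]

/-- A dart is not at the same time on an inner face of `X` and on an inner face of `Y`. -/
lemma not_inner_inner (g : Gluing q X Y k x y i j) (hx : X.face x = X.extFace)
    (hy : Y.face y = Y.extFace) {d : E} {e : F} (h : i d = j e) :
    X.face d = X.extFace ∨ Y.face e = Y.extFace := by
  obtain ⟨t, -, ⟨rfl, -⟩ | ⟨-, rfl⟩⟩ := g.overlap d e h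
  · exact Or.inl (by rw [X.face_φ_pow, hx])
  · exact Or.inr (by rw [Y.face_φ_pow, hy])

lemma exists_face_code (g : Gluing q X Y k x y i j) (hx : X.face x = X.extFace)
    (hy : Y.face y = Y.extFace) :
    ∃ f : D → Option (X.Face ⊕ Y.Face), (∀ z, f (q.φ z) = f z) ∧
      (∀ d, X.face d ≠ X.extFace → f (i d) = some (Sum.inl (X.face d))) ∧
      (∀ e, Y.face e ≠ Y.extFace → f (j e) = some (Sum.inr (Y.face e))) ∧
      ∀ z, f z ≠ none → (∃ d, i d = z ∧ X.face d ≠ X.extFace) ∨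
        ∃ e, j e = z ∧ Y.face e ≠ Y.extFace := by
  classical
  let A : D → Prop := fun z => ∃ d, i d = z ∧ X.face d ≠ X.extFace
  let B : D → Prop := fun z => ∃ e, j e = z ∧ Y.face e ≠ Y.extFace
  let f : D → Option (X.Face ⊕ Y.Face) := fun z =>
    if h : A z then some (Sum.inl (X.face h.choose)) else
      if h : B z then some (Sum.inr (Y.face h.choose)) else none
  have hf1 : ∀ d, X.face d ≠ X.extFace → f (i d) = some (Sum.inl (X.face d)) := fun d hd => by
    have h : A (i d) := ⟨d, rfl, hd⟩
    simp only [f, dif_pos h]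
    rw [g.i_inj h.choose_spec.1]
  have hf2 : ∀ e, Y.face e ≠ Y.extFace → f (j e) = some (Sum.inr (Y.face e)) := fun e he => by
    have h : B (j e) := ⟨e, rfl, he⟩
    have h' : ¬ A (j e) := by
      rintro ⟨d, hd, hd'⟩
      rcases g.not_inner_inner hx hy hd with h1 | h1
      · exact hd' h1
      · exact he h1
    simp only [f, dif_pos h, dif_neg h']
    rw [g.j_inj h.choose_spec.1]
  have hf3 : ∀ z, f z ≠ none → A z ∨ B z := fun z hz => by
    by_contra hcon
    rw [not_or] at hcon
    exact hz (by simp only [f, dif_neg hcon.1, dif_neg hcon.2])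
  refine ⟨f, fun z => ?_, hf1, hf2, hf3⟩
  have hstep : ∀ {E F : Type} {X : RootedMap E} {Y : RootedMap F} {x : E} {y : F} {i : E → D}
      {j : F → D}, Gluing q X Y k x y i j → X.face x = X.extFace → ∀ d, X.face d ≠ X.extFace →
      ∃ d', X.face d' ≠ X.extFace ∧ X.face d' = X.face d ∧ q.φ (i d') = i d :=
    fun {E F X Y x y i j} g hx d hd => by
      have h1 : X.face (X.φ.symm d) = X.face d := by
        rw [← X.face_φ, Equiv.apply_symm_apply]
      refine ⟨X.φ.symm d, h1 ▸ hd, h1, ?_⟩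
      rw [g.φ_i_inner hx (h1 ▸ hd), Equiv.apply_symm_apply]
  by_cases hz : f (q.φ z) = none
  · rw [hz]
    by_contra hcon
    rcases hf3 z (Ne.symm hcon) with ⟨d, rfl, hd⟩ | ⟨e, rfl, he⟩
    · rw [g.φ_i_inner hx hd, hf1 _ (by rwa [X.face_φ])] at hz
      cases hz
    · rw [g.symm.φ_i_inner hy he, hf2 _ (by rwa [Y.face_φ])] at hz
      cases hz
  · rcases hf3 _ hz with ⟨d, hd, hd'⟩ | ⟨e, he, he'⟩
    · obtain ⟨d', h1, h2, h3⟩ := hstep g hx d hd'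
      rw [← hd, ← q.φ.injective (h3.trans hd), hf1 _ hd', hf1 _ h1, h2]
    · obtain ⟨e', h1, h2, h3⟩ := hstep g.symm hy e he'
      rw [← he, ← q.φ.injective (h3.trans he), hf2 _ he', hf2 _ h1, h2]

/-- The darts of the external face of `X` outside the path are in the face of `x`. -/
lemma face_i_outer [Finite E] (g : Gluing q X Y k x y i j) (hx : X.face x = X.extFace) {d : E}
    (hd : X.face d = X.extFace) (hpath : ∀ t, t < k → d ≠ (X.φ ^ (t + 1)) x) :
    q.face (i d) = q.face (i x) := by
  obtain ⟨s, hs, rfl⟩ := X.exists_φ_pow (hd.trans hx.symm)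
  rcases s with _ | s
  · rfl
  have hks : k ≤ s := by
    by_contra h
    exact hpath s (by omega) rfl
  have key : ∀ u, s + 1 + u ≤ X.degree (X.face x) →
      q.face (i ((X.φ ^ (s + 1 + u)) x)) = q.face (i ((X.φ ^ (s + 1)) x)) := fun u => by
    induction u with
    | zero => intro _; rfl
    | succ u ih =>
      intro hu
      rw [← ih (by omega), show s + 1 + (u + 1) = s + 1 + u + 1 by omega, X.φ_pow_succ,
        ← g.φ_i _ fun t ht h => ?_, q.face_φ]
      have := X.φ_pow_injOn (by omega) (by omega) h
      omega
  rw [← key (X.degree (X.face x) - (s + 1)) (by omega),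
    show s + 1 + (X.degree (X.face x) - (s + 1)) = X.degree (X.face x) by omega,
    X.φ_pow_degree]

/-- The boundaries outside the path form a single face. -/
lemma face_j_start [Finite F] (g : Gluing q X Y k x y i j) (hy : Y.face y = Y.extFace) :
    q.face (j y) = q.face (i x) := by
  rw [← q.face_φ (i x), g.φ_i_start]
  refine (g.symm.face_i_outer hy (by rw [Y.face_φ_pow, hy]) fun t ht h => ?_).symm
  have := g.tail_Y k t le_rfl ht.le (by rw [h])
  omega

/-- The external face of `q`, when the root is on it. -/
lemma face_eq_ext_iff [Finite E] [Finite F] (g : Gluing q X Y k x y i j) (hx : X.face x = X.extFace)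
    (hy : Y.face y = Y.extFace) (hr : q.face (i x) = q.extFace) {z : D} :
    q.face z ≠ q.extFace ↔ (∃ d, i d = z ∧ X.face d ≠ X.extFace) ∨
        ∃ e, j e = z ∧ Y.face e ≠ Y.extFace := by
  obtain ⟨f, h1, h2, h3, h4⟩ := g.exists_face_code hx hy
  have hroot : f (i x) = none := by
    by_contra hcon
    rcases h4 _ hcon with ⟨d, hd, hd'⟩ | ⟨e, he, he'⟩
    · exact hd' (g.i_inj hd ▸ hx)
    · obtain ⟨t, ht, h | h⟩ := g.overlap x e he.symm
      · exact g.pow_ne ht h.1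
      · exact he' (by rw [h.2, Y.face_φ_pow, hy])
  constructor
  · intro hz
    by_contra hcon
    rw [not_or] at hcon
    have key : ∀ e, j e = z → ((∀ t, t < k → e ≠ (Y.φ ^ (t + 1)) y) → False) := fun e he ht => by
      have h5 : Y.face e = Y.extFace := by
        by_contra h5
        exact hcon.2 ⟨e, he, h5⟩
      have := g.symm.face_i_outer hy h5 ht
      rw [he, g.face_j_start hy, hr] at this
      exact hz this
    rcases g.cover z with ⟨d, hd⟩ | ⟨e, he⟩
    · have h5 : X.face d = X.extFace := by
        by_contra h5
        exact hcon.1 ⟨d, hd, h5⟩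
      by_cases ht : ∃ t, t < k ∧ d = (X.φ ^ (t + 1)) x
      · obtain ⟨t, ht, rfl⟩ := ht
        rw [g.glue t ht] at hd
        obtain ⟨v, hv⟩ : ∃ v, k - t = v + 1 := ⟨k - t - 1, by omega⟩
        rw [hv] at hd
        exact key _ hd fun s hs h => g.symm.α_ne (by omega) hs h
      · push Not at ht
        have := g.face_i_outer hx h5 ht
        rw [hd, hr] at this
        exact hz this
    · by_cases ht : ∃ t, t < k ∧ e = (Y.φ ^ (t + 1)) y
      · obtain ⟨t, ht, rfl⟩ := ht
        rw [g.symm.glue t ht] at he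
        obtain ⟨v, hv⟩ : ∃ v, k - t = v + 1 := ⟨k - t - 1, by omega⟩
        rw [hv] at he
        have h5 : X.face (X.α ((X.φ ^ (v + 1)) x)) = X.extFace := by
          by_contra h5
          exact hcon.1 ⟨_, he, h5⟩
        have := g.face_i_outer hx h5 fun s hs h => g.α_ne (by omega) hs h
        rw [he, hr] at this
        exact hz this
      · push Not at ht
        exact key e he ht
  · intro h h'
    rw [← hr] at h'
    have h5 := q.apply_eq_of_face_eq h1 h'
    rw [hroot] at h5
    rcases h with ⟨d, rfl, hd⟩ | ⟨e, rfl, he⟩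
    · rw [h2 d hd] at h5
      cases h5
    · rw [h3 e he] at h5
      cases h5

lemma face_i_iff [Finite E] (g : Gluing q X Y k x y i j) (hx : X.face x = X.extFace)
    (hy : Y.face y = Y.extFace) {d d' : E} (hd : X.face d ≠ X.extFace)
    (hd' : X.face d' ≠ X.extFace) : q.face (i d) = q.face (i d') ↔ X.face d = X.face d' := by
  obtain ⟨f, h1, h2, -, -⟩ := g.exists_face_code hx hy
  constructor
  · intro h
    have := q.apply_eq_of_face_eq h1 h
    rw [h2 d hd, h2 d' hd'] at this
    exact Sum.inl_injective (Option.some_injective _ this)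
  · intro h
    obtain ⟨t, -, rfl⟩ := X.exists_φ_pow h
    rw [← g.φ_pow_i_inner hx hd', q.face_φ_pow]

lemma face_i_ne_face_j (g : Gluing q X Y k x y i j) (hx : X.face x = X.extFace)
    (hy : Y.face y = Y.extFace) {d : E} {e : F} (hd : X.face d ≠ X.extFace)
    (he : Y.face e ≠ Y.extFace) : q.face (i d) ≠ q.face (j e) := by
  obtain ⟨f, h1, h2, h3, -⟩ := g.exists_face_code hx hy
  intro h
  have := q.apply_eq_of_face_eq h1 h
  rw [h2 d hd, h3 e he] at this
  cases this

lemma area_eq [Finite D] [Finite E] [Finite F] (g : Gluing q X Y k x y i j)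
    (hx : X.face x = X.extFace) (hy : Y.face y = Y.extFace) (hr : q.face (i x) = q.extFace) :
    q.area = X.area + Y.area := by
  have : Finite X.Face := Quotient.finite _
  have : Finite Y.Face := Quotient.finite _
  have : Finite q.Face := Quotient.finite _
  choose c hc using X.face_surjective
  choose c' hc' using Y.face_surjective
  rw [RootedMap.area, RootedMap.area, RootedMap.area, ← Nat.card_sum]
  have hiff := fun z => g.face_eq_ext_iff hx hy hr (z := z)
  symm
  refine Nat.card_congr (Equiv.ofBijective (Sum.elim
    (fun f : {f // f ≠ X.extFace} => (⟨q.face (i (c f)), (hiff _).2 (Or.inl ⟨c f, rfl, by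
      rw [hc]; exact f.2⟩)⟩ : {f // f ≠ q.extFace}))
    (fun f : {f // f ≠ Y.extFace} => ⟨q.face (j (c' f)), (hiff _).2 (Or.inr ⟨c' f, rfl, by
      rw [hc']; exact f.2⟩)⟩)) ⟨?_, ?_⟩)
  · have hcx : ∀ f : {f // f ≠ X.extFace}, X.face (c f) ≠ X.extFace := fun f => by
      rw [hc]; exact f.2
    have hcy : ∀ f : {f // f ≠ Y.extFace}, Y.face (c' f) ≠ Y.extFace := fun f => by
      rw [hc']; exact f.2
    rintro (f | f) (f' | f') hff
    · have := (g.face_i_iff hx hy (hcx f) (hcx f')).1 (congrArg Subtype.val hff)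
      rw [hc, hc] at this
      rw [Subtype.ext this]
    · exact absurd (congrArg Subtype.val hff) (g.face_i_ne_face_j hx hy (hcx f) (hcy f'))
    · exact absurd (congrArg Subtype.val hff).symm (g.face_i_ne_face_j hx hy (hcx f') (hcy f))
    · have := (g.symm.face_i_iff hy hx (hcy f) (hcy f')).1 (congrArg Subtype.val hff)
      rw [hc', hc'] at this
      rw [Subtype.ext this]
  · rintro ⟨f, hf⟩
    obtain ⟨z, rfl⟩ := q.face_surjective f
    rcases (hiff z).1 hf with ⟨d, rfl, hd⟩ | ⟨e, rfl, he⟩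
    · refine ⟨Sum.inl ⟨X.face d, hd⟩, Subtype.ext ?_⟩
      exact (g.face_i_iff hx hy (by rwa [hc]) hd).2 (hc _)
    · refine ⟨Sum.inr ⟨Y.face e, he⟩, Subtype.ext ?_⟩
      exact (g.symm.face_i_iff hy hx (by rwa [hc']) he).2 (hc' _)

/-- Euler's relation is additive. -/
lemma planar_iff [Finite D] [Finite E] [Finite F] (g : Gluing q X Y k x y i j)
    (hx : X.face x = X.extFace)
    (hy : Y.face y = Y.extFace) (hr : q.face (i x) = q.extFace) (hX : X.Connected)
    (hY : Y.Connected) : q.Planar ↔ X.Planar ∧ Y.Planar := by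
  have h1 := g.card_vertex
  have h2 := g.card_dart
  have h3 := g.area_eq hx hy hr
  have h4 := hX.euler_le
  have h5 := hY.euler_le
  rw [RootedMap.Planar, RootedMap.Planar, RootedMap.Planar]
  rw [RootedMap.card_face] at h4 h5 ⊢
  rw [RootedMap.card_face, RootedMap.card_face]
  constructor
  · intro h
    constructor <;> omega
  · rintro ⟨h6, h7⟩
    omega

end Gluing

/-! ### The map carried by a set of faces -/

namespace RootedMap

variable {D : Type} {m : RootedMap D} {S : Set m.Face}

lemma α_mem_edgesOf (m : RootedMap D) (S : Set m.Face) (d : D) :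
    m.α d ∈ m.edgesOf S ↔ d ∈ m.edgesOf S := by
  simp only [edgesOf, Set.mem_ofPred_eq, m.α_α]
  exact or_comm

lemma face_α_mem_of_mem_edgesOf {d : D} (hd : d ∈ m.edgesOf S) (h : m.face d ∉ S) :
    m.face (m.α d) ∈ S := hd.resolve_left h

/-- The dual connected set `S` of inner faces is incident to the boundary edges
`e₀, …, φ ^ (L - 1) e₀` and to no other ones, and the edges between `S` and the other inner faces
contain no cycle. -/
structure Side (m : RootedMap D) (S : Set m.Face) (e₀ : D) (L : ℕ) : Prop where
  ext_notMem : m.extFace ∉ S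
  L_pos : 0 < L
  L_lt : L < m.per
  face_e₀ : m.face e₀ = m.extFace
  arc : ∀ l, l < L → m.face (m.α ((m.φ ^ l) e₀)) ∈ S
  arc_only : ∀ d, m.face d = m.extFace → m.face (m.α d) ∈ S → ∃ l, l < L ∧ (m.φ ^ l) e₀ = d
  acyclic : ∀ Z : Finset D, (∀ d ∈ Z, m.face d ∉ S ∧ m.face d ≠ m.extFace ∧ m.face (m.α d) ∈ S) →
    (∀ f : D → ZMod 2, (∀ d, f (m.σ d) = f d) → ∑ d ∈ Z, f (m.α d) = ∑ d ∈ Z, f d) → Z = ∅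

namespace Side

variable {e₀ : m.edgesOf S} {L : ℕ}

lemma degree_e₀ (h : m.Side S e₀ L) : m.degree (m.face (e₀ : D)) = m.per := by
  rw [h.face_e₀]
  rfl

lemma e₀_notMem (h : m.Side S e₀ L) : m.face (e₀ : D) ∉ S := by
  rw [h.face_e₀]
  exact h.ext_notMem

end Side

variable [Finite D]

/-- The map made of the edges incident to the faces of `S`, rooted at `r`. The rotation around a
vertex skips the suppressed darts. -/
noncomputable def sub (m : RootedMap D) (S : Set m.Face) (r : m.edgesOf S) :
    RootedMap (m.edgesOf S) where
  σ := firstReturn m.σ (m.edgesOf S)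
  α := m.α.subtypePerm (m.α_mem_edgesOf S)
  root := r
  α_α d := Subtype.ext (m.α_α d)
  α_ne d h := m.α_ne d (congrArg Subtype.val h)

variable {r : m.edgesOf S}

lemma sub_α (d : m.edgesOf S) : ((m.sub S r).α d : D) = m.α d := rfl

lemma sub_tail_iff {d d' : m.edgesOf S} :
    (m.sub S r).tail d = (m.sub S r).tail d' ↔ m.tail (d : D) = m.tail d' := by
  rw [tail_eq_iff, tail_eq_iff]
  exact sameCycle_firstReturn

lemma sub_φ_of_mem {d : m.edgesOf S} (h : m.φ d ∈ m.edgesOf S) :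
    ((m.sub S r).φ d : D) = m.φ d :=
  firstReturn_eq_apply h

lemma sub_φ_inner {d : m.edgesOf S} (h : m.face (d : D) ∈ S) :
    ((m.sub S r).φ d : D) = m.φ d :=
  sub_φ_of_mem (Or.inl (by rwa [face_φ]))

lemma sub_φ_pow_inner {d : m.edgesOf S} (h : m.face (d : D) ∈ S) (t : ℕ) :
    (((m.sub S r).φ ^ t) d : D) = (m.φ ^ t) d := by
  induction t with
  | zero => rfl
  | succ t ih => rw [φ_pow_succ, sub_φ_inner (by rwa [ih, face_φ_pow]), ih, φ_pow_succ]

lemma sub_face_φ_mem_iff {d : m.edgesOf S} :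
    m.face ((m.sub S r).φ d : D) ∈ S ↔ m.face (d : D) ∈ S := by
  constructor
  · intro h
    have h1 : m.face (m.φ.symm ((m.sub S r).φ d)) ∈ S := by
      rwa [← face_φ, Equiv.apply_symm_apply]
    have h2 : (m.sub S r).φ ⟨m.φ.symm ((m.sub S r).φ d), Or.inl h1⟩ = (m.sub S r).φ d :=
      Subtype.ext (by rw [sub_φ_inner h1, Equiv.apply_symm_apply])
    rwa [← (m.sub S r).φ.injective h2]
  · intro h
    rwa [sub_φ_inner h, face_φ]

lemma sub_mem_iff_of_face_eq {d d' : m.edgesOf S} (h : (m.sub S r).face d = (m.sub S r).face d') :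
    m.face (d : D) ∈ S ↔ m.face (d' : D) ∈ S := by
  have := (m.sub S r).apply_eq_of_face_eq (f := fun d => m.face (d : D) ∈ S)
    (fun d => propext sub_face_φ_mem_iff) h
  exact iff_of_eq this

lemma sub_face_iff {d d' : m.edgesOf S} (h : m.face (d : D) ∈ S) :
    (m.sub S r).face d = (m.sub S r).face d' ↔ m.face (d : D) = m.face d' := by
  constructor
  · intro h'
    obtain ⟨t, -, rfl⟩ := (m.sub S r).exists_φ_pow h'.symm
    rw [sub_φ_pow_inner h, face_φ_pow]
  · intro h'
    obtain ⟨t, -, ht⟩ := m.exists_φ_pow h'.symm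
    have : ((m.sub S r).φ ^ t) d = d' := Subtype.ext (by rw [sub_φ_pow_inner h, ht])
    rw [← this, face_φ_pow]

lemma sub_degree {d : m.edgesOf S} (h : m.face (d : D) ∈ S) :
    (m.sub S r).degree ((m.sub S r).face d) = m.degree (m.face (d : D)) := by
  rw [degree_face, degree_face]
  refine Function.minimalPeriod_eq_minimalPeriod_iff.2 fun n => ?_
  rw [Function.IsPeriodicPt, Function.IsFixedPt, Function.IsPeriodicPt, Function.IsFixedPt,
    Equiv.Perm.iterate_eq_pow, Equiv.Perm.iterate_eq_pow, ← sub_φ_pow_inner (r := r) h,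
    Subtype.ext_iff]

lemma sub_connected (hS : m.DualConnected S) : (m.sub S r).Connected := by
  let s := Relation.EqvGen fun x y => y = (m.sub S r).σ x ∨ y = (m.sub S r).α x
  have hs : Equivalence s := Relation.EqvGen.is_equivalence _
  have hσ : ∀ z, s z ((m.sub S r).σ z) := fun z => Relation.EqvGen.rel _ _ (Or.inl rfl)
  have hα : ∀ z, s z ((m.sub S r).α z) := fun z => Relation.EqvGen.rel _ _ (Or.inr rfl)
  have hφ : ∀ z, s z ((m.sub S r).φ z) := fun z => hs.trans (hα z) (hσ _)
  have hface : ∀ {z z'}, (m.sub S r).face z = (m.sub S r).face z' → s z z' := fun {z z'} h => by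
    have := (m.sub S r).apply_eq_of_face_eq (f := fun z' => s z z') (fun d => propext
      ⟨fun h => hs.trans h (hs.symm (hφ d)), fun h => hs.trans h (hφ d)⟩) h
    exact this ▸ hs.refl z
  have key : ∀ z z' : m.edgesOf S, m.face (z : D) ∈ S → m.face (z' : D) ∈ S → s z z' := by
    intro z z' hz hz'
    have := hS (fun f => ∀ d : m.edgesOf S, m.face (d : D) = f → s z d) (fun d hd hd' => ?_)
      z z' hz hz'
    · exact (this.1 fun d hd => hface ((sub_face_iff hz).2 hd.symm)) z' rfl
    · let x : m.edgesOf S := ⟨d, Or.inl hd⟩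
      constructor
      · intro H y hy
        refine hs.trans (hs.trans (H x rfl) (hα x)) (hface ((sub_face_iff ?_).2 hy.symm))
        exact hd'
      · intro H y hy
        refine hs.trans (hs.trans (H ((m.sub S r).α x) rfl) (hs.symm (hα x)))
          (hface ((sub_face_iff hd).2 hy.symm))
  have key' : ∀ z : m.edgesOf S, ∃ z' : m.edgesOf S, m.face (z' : D) ∈ S ∧ s z z' := fun z => by
    rcases z.2 with h | h
    · exact ⟨z, h, hs.refl z⟩
    · exact ⟨(m.sub S r).α z, h, hα z⟩
  intro z z'
  obtain ⟨y, hy, hzy⟩ := key' z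
  obtain ⟨y', hy', hzy'⟩ := key' z'
  exact hs.trans hzy (hs.trans (key y y' hy hy') (hs.symm hzy'))

/-! #### The boundary of one side of a cut -/

namespace Side

variable {e₀ : m.edgesOf S} {L : ℕ}

lemma φ_pow_eq (h : m.Side S e₀ L) {l : ℕ} (hl : l < L) :
    (((m.sub S r).φ ^ l) e₀ : D) = (m.φ ^ l) e₀ := by
  induction l with
  | zero => rfl
  | succ l ih =>
    have h1 := ih (by omega)
    rw [φ_pow_succ, sub_φ_of_mem, h1, φ_pow_succ]
    rw [h1, ← φ_pow_succ]
    exact Or.inr (h.arc _ hl)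

lemma le_degree (h : m.Side S e₀ L) : L ≤ (m.sub S r).degree ((m.sub S r).face e₀) := by
  by_contra hlt
  have hpos := (m.sub S r).degree_pos ((m.sub S r).face e₀)
  have h1 := h.φ_pow_eq (r := r) (not_le.1 hlt)
  rw [φ_pow_degree] at h1
  have := m.φ_pow_injOn (d := (e₀ : D)) (i := 0) (by rw [h.degree_e₀]; exact m.per_pos)
    (by rw [h.degree_e₀]; have := h.L_lt; omega) h1
  omega

lemma apply_φ_eq (r : m.edgesOf S) {f : D → ZMod 2} (hf : ∀ d, f (m.σ d) = f d)
    (d : m.edgesOf S) : f (m.α d) = f ((m.sub S r).φ d) :=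
  (m.apply_eq_of_tail_eq hf (sub_tail_iff.1 ((m.sub S r).tail_φ d))).symm

/-- The darts of `sub S` that are not on a face of `S` form a single face. -/
lemma face_eq (h : m.Side S e₀ L) {d : m.edgesOf S} (hd : m.face (d : D) ∉ S) :
    (m.sub S r).face d = (m.sub S r).face e₀ := by
  classical
  have : Fintype D := Fintype.ofFinite D
  by_contra hne
  let W : Finset (m.edgesOf S) := Finset.univ.filter fun y =>
    (m.sub S r).face y = (m.sub S r).face d
  have hW : ∀ y, y ∈ W ↔ (m.sub S r).face y = (m.sub S r).face d := fun y => by simp [W]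
  have hempty := h.acyclic (W.map (Function.Embedding.subtype _)) (fun y hy => ?_) (fun f hf => ?_)
  · have : d ∈ W := (hW d).2 rfl
    rw [Finset.map_eq_empty] at hempty
    rw [hempty] at this
    exact absurd this (Finset.notMem_empty _)
  · obtain ⟨y, hyW, rfl⟩ := Finset.mem_map.1 hy
    have hy := (hW y).1 hyW
    have h1 : m.face (y : D) ∉ S := fun h' => hd ((sub_mem_iff_of_face_eq hy).1 h')
    have h2 := face_α_mem_of_mem_edgesOf y.2 h1
    refine ⟨h1, fun hext => hne ?_, h2⟩
    obtain ⟨l, hl, hly⟩ := h.arc_only _ hext h2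
    have : ((m.sub S r).φ ^ l) e₀ = y := Subtype.ext (by rw [h.φ_pow_eq hl, hly]; rfl)
    rw [← hy, ← this, face_φ_pow]
  · rw [Finset.sum_map, Finset.sum_map]
    refine Finset.sum_bij' (fun y _ => (m.sub S r).φ y) (fun y _ => (m.sub S r).φ.symm y)
      (fun y hy => ?_) (fun y hy => ?_) (fun y _ => ?_) (fun y _ => ?_) (fun y _ => ?_)
    · rw [hW] at hy ⊢
      rw [face_φ, hy]
    · rw [hW] at hy ⊢
      rw [← face_φ, Equiv.apply_symm_apply, hy]
    · exact Equiv.symm_apply_apply _ _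
    · exact Equiv.apply_symm_apply _ _
    · exact apply_φ_eq r hf y

/-- After the arc, the external face of `sub S` follows edges between `S` and the other inner
faces. -/
lemma crossing (h : m.Side S e₀ L) {t : ℕ}
    (ht : L + t < (m.sub S r).degree ((m.sub S r).face e₀)) :
    m.face (((m.sub S r).φ ^ (L + t)) e₀ : D) ∉ S ∧
      m.face (((m.sub S r).φ ^ (L + t)) e₀ : D) ≠ m.extFace ∧
      m.face (m.α (((m.sub S r).φ ^ (L + t)) e₀ : D)) ∈ S := by
  have h1 : m.face (((m.sub S r).φ ^ (L + t)) e₀ : D) ∉ S := fun h' =>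
    h.e₀_notMem ((sub_mem_iff_of_face_eq ((m.sub S r).face_φ_pow e₀ (L + t))).1 h')
  have h2 := face_α_mem_of_mem_edgesOf (((m.sub S r).φ ^ (L + t)) e₀).2 h1
  refine ⟨h1, fun hext => ?_, h2⟩
  obtain ⟨l, hl, hly⟩ := h.arc_only _ hext h2
  have := (m.sub S r).φ_pow_injOn (i := l) (j := L + t) (by omega) ht
    (Subtype.ext (by rw [h.φ_pow_eq hl, hly]))
  omega

/-- After the arc, the boundary of `sub S` does not visit a vertex twice. -/
lemma tail_injOn (h : m.Side S e₀ L) {s t : ℕ}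
    (hs : L + s ≤ (m.sub S r).degree ((m.sub S r).face e₀))
    (ht : L + t ≤ (m.sub S r).degree ((m.sub S r).face e₀))
    (hst : (m.sub S r).tail (((m.sub S r).φ ^ (L + s)) e₀) =
      (m.sub S r).tail (((m.sub S r).φ ^ (L + t)) e₀)) : s = t := by
  classical
  wlog hle : s ≤ t generalizing s t
  · exact (this ht hs hst.symm (by omega)).symm
  obtain ⟨n, rfl⟩ := Nat.exists_eq_add_of_le hle
  have hinj : ∀ l l', l < n → l' < n → (((m.sub S r).φ ^ (L + s + l)) e₀ : D) =
      ((m.sub S r).φ ^ (L + s + l')) e₀ → l = l' := fun l l' hl hl' hll => by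
    have := (m.sub S r).φ_pow_injOn (i := L + s + l) (j := L + s + l') (by omega) (by omega)
      (Subtype.ext hll)
    omega
  have hempty := h.acyclic
    ((Finset.range n).image fun l => (((m.sub S r).φ ^ (L + s + l)) e₀ : D)) (fun y hy => ?_)
    (fun f hf => ?_)
  · rw [Finset.image_eq_empty, Finset.range_eq_empty_iff] at hempty
    omega
  · obtain ⟨l, hl, rfl⟩ := Finset.mem_image.1 hy
    rw [Finset.mem_range] at hl
    have := h.crossing (r := r) (t := s + l) (by omega)
    rwa [← add_assoc] at this
  · rw [Finset.sum_image fun l hl l' hl' => hinj l l' (Finset.mem_range.1 hl)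
        (Finset.mem_range.1 hl'),
      Finset.sum_image fun l hl l' hl' => hinj l l' (Finset.mem_range.1 hl)
        (Finset.mem_range.1 hl')]
    have h1 : ∀ l, f (m.α (((m.sub S r).φ ^ (L + s + l)) e₀)) =
        f (((m.sub S r).φ ^ (L + s + (l + 1))) e₀) := fun l => by
      rw [apply_φ_eq r hf, ← φ_pow_succ, add_assoc _ l]
    rw [Finset.sum_congr rfl fun l _ => h1 l]
    have h2 := Finset.sum_range_succ (fun l => f (((m.sub S r).φ ^ (L + s + l)) e₀)) n
    rw [Finset.sum_range_succ'] at h2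
    have h3 : f (((m.sub S r).φ ^ (L + s + 0)) e₀) = f (((m.sub S r).φ ^ (L + s + n)) e₀) := by
      refine m.apply_eq_of_tail_eq hf ((sub_tail_iff (r := r)).1 ?_)
      rw [add_zero, hst, add_assoc]
    rw [h3] at h2
    exact add_right_cancel h2

lemma tail_pow_L (h : m.Side S e₀ L) :
    m.tail (((m.sub S r).φ ^ L) e₀ : D) = m.tail ((m.φ ^ L) (e₀ : D)) := by
  obtain ⟨l, hl⟩ : ∃ l, L = l + 1 := ⟨L - 1, by have := h.L_pos; omega⟩
  have h1 : m.tail (((m.sub S r).φ ^ (l + 1)) e₀ : D) =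
      m.tail (m.α (((m.sub S r).φ ^ l) e₀ : D)) := by
    rw [φ_pow_succ]
    exact sub_tail_iff.1 ((m.sub S r).tail_φ _)
  rw [hl, h1, h.φ_pow_eq (by omega), ← tail_φ, ← φ_pow_succ]

lemma lt_degree (h : m.Side S e₀ L) (hs : m.SimpleBoundary) :
    L < (m.sub S r).degree ((m.sub S r).face e₀) := by
  refine lt_of_le_of_ne h.le_degree fun heq => ?_
  have h1 := h.tail_pow_L (r := r)
  have h2 : ((m.sub S r).φ ^ L) e₀ = e₀ := by
    conv_lhs => rw [heq]
    exact φ_pow_degree _ _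
  rw [h2] at h1
  have h3 := hs _ _ h.face_e₀ (by rw [face_φ_pow, h.face_e₀]) h1
  have := m.φ_pow_injOn (d := (e₀ : D)) (i := 0) (j := L)
    (by rw [h.degree_e₀]; exact m.per_pos) (by rw [h.degree_e₀]; exact h.L_lt) h3
  have := h.L_pos
  omega

/-- The edges between `S` and the other inner faces are those that follow the arc. -/
lemma exists_crossing (h : m.Side S e₀ L) {d : D} (h1 : m.face d ∉ S)
    (h2 : m.face d ≠ m.extFace) (h3 : m.face (m.α d) ∈ S) :
    ∃ t, L + t < (m.sub S r).degree ((m.sub S r).face e₀) ∧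
      (((m.sub S r).φ ^ (L + t)) e₀ : D) = d := by
  have hd : d ∈ m.edgesOf S := Or.inr h3
  obtain ⟨l, hl, hld⟩ := (m.sub S r).exists_φ_pow (h.face_eq (r := r) (d := ⟨d, hd⟩) h1)
  have hLl : L ≤ l := by
    by_contra hcon
    refine h2 ?_
    have := h.φ_pow_eq (r := r) (l := l) (by omega)
    rw [hld] at this
    change d = _ at this
    rw [this, face_φ_pow, h.face_e₀]
  obtain ⟨t, rfl⟩ := Nat.exists_eq_add_of_le hLl
  exact ⟨t, hl, by rw [hld]⟩

/-- The number of edges that follow the arc. -/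
lemma card_crossing (h : m.Side S e₀ L) :
    Nat.card {d : D // m.face d ∉ S ∧ m.face d ≠ m.extFace ∧ m.face (m.α d) ∈ S} + L =
      (m.sub S r).degree ((m.sub S r).face e₀) := by
  obtain ⟨k, hk⟩ := Nat.exists_eq_add_of_le (h.le_degree (r := r))
  have : Nat.card {d : D // m.face d ∉ S ∧ m.face d ≠ m.extFace ∧ m.face (m.α d) ∈ S} = k := by
    rw [← Nat.card_fin k]
    symm
    refine Nat.card_congr (Equiv.ofBijective
      (fun t : Fin k => ⟨_, h.crossing (r := r) (t := t) (by omega)⟩) ⟨fun s t hst => ?_, ?_⟩)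
    · have hst' : (((m.sub S r).φ ^ (L + s)) e₀ : D) = ((m.sub S r).φ ^ (L + t)) e₀ :=
        by have := congrArg Subtype.val hst; exact this
      have := (m.sub S r).φ_pow_injOn (i := L + s) (j := L + t) (d := e₀) (by omega) (by omega)
        (Subtype.ext hst')
      exact Fin.ext (by omega)
    · rintro ⟨d, h1, h2, h3⟩
      obtain ⟨t, ht, htd⟩ := h.exists_crossing (r := r) h1 h2 h3
      exact ⟨⟨t, by omega⟩, Subtype.ext htd⟩
  omega

end Side

end RootedMap

namespace RootedMap

variable {D : Type} {m : RootedMap D} [Finite D]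

namespace Side

variable {S : Set m.Face} {r e₀ : m.edgesOf S} {L : ℕ}

/-- `φ ^ (L - 1) e₀` is the last edge of the arc. -/
lemma pow_pred (h : m.Side S e₀ L) (t : ℕ) :
    ((m.sub S r).φ ^ (t + 1)) (((m.sub S r).φ ^ (L - 1)) e₀) = ((m.sub S r).φ ^ (L + t)) e₀ := by
  rw [← φ_pow_add]
  congr 2
  have := h.L_pos
  omega

lemma φ_eq (h : m.Side S e₀ L) {d : m.edgesOf S}
    (hd : ∀ t, L + t ≤ (m.sub S r).degree ((m.sub S r).face e₀) →
      d ≠ ((m.sub S r).φ ^ t) (((m.sub S r).φ ^ (L - 1)) e₀)) :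
    m.φ d = ((m.sub S r).φ d : D) := by
  by_cases hdS : m.face (d : D) ∈ S
  · exact (sub_φ_inner hdS).symm
  obtain ⟨l, hl, rfl⟩ := (m.sub S r).exists_φ_pow (h.face_eq (r := r) hdS)
  have hlL : l + 1 < L := by
    by_contra hcon
    refine hd (l + 1 - L) (by omega) ?_
    rw [← φ_pow_add]
    congr 2
    have := h.L_pos
    omega
  have h1 := h.φ_pow_eq (r := r) hlL
  rw [← φ_pow_succ, h1, h.φ_pow_eq (by omega), φ_pow_succ]

/-- The faces of `sub S` other than the one of the arc are the faces of `S`. -/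
lemma face_mem_of_ne (h : m.Side S e₀ L) {d : m.edgesOf S}
    (hd : (m.sub S r).face d ≠ (m.sub S r).face e₀) : m.face (d : D) ∈ S := by
  by_contra h'
  exact hd (h.face_eq h')

end Side

namespace ArcCut

variable {T : Set m.Face} {a b : ℕ}

lemma side (h : m.ArcCut T a b) (hp : m.Planar) (hc : m.Connected) (hs : m.SimpleBoundary) :
    m.Side T (m.bEdge a) (b - a) where
  ext_notMem := h.ext_notMem
  L_pos := by have := h.a_lt; omega
  L_lt := by have := h.a_lt; have := h.b_lt; omega
  face_e₀ := m.face_bEdge a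
  arc l hl := by
    rw [φ_pow_bEdge]
    exact h.arc_mem _ (by omega) (by omega)
  arc_only d hd hd' := by
    obtain ⟨i, hi, rfl⟩ := m.exists_bEdge hd
    have h1 : ¬ (i < a ∨ b ≤ i) := fun hi' => h.nonarc hp hc hi hi' hd'
    refine ⟨i - a, by omega, ?_⟩
    rw [φ_pow_bEdge]
    congr 1
    omega
  acyclic Z hZ hσ := h.closed_eq_empty hp hc hs
    (Or.inr fun d hd => ⟨⟨(hZ d hd).2.1, (hZ d hd).1⟩, (hZ d hd).2.2⟩) hσ

lemma side_compl (h : m.ArcCut T a b) (hp : m.Planar) (hc : m.Connected)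
    (hs : m.SimpleBoundary) :
    m.Side (m.innerCompl T) (m.bEdge b) (m.per - (b - a)) where
  ext_notMem h' := h'.1 rfl
  L_pos := by have := h.b_lt; omega
  L_lt := by have := h.a_lt; have := h.b_lt; omega
  face_e₀ := m.face_bEdge b
  arc l hl := by
    have hab := h.a_lt
    have hbp := h.b_lt
    obtain ⟨y, -, hy⟩ := h.right
    rw [φ_pow_bEdge]
    refine ⟨hs.face_α_ne hc hy.1 (m.face_bEdge _), ?_⟩
    by_cases hlt : l + b < m.per
    · exact h.nonarc hp hc hlt (Or.inr (by omega))
    · rw [show l + b = l + b - m.per + m.per by omega, bEdge_add_per]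
      exact h.nonarc hp hc (by omega) (Or.inl (by omega))
  arc_only d hd hd' := by
    have hab := h.a_lt
    have hbp := h.b_lt
    obtain ⟨i, hi, rfl⟩ := m.exists_bEdge hd
    have h1 : i < a ∨ b ≤ i := by
      by_contra hcon
      exact hd'.2 (h.arc_mem i (by omega) (by omega))
    rcases h1 with h1 | h1
    · refine ⟨i + m.per - b, by omega, ?_⟩
      rw [φ_pow_bEdge, show i + m.per - b + b = i + m.per by omega, bEdge_add_per]
    · refine ⟨i - b, by omega, ?_⟩
      rw [φ_pow_bEdge, show i - b + b = i by omega]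
  acyclic Z hZ hσ := h.closed_eq_empty hp hc hs (Or.inl fun d hd => by
    refine ⟨?_, (hZ d hd).2.2⟩
    by_contra h'
    exact (hZ d hd).1 ⟨(hZ d hd).2.1, h'⟩) hσ

/-- The map is obtained by gluing its two sides. The boundary of each side is made of its part of
the boundary of the map, followed by the `k` edges between the two sides, which are visited in
opposite directions by the two boundaries: both orders are determined by the origins of the
edges. -/
theorem gluing (h : m.ArcCut T a b) (hp : m.Planar) (hc : m.Connected) (hs : m.SimpleBoundary)
    {r e : m.edgesOf (m.innerCompl T)} (he : (e : D) = m.bEdge b)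
    {r' e' : m.edgesOf T} (he' : (e' : D) = m.bEdge a) :
    ∃ k, (m.sub _ r).degree ((m.sub _ r).face e) = m.per - (b - a) + k ∧
      (m.sub T r').degree ((m.sub T r').face e') = b - a + k ∧
      Gluing m (m.sub _ r) (m.sub T r') k (((m.sub _ r).φ ^ (m.per - (b - a) - 1)) e)
        (((m.sub T r').φ ^ (b - a - 1)) e') Subtype.val Subtype.val := by
  have hab := h.a_lt
  have hbp := h.b_lt
  obtain ⟨y₀, -, hy₀⟩ := h.right
  have h1 : m.Side (m.innerCompl T) (e : D) (m.per - (b - a)) := he ▸ h.side_compl hp hc hs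
  have h2 : m.Side T (e' : D) (b - a) := he' ▸ h.side hp hc hs
  set X := m.sub _ r with hX
  set Y := m.sub T r' with hY
  set A := m.per - (b - a) with hA
  set B := b - a with hB
  have hcardeq : Nat.card {d : D // m.face d ∉ m.innerCompl T ∧ m.face d ≠ m.extFace ∧
      m.face (m.α d) ∈ m.innerCompl T} =
      Nat.card {d : D // m.face d ∉ T ∧ m.face d ≠ m.extFace ∧ m.face (m.α d) ∈ T} := by
    refine Nat.card_congr (m.α.subtypeEquiv fun d => ?_)
    rw [m.α_α]
    constructor
    · rintro ⟨g1, g2, g3⟩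
      refine ⟨g3.2, g3.1, ?_⟩
      by_contra g4
      exact g1 ⟨g2, g4⟩
    · rintro ⟨g1, g2, g3⟩
      exact ⟨fun g4 => g4.2 g3, fun g4 => h.ext_notMem (g4 ▸ g3), ⟨g2, g1⟩⟩
  have hk1 := h1.card_crossing (r := r)
  have hk2 := h2.card_crossing (r := r')
  rw [hcardeq] at hk1
  set k := Nat.card {d : D // m.face d ∉ T ∧ m.face d ≠ m.extFace ∧ m.face (m.α d) ∈ T}
  have hk3 := h1.lt_degree (r := r) hs
  rw [← hX] at hk1 hk3
  rw [← hY] at hk2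
  have hXd : (m.sub _ r).degree ((m.sub _ r).face e) = A + k :=
    show X.degree (X.face e) = A + k by omega
  have hYd : (m.sub _ r').degree ((m.sub _ r').face e') = B + k :=
    show Y.degree (Y.face e') = B + k by omega
  have hXe : (X.φ ^ (A + k)) e = e := by
    rw [add_comm A, hk1]
    exact φ_pow_degree _ _
  have hYe : (Y.φ ^ (B + k)) e' = e' := by
    rw [add_comm B, hk2]
    exact φ_pow_degree _ _
  have hxpow : ∀ t, (X.φ ^ (t + 1)) ((X.φ ^ (A - 1)) e) = (X.φ ^ (A + t)) e := h1.pow_pred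
  have hypow : ∀ t, (Y.φ ^ (t + 1)) ((Y.φ ^ (B - 1)) e') = (Y.φ ^ (B + t)) e' := h2.pow_pred
  -- the edges of the path are visited in opposite directions
  have hcross : ∀ t, t < k → ∃ s, s < k ∧ m.α ((X.φ ^ (A + t)) e) = ((Y.φ ^ (B + s)) e' : D) ∧
      m.tail ((X.φ ^ (A + t)) e : D) = m.tail ((Y.φ ^ (B + (s + 1))) e' : D) := fun t ht => by
    obtain ⟨g1, g2, g3⟩ := h1.crossing (r := r) (t := t) (by omega)
    have g4 : m.face ((X.φ ^ (A + t)) e : D) ∈ T := by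
      by_contra g4
      exact g1 ⟨g2, g4⟩
    obtain ⟨s, hs, hse⟩ := h2.exists_crossing (r := r') (d := m.α ((X.φ ^ (A + t)) e : D)) g3.2
      g3.1 (by rwa [m.α_α])
    refine ⟨s, by omega, hse.symm, ?_⟩
    rw [← add_assoc, φ_pow_succ]
    refine Eq.trans ?_ (sub_tail_iff.1 (Y.tail_φ _)).symm
    rw [sub_α, hse, m.α_α]
  have hglue : ∀ t, t < k → m.α ((X.φ ^ (A + t)) e) = ((Y.φ ^ (B + (k - t - 1))) e' : D) := by
    intro t
    induction t with
    | zero =>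
      intro hk0
      obtain ⟨s, hsk, g1, g2⟩ := hcross 0 hk0
      have g3 : m.tail ((X.φ ^ (A + 0)) e : D) = m.tail ((Y.φ ^ (B + k)) e' : D) := by
        have := h1.tail_pow_L (r := r)
        rw [← hX] at this
        rw [add_zero, this, hYe, he, he', φ_pow_bEdge,
          show A + b = a + m.per by omega, bEdge_add_per]
      have := h2.tail_injOn (r := r') (s := s + 1) (t := k) (by omega) (by omega)
        (sub_tail_iff.2 (g2.symm.trans g3))
      rw [g1, show k - 0 - 1 = s by omega]
    | succ t ih =>
      intro htk
      obtain ⟨s, hsk, g1, g2⟩ := hcross (t + 1) htk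
      have g3 : m.tail ((X.φ ^ (A + (t + 1))) e : D) =
          m.tail ((Y.φ ^ (B + (k - t - 1))) e' : D) := by
        rw [← ih (by omega), ← add_assoc, φ_pow_succ]
        exact sub_tail_iff.1 (X.tail_φ _)
      have := h2.tail_injOn (r := r') (s := s + 1) (t := k - t - 1) (by omega) (by omega)
        (sub_tail_iff.2 (g2.symm.trans g3))
      rw [g1, show k - (t + 1) - 1 = s by omega]
  have hgl : ∀ t, t < k → ((X.φ ^ (t + 1)) ((X.φ ^ (A - 1)) e) : D) =
      (Y.α ((Y.φ ^ (k - t)) ((Y.φ ^ (B - 1)) e')) : D) := fun t ht => by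
    have := hypow (k - t - 1)
    rw [show k - t - 1 + 1 = k - t by omega] at this
    rw [hxpow, this]
    change _ = m.α ((Y.φ ^ (B + (k - t - 1))) e' : D)
    rw [← hglue t ht, m.α_α]
  refine ⟨k, by omega, by omega, ?_⟩
  exact
    { k_pos := by omega
      i_inj := Subtype.val_injective
      j_inj := Subtype.val_injective
      i_α := fun _ => rfl
      j_α := fun _ => rfl
      cover := fun z => by
        have hin : ∀ z, m.face z ≠ m.extFace → m.face z ∈ m.innerCompl T ∨ m.face z ∈ T :=
          fun z hz => by
            by_cases hzT : m.face z ∈ T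
            · exact Or.inr hzT
            · exact Or.inl ⟨hz, hzT⟩
        by_cases hz : m.face z = m.extFace
        · rcases hin _ (hs.face_α_ne hc hy₀.1 hz) with h3 | h3
          · exact Or.inl ⟨⟨z, Or.inr h3⟩, rfl⟩
          · exact Or.inr ⟨⟨z, Or.inr h3⟩, rfl⟩
        · rcases hin _ hz with h3 | h3
          · exact Or.inl ⟨⟨z, Or.inl h3⟩, rfl⟩
          · exact Or.inr ⟨⟨z, Or.inl h3⟩, rfl⟩
      overlap := fun d e'' hde => by
        have key : ∀ z, m.face z ∈ T → m.face (m.α z) ∈ m.innerCompl T →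
            ∃ t, t < k ∧ ((X.φ ^ (A + t)) e : D) = z := fun z hz hz' => by
          obtain ⟨t, ht, htz⟩ := h1.exists_crossing (r := r) (d := z) (fun h' => h'.2 hz)
            (fun h' => h.ext_notMem (h' ▸ hz)) hz'
          exact ⟨t, by omega, htz⟩
        by_cases hz : m.face (d : D) ∈ T
        · have hz' : m.face (m.α (d : D)) ∈ m.innerCompl T :=
            d.2.resolve_left fun h' => h'.2 hz
          obtain ⟨t, ht, htz⟩ := key _ hz hz'
          rw [← hxpow] at htz
          refine ⟨t, ht, Or.inl ⟨Subtype.ext htz.symm, Subtype.ext ?_⟩⟩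
          rw [← hde, ← htz, hgl t ht]
        · have hz' : m.face (m.α (d : D)) ∈ T := by
            have := e''.2
            rw [← hde] at this
            exact this.resolve_left hz
          have hz'' : m.face (d : D) ∈ m.innerCompl T := d.2.resolve_right fun h' => h'.2 hz'
          obtain ⟨t, ht, htz⟩ := key (m.α d) hz' (by rwa [m.α_α])
          rw [← hxpow] at htz
          refine ⟨t, ht, Or.inr ⟨Subtype.ext ?_, Subtype.ext ?_⟩⟩
          · change (d : D) = m.α _
            rw [htz, m.α_α]
          · rw [← hde]
            have h3 := hgl t ht
            rw [htz] at h3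
            exact m.α.injective h3
      glue := hgl
      φ_i := fun d hd => h1.φ_eq fun t ht => hd t (by omega)
      φ_j := fun d hd => h2.φ_eq fun t ht => hd t (by omega)
      φ_i_start := by
        have h3 := h1.φ_pow_eq (r := r) (l := A - 1) (by have := h1.L_pos; omega)
        rw [← hX] at h3
        rw [h3, hypow, hYe, ← φ_pow_succ, he, he', φ_pow_bEdge,
          show A - 1 + 1 + b = a + m.per by omega, bEdge_add_per]
      φ_j_start := by
        have h3 := h2.φ_pow_eq (r := r') (l := B - 1) (by have := h2.L_pos; omega)
        rw [← hY] at h3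
        rw [h3, hxpow, hXe, ← φ_pow_succ, he, he', φ_pow_bEdge, show B - 1 + 1 + a = b by omega]
      tail_X := fun s t hs ht hst => by
        rw [hxpow, hxpow] at hst
        exact h1.tail_injOn (by omega) (by omega) hst
      tail_Y := fun s t hs ht hst => by
        rw [hypow, hypow] at hst
        exact h2.tail_injOn (by omega) (by omega) hst }

/-- The part of the map that is cut off has a simple boundary. -/
lemma simpleBoundary_sub (h : m.ArcCut T a b) (hp : m.Planar) (hc : m.Connected)
    (hs : m.SimpleBoundary) {e : m.edgesOf T} (he : (e : D) = m.bEdge a) :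
    (m.sub T e).SimpleBoundary := by
  have hab := h.a_lt
  have hbp := h.b_lt
  have h2 : m.Side T (e : D) (b - a) := he ▸ h.side hp hc hs
  set Y := m.sub T e with hY
  set B := b - a with hB
  set P := Y.degree (Y.face e) with hP
  have hBP : B < P := h2.lt_degree hs
  have hP' : (m.sub T e).degree ((m.sub T e).face e) = P := rfl
  have hperiod : (Y.φ ^ P) e = e := φ_pow_degree _ _
  have htail : ∀ l, l < B → m.tail ((Y.φ ^ l) e : D) = m.bVert (a + l) := fun l hl => by
    have h3 := h2.φ_pow_eq (r := e) hl
    rw [← hY] at h3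
    rw [h3, he, φ_pow_bEdge, add_comm, bVert]
  -- the vertices that are incident to a face on the other side
  have hN : ∀ l, l < P → (l = 0 ∨ B ≤ l) →
      ∃ d, m.tail d = m.tail ((Y.φ ^ l) e : D) ∧ m.face d ∈ m.innerCompl T := fun l hl hl' => by
    rcases hl' with rfl | hl'
    · rw [htail 0 (by omega), add_zero]
      exact h.left
    · obtain ⟨t, rfl⟩ := Nat.exists_eq_add_of_le hl'
      have h3 := h2.crossing (r := e) hl
      exact ⟨_, rfl, h3.2.1, h3.1⟩
  have key : ∀ l l', l < P → l' < P → Y.tail ((Y.φ ^ l) e) = Y.tail ((Y.φ ^ l') e) → l ≤ l' →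
      l = l' := by
    intro l l' hl hl' hll hle
    have hmll := sub_tail_iff.1 hll
    have hfirst : ∀ l l', l < P → l' < P → m.tail ((Y.φ ^ l) e : D) = m.tail ((Y.φ ^ l') e : D) →
        0 < l → l < B → 0 < l' ∧ l' < B := by
      intro l l' hl hl' hll h0 hlB
      by_contra hcon
      obtain ⟨d, hd, hdN⟩ := hN l' hl' (by omega)
      rw [← hll, htail l hlB] at hd
      exact h.interior _ d (by omega) (by omega) hd hdN
    by_cases h3 : 0 < l ∧ l < B
    · have h4 := hfirst l l' hl hl' hmll h3.1 h3.2
      rw [htail l h3.2, htail l' h4.2] at hmll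
      have := m.bEdge_injOn (by omega) (by omega)
        (hs _ _ (m.face_bEdge _) (m.face_bEdge _) hmll)
      omega
    · by_cases h4 : 0 < l' ∧ l' < B
      · exact absurd (hfirst l' l hl' hl hmll.symm h4.1 h4.2) h3
      · rcases Nat.eq_zero_or_pos l' with rfl | hl'pos
        · omega
        · obtain ⟨t', ht'⟩ := Nat.exists_eq_add_of_le (show B ≤ l' by omega)
          rcases Nat.eq_zero_or_pos l with rfl | hlpos
          · rw [ht'] at hll
            have := h2.tail_injOn (r := e) (s := P - B) (t := t') (by omega) (by omega)
              (Eq.trans (congrArg Y.tail (show (Y.φ ^ (B + (P - B))) e = e by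
                rw [Nat.add_sub_of_le hBP.le, hperiod])) hll)
            omega
          · obtain ⟨t, ht⟩ := Nat.exists_eq_add_of_le (show B ≤ l by omega)
            rw [ht, ht'] at hll
            have := h2.tail_injOn (r := e) (s := t) (t := t') (by omega) (by omega) hll
            omega
  intro d d' hd hd' hdd
  obtain ⟨l, hl, rfl⟩ := Y.exists_φ_pow (d := e) hd
  obtain ⟨l', hl', rfl⟩ := Y.exists_φ_pow (d := e) hd'
  rcases le_total l l' with hle | hle
  · rw [key l l' hl hl' hdd hle]
  · rw [key l' l hl' hl hdd.symm hle]

end ArcCut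

end RootedMap

/-! ### Completing a map by filling its boundary -/

/-- The map `q` is obtained by gluing `Y` to `X` along the part of the boundary of `X` that is
numbered from `a` to `a + k`, with `l` edges after it; the external face of `Y` has `m` edges,
numbered from the root of `Y`, that are not on the path. The root of `q` is the one inherited
from `X`: it is the root of `X` if `a ≠ 0`, and otherwise the edge of `Y` with the same origin that
replaces it on the boundary. -/
structure Completion {D E F : Type} (q : RootedMap D) (X : RootedMap E) (Y : RootedMap F)
    (a k l m : ℕ) (i : E → D) (j : F → D) : Prop where
  gluing : Gluing q X Y k ((X.φ ^ a) (X.φ.symm X.root)) ((Y.φ ^ m) (Y.φ.symm Y.root)) i j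
  root : q.root = q.φ (i (X.φ.symm X.root))
  per_X : X.per = a + k + l
  per_Y : Y.per = m + k
  l_pos : 0 < l
  m_pos : 0 < m

namespace RootedMap

variable {D : Type} {m : RootedMap D}

lemma φ_pow_φ_symm_root (t : ℕ) : (m.φ ^ (t + 1)) (m.φ.symm m.root) = m.bEdge t := by
  rw [φ_pow_succ_apply, Equiv.apply_symm_apply, bEdge]

lemma φ_symm_root [Finite D] {P : ℕ} (h : m.per = P + 1) : m.φ.symm m.root = m.bEdge P := by
  rw [Equiv.symm_apply_eq, φ_bEdge, ← h, bEdge_per]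

lemma face_φ_symm_root : m.face (m.φ.symm m.root) = m.extFace := by
  rw [← m.face_φ, Equiv.apply_symm_apply, extFace]

end RootedMap

namespace Completion

variable {D E F : Type} {q : RootedMap D} {X : RootedMap E} {Y : RootedMap F} {a k l m : ℕ}
  {i : E → D} {j : F → D}

lemma pow_x (a t : ℕ) :
    (X.φ ^ (t + 1)) ((X.φ ^ a) (X.φ.symm X.root)) = X.bEdge (a + t) := by
  rw [← X.φ_pow_add, show t + 1 + a = a + t + 1 by omega, X.φ_pow_φ_symm_root]

lemma face_x (a : ℕ) : X.face ((X.φ ^ a) (X.φ.symm X.root)) = X.extFace := by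
  rw [X.face_φ_pow, X.face_φ_symm_root]

lemma φ_symm_root [Finite E] (h : Completion q X Y a k l m i j) :
    X.φ.symm X.root = X.bEdge (a + k + l - 1) :=
  X.φ_symm_root (by have := h.per_X; have := h.l_pos; omega)

lemma y_eq (h : Completion q X Y a k l m i j) :
    (Y.φ ^ m) (Y.φ.symm Y.root) = Y.bEdge (m - 1) := by
  rw [← Y.φ_pow_φ_symm_root, Nat.sub_add_cancel h.m_pos]

lemma bEdge_left [Finite E] (h : Completion q X Y a k l m i j) {t : ℕ} (ht : t < a) :
    q.bEdge t = i (X.bEdge t) := by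
  have hX := h.per_X
  have hl := h.l_pos
  have hx : ∀ s, (X.φ ^ s) ((X.φ ^ a) (X.φ.symm X.root)) = X.bEdge (s + a - 1) := fun s => by
    rw [← X.φ_pow_add, ← X.φ_pow_φ_symm_root, show s + a - 1 + 1 = s + a by omega]
  induction t with
  | zero =>
    change q.root = i X.root
    rw [h.root, h.gluing.φ_i, Equiv.apply_symm_apply]
    intro s hs hcon
    rw [hx, h.φ_symm_root] at hcon
    have := X.bEdge_injOn (by omega) (by omega) hcon
    omega
  | succ t ih =>
    rw [← q.φ_bEdge, ih (by omega), h.gluing.φ_i, X.φ_bEdge]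
    intro s hs hcon
    rw [hx] at hcon
    have := X.bEdge_injOn (by omega) (by omega) hcon
    omega

lemma bEdge_mid [Finite E] [Finite F] (h : Completion q X Y a k l m i j) {t : ℕ} (ht : t < m) :
    q.bEdge (a + t) = j (Y.bEdge t) := by
  have hY := h.per_Y
  induction t with
  | zero =>
    have h1 : q.bEdge a = q.φ (i ((X.φ ^ a) (X.φ.symm X.root))) := by
      rcases Nat.eq_zero_or_pos a with rfl | ha
      · exact h.root
      · obtain ⟨b, rfl⟩ : ∃ b, a = b + 1 := ⟨a - 1, by omega⟩
        rw [← q.φ_bEdge, h.bEdge_left (by omega), X.φ_pow_φ_symm_root]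
    rw [add_zero, h1, h.gluing.φ_i_start, pow_x, ← hY, ← Y.bEdge_add_per 0, zero_add]
  | succ t ih =>
    rw [← add_assoc, ← q.φ_bEdge, ih (by omega), h.gluing.φ_j, Y.φ_bEdge]
    intro s hs hcon
    rw [h.y_eq, Y.φ_pow_bEdge] at hcon
    have := Y.bEdge_injOn (by omega) (by omega) hcon
    omega

lemma bEdge_right [Finite E] [Finite F] (h : Completion q X Y a k l m i j) {t : ℕ} (ht : t < l) :
    q.bEdge (a + m + t) = i (X.bEdge (a + k + t)) := by
  have hX := h.per_X
  have hm := h.m_pos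
  have hk := h.gluing.k_pos
  have hx : ∀ s, (X.φ ^ s) ((X.φ ^ a) (X.φ.symm X.root)) = X.bEdge (s + a - 1) ∨
      s = 0 ∧ a = 0 ∧ (X.φ ^ s) ((X.φ ^ a) (X.φ.symm X.root)) = X.bEdge (a + k + l - 1) :=
    fun s => by
    by_cases hs : s = 0 ∧ a = 0
    · refine Or.inr ⟨hs.1, hs.2, ?_⟩
      rw [← h.φ_symm_root, hs.1, hs.2]
      rfl
    · left
      rw [← X.φ_pow_add, ← X.φ_pow_φ_symm_root, show s + a - 1 + 1 = s + a by omega]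
  induction t with
  | zero =>
    rw [add_zero, show a + m = a + (m - 1) + 1 by omega, ← q.φ_bEdge, h.bEdge_mid (by omega),
      ← h.y_eq, h.gluing.φ_j_start, pow_x, add_zero]
  | succ t ih =>
    rw [← add_assoc, ← q.φ_bEdge, ih (by omega), h.gluing.φ_i, X.φ_bEdge]
    · rfl
    intro s hs hcon
    rcases hx s with h1 | ⟨-, -, h1⟩
    · rw [h1] at hcon
      have := X.bEdge_injOn (by omega) (by omega) hcon
      omega
    · rw [h1] at hcon
      have := X.bEdge_injOn (by omega) (by omega) hcon
      omega

/-- The vertices of the path. -/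
lemma tail_path [Finite E] [Finite F] (h : Completion q X Y a k l m i j) {t : ℕ} (ht : t ≤ k) :
    q.tail (i (X.bEdge (a + t))) = q.tail (j (Y.bEdge (m + k - t))) := by
  have := h.gluing.tail_path ht
  rwa [pow_x, pow_x, ← Nat.add_sub_assoc ht] at this

lemma bVert_left [Finite E] [Finite F] (h : Completion q X Y a k l m i j) {t : ℕ} (ht : t ≤ a) :
    q.bVert t = q.tail (i (X.bEdge t)) := by
  rcases ht.lt_or_eq with ht | rfl
  · rw [RootedMap.bVert, h.bEdge_left ht]
  · have h1 := h.tail_path (t := 0) (by omega)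
    rw [add_zero, Nat.sub_zero, ← h.per_Y, ← zero_add Y.per, Y.bEdge_add_per] at h1
    rw [h1, ← h.bEdge_mid h.m_pos]
    rfl

lemma bEdge_length [Finite E] [Finite F] (h : Completion q X Y a k l m i j) :
    q.bEdge (a + m + l) = q.root := by
  have hl := h.l_pos
  rw [show a + m + l = a + m + (l - 1) + 1 by omega, ← q.φ_bEdge, h.bEdge_right (by omega),
    h.root, h.φ_symm_root, show a + k + (l - 1) = a + k + l - 1 by omega]

lemma bVert_right [Finite E] [Finite F] (h : Completion q X Y a k l m i j) {t : ℕ} (ht : t ≤ l) :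
    q.bVert (a + m + t) = q.tail (i (X.bEdge (a + k + t))) := by
  rcases ht.lt_or_eq with ht | rfl
  · rw [RootedMap.bVert, h.bEdge_right ht]
  · rw [RootedMap.bVert, h.bEdge_length, ← h.per_X, X.bEdge_per]
    exact h.bVert_left (t := 0) (by omega)

lemma bVert_mid [Finite E] [Finite F] (h : Completion q X Y a k l m i j) {t : ℕ} (ht : t ≤ m) :
    q.bVert (a + t) = q.tail (j (Y.bEdge t)) := by
  rcases ht.lt_or_eq with ht | rfl
  · rw [RootedMap.bVert, h.bEdge_mid ht]
  · have h1 := h.tail_path (t := k) le_rfl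
    rw [Nat.add_sub_cancel] at h1
    rw [← h1]
    exact h.bVert_right (t := 0) (by omega)

lemma face_i [Finite E] (h : Completion q X Y a k l m i j) :
    q.face (i ((X.φ ^ a) (X.φ.symm X.root))) = q.extFace := by
  rw [← h.gluing.face_i_outer (face_x a) X.face_φ_symm_root fun t ht hcon => ?_,
    ← q.face_φ, ← h.root]
  · rfl
  · have := h.per_X
    have := h.l_pos
    rw [pow_x, h.φ_symm_root] at hcon
    have := X.bEdge_injOn (by omega) (by omega) hcon
    omega

/-- The edges of the path are matched in opposite directions. -/
lemma glue (h : Completion q X Y a k l m i j) {t : ℕ} (ht : t < k) :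
    i (X.bEdge (a + t)) = j (Y.α (Y.bEdge (m + k - t - 1))) := by
  have := h.gluing.glue t ht
  rwa [pow_x, show k - t = k - t - 1 + 1 by omega, pow_x,
    show m + (k - t - 1) = m + k - t - 1 by omega] at this

lemma overlap (h : Completion q X Y a k l m i j) {d : E} {e : F} (hde : i d = j e) :
    ∃ t, t < k ∧ ((d = X.bEdge (a + t) ∧ e = Y.α (Y.bEdge (m + k - t - 1))) ∨
      (d = X.α (X.bEdge (a + t)) ∧ e = Y.bEdge (m + k - t - 1))) := by
  obtain ⟨t, ht, h1⟩ := h.gluing.overlap d e hde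
  refine ⟨t, ht, ?_⟩
  rwa [pow_x, show k - t = k - t - 1 + 1 by omega, pow_x,
    show m + (k - t - 1) = m + k - t - 1 by omega] at h1

lemma exists_of_tail_eq (h : Completion q X Y a k l m i j) {d : E} {e : F}
    (hde : q.tail (i d) = q.tail (j e)) : ∃ t, t ≤ k ∧ X.tail d = X.bVert (a + t) ∧
      Y.tail e = Y.bVert (m + k - t) := by
  obtain ⟨t, ht, h1, h2⟩ := h.gluing.exists_of_tail_eq hde
  rw [pow_x] at h1 h2
  exact ⟨t, ht, h1, by rwa [← Nat.add_sub_assoc ht] at h2⟩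

lemma inner_iff [Finite E] [Finite F] (h : Completion q X Y a k l m i j) {z : D} :
    q.face z ≠ q.extFace ↔ (∃ d, i d = z ∧ X.face d ≠ X.extFace) ∨
      ∃ e, j e = z ∧ Y.face e ≠ Y.extFace :=
  h.gluing.face_eq_ext_iff (face_x a) (face_x m) h.face_i

/-- A vertex in the interior of the part of the boundary that comes from `Y` is not on `X`. -/
lemma bVert_mid_ne [Finite E] [Finite F] (h : Completion q X Y a k l m i j) (hs : Y.SimpleBoundary)
    {t : ℕ} (h0 : 0 < t) (ht : t < m) (d : E) : q.bVert (a + t) ≠ q.tail (i d) := by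
  intro hcon
  rw [h.bVert_mid ht.le] at hcon
  obtain ⟨s, hs', -, h2⟩ := h.exists_of_tail_eq hcon.symm
  have hY := h.per_Y
  have h3 := hs _ _ (Y.face_bEdge _) (Y.face_bEdge _) h2
  rcases Nat.eq_zero_or_pos s with rfl | hspos
  · rw [Nat.sub_zero, ← hY, ← zero_add Y.per, Y.bEdge_add_per] at h3
    have := Y.bEdge_injOn (by omega) (by omega) h3
    omega
  · have := Y.bEdge_injOn (by omega) (by omega) h3
    omega

end Completion

/-! ### The restriction as an embedded map -/

/-- The marked map `r` is the restriction of `q`, its darts being embedded in those of `q`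
by `i`. -/
structure Carries {D : Type} [Finite D] (q : RootedMap D) (ρ : q.Vertex) (pn : ℕ) (ε : ℝ)
    (r : MarkedMap) (i : r.Dart → D) : Prop where
  restrictable : q.Restrictable ρ pn ε
  inj : Function.Injective i
  range : Set.range i = q.kept ρ pn ε
  i_α : ∀ d, i (r.map.α d) = q.α (i d)
  returns : ∀ d, Returns q.σ (Set.range i) (i d) (i (r.map.σ d))
  root : ∃ n, (q.σ ^ n) q.root = i r.map.root ∧ ∀ l, l < n → (q.σ ^ l) q.root ∉ Set.range i
  ρ_iff : ∀ d, r.map.tail d = r.ρ ↔ q.tail (i d) = ρ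
  vm_iff : ∀ d, r.map.tail d = r.vm ↔ q.tail (i d) = q.vMinus ρ pn ε
  vp_iff : ∀ d, r.map.tail d = r.vp ↔ q.tail (i d) = q.vPlus ρ pn ε

namespace RootedMap

variable {D : Type} [Finite D] {q : RootedMap D} {ρ : q.Vertex} {pn : ℕ} {ε : ℝ}

lemma submap_tail_iff {K : Set D} {hα : ∀ d, q.α d ∈ K ↔ d ∈ K}
    {hroot : {k : ℕ | (q.σ ^ k) q.root ∈ K}.Nonempty} {d d' : K} :
    (q.submap K hα hroot).tail d = (q.submap K hα hroot).tail d' ↔ q.tail (d : D) = q.tail d' := by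
  rw [tail_eq_iff, tail_eq_iff]
  exact sameCycle_firstReturn

/-- The embedding `i` identifies the darts of `r` with the kept darts. The conditions on the
distinguished vertices are expressed on all the darts of `r`, so that the vertices survive. -/
theorem restrictionClass_eq_some_iff {r : MarkedMap} :
    q.restrictionClass ρ pn ε = some (Quotient.mk MarkedMap.setoid r) ↔
      ∃ i, Carries q ρ pn ε r i := by
  unfold restrictionClass restriction
  constructor
  · intro h
    split_ifs at h with h0
    · rw [Option.map_some, Option.some_inj] at h
      obtain ⟨e, h1, h2, h3, h4, h5, h6⟩ := Quotient.exact h.symm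
      dsimp only at e h1 h2 h3 h4 h5 h6
      have hr : Set.range (fun d => (e d : D)) = q.kept ρ pn ε := by
        ext z
        constructor
        · rintro ⟨d, rfl⟩
          exact (e d).2
        · intro hz
          exact ⟨e.symm ⟨z, hz⟩, by simp only [Equiv.apply_symm_apply]⟩
      refine ⟨fun d => e d, h0.1, Subtype.val_injective.comp e.injective, hr, fun d => ?_,
        fun d => ?_, ⟨_, (congrArg Subtype.val h3).symm, fun l hl => ?_⟩, fun d => ?_, fun d => ?_,
        fun d => ?_⟩
      · rw [h2]
        rfl
      · rw [hr, h1]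
        exact returns_firstReturn _ _ _
      · rw [hr]
        exact Nat.notMem_of_lt_sInf hl
      · rw [h4, submap_tail_iff, h0.2.2.1.choose_spec.2]
      · rw [h5, submap_tail_iff, h0.2.2.2.1.choose_spec.2]
      · rw [h6, submap_tail_iff, h0.2.2.2.2.choose_spec.2]
    · simp at h
  · rintro ⟨i, h⟩
    have surv : ∀ {v : r.map.Vertex} {w : q.Vertex},
        (∀ d, r.map.tail d = v ↔ q.tail (i d) = w) → q.Survives (q.kept ρ pn ε) w := by
      intro v w hvw
      obtain ⟨d, hd⟩ := r.map.tail_surjective v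
      exact ⟨i d, by rw [← h.range]; exact ⟨d, rfl⟩, (hvw d).1 hd⟩
    obtain ⟨n, hn, hn'⟩ := h.root
    rw [h.range] at hn'
    have hmem : ∀ d, i d ∈ q.kept ρ pn ε := fun d => by
      rw [← h.range]
      exact ⟨d, rfl⟩
    have hne : {k : ℕ | (q.σ ^ k) q.root ∈ q.kept ρ pn ε}.Nonempty := ⟨n, by
      rw [Set.mem_ofPred_eq, hn]
      exact hmem _⟩
    have hinf : sInf {k : ℕ | (q.σ ^ k) q.root ∈ q.kept ρ pn ε} = n := by
      refine le_antisymm (Nat.sInf_le (by rw [Set.mem_ofPred_eq, hn]; exact hmem _)) ?_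
      by_contra hcon
      exact hn' _ (not_le.1 hcon) (Nat.sInf_mem hne)
    have h0 : q.Restrictable ρ pn ε ∧ {k : ℕ | (q.σ ^ k) q.root ∈ q.kept ρ pn ε}.Nonempty ∧
      q.Survives (q.kept ρ pn ε) ρ ∧ q.Survives (q.kept ρ pn ε) (q.vMinus ρ pn ε) ∧
      q.Survives (q.kept ρ pn ε) (q.vPlus ρ pn ε) :=
      ⟨h.restrictable, hne, surv h.ρ_iff, surv h.vm_iff, surv h.vp_iff⟩
    rw [dif_pos h0, Option.map_some, Option.some_inj]
    refine Eq.symm (Quotient.sound ?_)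
    let e : r.Dart ≃ q.kept ρ pn ε := Equiv.ofBijective (fun d => ⟨i d, hmem d⟩)
      ⟨fun d d' hd => h.inj (congrArg Subtype.val hd), fun z => by
        obtain ⟨d, hd⟩ : (z : D) ∈ Set.range i := by
          rw [h.range]
          exact z.2
        exact ⟨d, Subtype.ext hd⟩⟩
    refine ⟨e, fun d => ?_, fun d => Subtype.ext (h.i_α d), Subtype.ext ?_, fun d => ?_,
      fun d => ?_, fun d => ?_⟩
    · have := h.returns d
      rw [h.range] at this
      exact Subtype.ext (firstReturn_eq_of_returns (x := e d) this (hmem _)).symm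
    · change i r.map.root = (q.σ ^ sInf _) q.root
      rw [hinf, hn]
    · rw [h.ρ_iff]
      dsimp only
      rw [submap_tail_iff, h0.2.2.1.choose_spec.2]
      rfl
    · rw [h.vm_iff]
      dsimp only
      rw [submap_tail_iff, h0.2.2.2.1.choose_spec.2]
      rfl
    · rw [h.vp_iff]
      dsimp only
      rw [submap_tail_iff, h0.2.2.2.2.choose_spec.2]
      rfl

end RootedMap

/-! ### Isomorphisms -/

namespace RootedMap

/-- The bijection `e` is an isomorphism of rooted maps. -/
structure IsIso {D D' : Type} (m : RootedMap D) (m' : RootedMap D') (e : D ≃ D') : Prop where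
  σ : ∀ d, e (m.σ d) = m'.σ (e d)
  α : ∀ d, e (m.α d) = m'.α (e d)
  root : e m.root = m'.root

variable {D D' : Type} {m : RootedMap D} {m' : RootedMap D'} {e : D ≃ D'}

lemma iso_iff : m.Iso m' ↔ ∃ e, m.IsIso m' e :=
  ⟨fun ⟨e, h1, h2, h3⟩ => ⟨e, h1, h2, h3⟩, fun ⟨e, h⟩ => ⟨e, h.σ, h.α, h.root⟩⟩

namespace IsIso

lemma symm (h : m.IsIso m' e) : m'.IsIso m e.symm where
  σ d := by rw [Equiv.symm_apply_eq, h.σ, Equiv.apply_symm_apply]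
  α d := by rw [Equiv.symm_apply_eq, h.α, Equiv.apply_symm_apply]
  root := by rw [Equiv.symm_apply_eq, h.root]

lemma φ (h : m.IsIso m' e) (d : D) : e (m.φ d) = m'.φ (e d) := by
  rw [φ_apply, h.σ, h.α, φ_apply]

lemma φ_pow (h : m.IsIso m' e) (t : ℕ) (d : D) : e ((m.φ ^ t) d) = (m'.φ ^ t) (e d) := by
  induction t with
  | zero => rfl
  | succ t ih => rw [φ_pow_succ, h.φ, ih, φ_pow_succ]

lemma bEdge (h : m.IsIso m' e) (t : ℕ) : e (m.bEdge t) = m'.bEdge t := by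
  rw [RootedMap.bEdge, h.φ_pow, h.root]
  rfl

lemma φ_symm_root (h : m.IsIso m' e) : e (m.φ.symm m.root) = m'.φ.symm m'.root := by
  rw [Equiv.eq_symm_apply, ← h.φ, Equiv.apply_symm_apply, h.root]

lemma tail_of (h : m.IsIso m' e) {d d' : D} (hd : m.tail d = m.tail d') :
    m'.tail (e d) = m'.tail (e d') :=
  m.apply_eq_of_tail_eq (f := fun d => m'.tail (e d))
    (fun d => by rw [h.σ, m'.tail_σ]) hd

lemma tail_iff (h : m.IsIso m' e) {d d' : D} :
    m'.tail (e d) = m'.tail (e d') ↔ m.tail d = m.tail d' :=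
  ⟨fun hd => by simpa using h.symm.tail_of hd, h.tail_of⟩

lemma face_of (h : m.IsIso m' e) {d d' : D} (hd : m.face d = m.face d') :
    m'.face (e d) = m'.face (e d') :=
  m.apply_eq_of_face_eq (f := fun d => m'.face (e d))
    (fun d => by rw [h.φ, m'.face_φ]) hd

lemma face_iff (h : m.IsIso m' e) {d d' : D} :
    m'.face (e d) = m'.face (e d') ↔ m.face d = m.face d' :=
  ⟨fun hd => by simpa using h.symm.face_of hd, h.face_of⟩

lemma face_ext_iff (h : m.IsIso m' e) {d : D} :
    m'.face (e d) = m'.extFace ↔ m.face d = m.extFace := by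
  rw [extFace, ← h.root, h.face_iff, extFace]

lemma degree (h : m.IsIso m' e) (d : D) : m'.degree (m'.face (e d)) = m.degree (m.face d) :=
  (Nat.card_congr (e.subtypeEquiv fun _ => h.face_iff.symm)).symm

lemma per (h : m.IsIso m' e) : m'.per = m.per := by
  rw [RootedMap.per, extFace, ← h.root, h.degree]
  rfl

lemma connected (h : m.IsIso m' e) (hc : m.Connected) : m'.Connected := by
  have key : ∀ x y, Relation.EqvGen (fun x y => y = m.σ x ∨ y = m.α x) x y →
      Relation.EqvGen (fun x y => y = m'.σ x ∨ y = m'.α x) (e x) (e y) := by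
    intro x y hxy
    induction hxy with
    | rel x y hxy =>
      refine Relation.EqvGen.rel _ _ ?_
      rcases hxy with rfl | rfl
      · exact Or.inl (h.σ x)
      · exact Or.inr (h.α x)
    | refl x => exact Relation.EqvGen.refl _
    | symm x y _ ih => exact Relation.EqvGen.symm _ _ ih
    | trans x y z _ _ ih1 ih2 => exact Relation.EqvGen.trans _ _ _ ih1 ih2
  intro d d'
  have := key _ _ (hc (e.symm d) (e.symm d'))
  simpa using this

/-- The bijection between the sets of faces. -/
def faceEquiv (h : m.IsIso m' e) : m.Face ≃ m'.Face :=
  Quotient.congr e fun _ _ => (m.face_eq_iff.symm.trans h.face_iff.symm).trans m'.face_eq_iff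

lemma planar (h : m.IsIso m' e) (hp : m.Planar) : m'.Planar := by
  have h1 : Nat.card m.Vertex = Nat.card m'.Vertex := Nat.card_congr (Quotient.congr e fun _ _ =>
    (m.tail_eq_iff.symm.trans h.tail_iff.symm).trans m'.tail_eq_iff)
  have h2 : Nat.card m.Face = Nat.card m'.Face := Nat.card_congr h.faceEquiv
  have h3 : Nat.card D = Nat.card D' := Nat.card_congr e
  rw [Planar, ← h1, ← h2, ← h3]
  exact hp

lemma area (h : m.IsIso m' e) : m'.area = m.area :=
  (Nat.card_congr (h.faceEquiv.subtypeEquiv fun f => by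
    obtain ⟨d, rfl⟩ := m.face_surjective f
    exact not_congr h.face_ext_iff.symm)).symm

lemma isSimpleQuad {n p : ℕ} (h : m.IsIso m' e) (hm : m.IsSimpleQuad n p) :
    m'.IsSimpleQuad n p where
  connected := h.connected hm.connected
  planar := h.planar hm.planar
  degree_inner f hf := by
    obtain ⟨d, rfl⟩ := m'.face_surjective f
    obtain ⟨d, rfl⟩ := e.surjective d
    rw [h.degree]
    exact hm.degree_inner _ fun h' => hf (h.face_ext_iff.2 h')
  per_eq := h.per.trans hm.per_eq
  area_eq := h.area.trans hm.area_eq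
  simple d d' hd hd' hdd := by
    obtain ⟨d, rfl⟩ := e.surjective d
    obtain ⟨d', rfl⟩ := e.surjective d'
    rw [hm.simple d d' (h.face_ext_iff.1 hd) (h.face_ext_iff.1 hd') (h.tail_iff.1 hdd)]

end IsIso

/-- Every quadrangulation with a simple boundary can be relabeled. -/
lemma IsSimpleQuad.exists_labeled [Finite D] {n p : ℕ} (hm : m.IsSimpleQuad n p) :
    ∃ (q : LabeledQuad n p) (e : D ≃ Fin (4 * n + p)), m.IsIso q.1 e := by
  have hcard : Nat.card D = 4 * n + p := by
    rw [m.card_eq_of_degree_inner hm.degree_inner, hm.per_eq, hm.area_eq]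
  let e : D ≃ Fin (4 * n + p) := Finite.equivFinOfCardEq hcard
  let m' : RootedMap (Fin (4 * n + p)) :=
    { σ := e.permCongr m.σ
      α := e.permCongr m.α
      root := e m.root
      α_α := fun d => by simp [m.α_α]
      α_ne := fun d h => m.α_ne (e.symm d) (by
        rw [Equiv.permCongr_apply] at h
        rw [Equiv.eq_symm_apply, h]) }
  have h : m.IsIso m' e := ⟨fun d => by simp [m'], fun d => by simp [m'], rfl⟩
  exact ⟨⟨m', h.isSimpleQuad hm⟩, e, h⟩

end RootedMap

namespace Gluing

variable {D D' E E' F F' : Type} {q : RootedMap D} {q' : RootedMap D'} {X : RootedMap E}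
  {X' : RootedMap E'} {Y : RootedMap F} {Y' : RootedMap F'} {k : ℕ} {x : E}
  {y : F} {i : E → D} {j : F → D}

lemma congr_left (g : Gluing q X Y k x y i j) {e : E ≃ E'} (h : X.IsIso X' e) :
    Gluing q X' Y k (e x) y (i ∘ e.symm) j where
  k_pos := g.k_pos
  i_inj := g.i_inj.comp e.symm.injective
  j_inj := g.j_inj
  i_α d := by
    rw [Function.comp_apply, h.symm.α]
    exact g.i_α _
  j_α := g.j_α
  cover z := (g.cover z).imp (fun ⟨d, hd⟩ => ⟨e d, by simpa using hd⟩) id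
  overlap d e' hde := by
    obtain ⟨t, ht, h1⟩ := g.overlap _ _ hde
    refine ⟨t, ht, h1.imp (fun h2 => ⟨?_, h2.2⟩) fun h2 => ⟨?_, h2.2⟩⟩
    · rw [← h.φ_pow, ← h2.1, Equiv.apply_symm_apply]
    · rw [← h.φ_pow, ← h.α, ← h2.1, Equiv.apply_symm_apply]
  glue t ht := by
    rw [Function.comp_apply, ← h.φ_pow, Equiv.symm_apply_apply, g.glue t ht]
  φ_i d hd := by
    rw [Function.comp_apply, Function.comp_apply, h.symm.φ]
    refine g.φ_i _ fun t ht h1 => hd t ht ?_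
    rw [← h.φ_pow, ← h1, Equiv.apply_symm_apply]
  φ_j := g.φ_j
  φ_i_start := by
    rw [Function.comp_apply, Equiv.symm_apply_apply, g.φ_i_start]
  φ_j_start := by
    rw [Function.comp_apply, ← h.φ_pow, Equiv.symm_apply_apply, g.φ_j_start]
  tail_X s t hs ht hst := by
    rw [← h.φ_pow, ← h.φ_pow, h.tail_iff] at hst
    exact g.tail_X s t hs ht hst
  tail_Y := g.tail_Y

lemma congr_map (g : Gluing q X Y k x y i j) {e : D ≃ D'} (h : q.IsIso q' e) :
    Gluing q' X Y k x y (e ∘ i) (e ∘ j) where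
  k_pos := g.k_pos
  i_inj := e.injective.comp g.i_inj
  j_inj := e.injective.comp g.j_inj
  i_α d := by rw [Function.comp_apply, g.i_α, h.α]; rfl
  j_α d := by rw [Function.comp_apply, g.j_α, h.α]; rfl
  cover z := (g.cover (e.symm z)).imp (fun ⟨d, hd⟩ => ⟨d, by simp [hd]⟩)
    fun ⟨d, hd⟩ => ⟨d, by simp [hd]⟩
  overlap d e' hde := g.overlap _ _ (e.injective hde)
  glue t ht := congrArg e (g.glue t ht)
  φ_i d hd := by rw [Function.comp_apply, ← h.φ, g.φ_i d hd]; rfl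
  φ_j d hd := by rw [Function.comp_apply, ← h.φ, g.φ_j d hd]; rfl
  φ_i_start := by rw [Function.comp_apply, ← h.φ, g.φ_i_start]; rfl
  φ_j_start := by rw [Function.comp_apply, ← h.φ, g.φ_j_start]; rfl
  tail_X := g.tail_X
  tail_Y := g.tail_Y

end Gluing

namespace Completion

variable {D D' E E' F F' : Type} {q : RootedMap D} {q' : RootedMap D'} {X : RootedMap E}
  {X' : RootedMap E'} {Y : RootedMap F} {Y' : RootedMap F'} {a k l m : ℕ}
  {i : E → D} {j : F → D}

lemma congr_left (c : Completion q X Y a k l m i j) {e : E ≃ E'} (h : X.IsIso X' e) :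
    Completion q X' Y a k l m (i ∘ e.symm) j where
  gluing := by
    have := c.gluing.congr_left h
    rwa [h.φ_pow, h.φ_symm_root] at this
  root := by rw [Function.comp_apply, h.symm.φ_symm_root, c.root]
  per_X := h.per.trans c.per_X
  per_Y := c.per_Y
  l_pos := c.l_pos
  m_pos := c.m_pos

lemma congr_right (c : Completion q X Y a k l m i j) {e : F ≃ F'} (h : Y.IsIso Y' e) :
    Completion q X Y' a k l m i (j ∘ e.symm) where
  gluing := by
    have := (c.gluing.symm.congr_left h).symm
    rwa [h.φ_pow, h.φ_symm_root] at this
  root := c.root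
  per_X := c.per_X
  per_Y := h.per.trans c.per_Y
  l_pos := c.l_pos
  m_pos := c.m_pos

lemma congr_map (c : Completion q X Y a k l m i j) {e : D ≃ D'} (h : q.IsIso q' e) :
    Completion q' X Y a k l m (e ∘ i) (e ∘ j) where
  gluing := c.gluing.congr_map h
  root := by rw [← h.root, c.root, h.φ]; rfl
  per_X := c.per_X
  per_Y := c.per_Y
  l_pos := c.l_pos
  m_pos := c.m_pos

end Completion

/-! ### The suppressed part of a quadrangulation -/

/-- The map with a single edge. -/
def edgeMap : RootedMap Bool where
  σ := 1
  α := Equiv.boolNot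
  root := true
  α_α := by decide
  α_ne := by decide

lemma edgeMap_face (d : Bool) : edgeMap.face d = edgeMap.extFace := by
  cases d
  · exact edgeMap.face_φ true
  · rfl

lemma edgeMap_tail_injective : Function.Injective edgeMap.tail := fun d d' h => by
  rw [RootedMap.tail_eq_iff] at h
  exact Equiv.Perm.sameCycle_one.1 h

lemma edgeMap_isSimpleQuad : edgeMap.IsSimpleQuad 0 2 := by
  have h0 : IsEmpty {f : edgeMap.Face // f ≠ edgeMap.extFace} := ⟨fun ⟨f, hf⟩ => by
    obtain ⟨d, rfl⟩ := edgeMap.face_surjective f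
    exact hf (edgeMap_face d)⟩
  have harea : edgeMap.area = 0 := Nat.card_of_isEmpty
  have hV : Nat.card edgeMap.Vertex = 2 := by
    rw [← Nat.card_congr (Equiv.ofBijective edgeMap.tail
      ⟨edgeMap_tail_injective, edgeMap.tail_surjective⟩)]
    simp
  refine ⟨fun d d' => ?_, ?_, fun f hf => (h0.false ⟨f, hf⟩).elim, ?_, harea, fun d d' _ _ h =>
    edgeMap_tail_injective h⟩
  · have h1 : Relation.EqvGen (fun x y => y = edgeMap.σ x ∨ y = edgeMap.α x) true false :=
      Relation.EqvGen.rel _ _ (Or.inr rfl)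
    cases d <;> cases d'
    · exact Relation.EqvGen.refl _
    · exact h1.symm
    · exact h1
    · exact Relation.EqvGen.refl _
  · rw [RootedMap.Planar, hV, edgeMap.card_face, harea]
    simp
  · rw [RootedMap.per, RootedMap.degree, Nat.card_congr (Equiv.subtypeUnivEquiv edgeMap_face)]
    simp

namespace Carries

variable {D : Type} [Finite D] {q : RootedMap D} {ρ : q.Vertex} {pn : ℕ} {ε : ℝ} {r : MarkedMap}
  {i : r.Dart → D}

/-- The root of the restriction follows, on its boundary, the last boundary edge of `q`. -/
lemma root_eq (h : Carries q ρ pn ε r i) {d : r.Dart} (hd : q.φ (i d) = q.root) :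
    r.map.φ d = r.map.root := by
  obtain ⟨n, hn, hn'⟩ := h.root
  have h1 : q.σ (i (r.map.α d)) = q.root := by rw [h.i_α, ← hd]; rfl
  have h2 : ∀ l, (q.σ ^ (l + 1)) (i (r.map.α d)) = (q.σ ^ l) q.root := fun l => by
    rw [pow_succ, Equiv.Perm.mul_apply, h1]
  have h3 : Returns q.σ (Set.range i) (i (r.map.α d)) (i r.map.root) := by
    refine ⟨n + 1, by omega, by rw [h2, hn], fun l hl hl' => ?_⟩
    obtain ⟨l, rfl⟩ : ∃ s, l = s + 1 := ⟨l - 1, by omega⟩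
    rw [h2]
    exact hn' l (by omega)
  have h4 := firstReturn_eq_of_returns (K := Set.range i) (x := ⟨i (r.map.α d), ⟨_, rfl⟩⟩) h3
    (Set.mem_range_self _)
  have h5 := firstReturn_eq_of_returns (K := Set.range i) (x := ⟨i (r.map.α d), ⟨_, rfl⟩⟩)
    (h.returns (r.map.α d)) (Set.mem_range_self _)
  exact h.inj (h5.symm.trans h4)

/-- The case where a part of the quadrangulation is suppressed. -/
lemma exists_completion_of_nonempty {n p : ℕ} (hq : q.IsSimpleQuad n p) (h : Carries q ρ pn ε r i)
    (hne : (q.outFaces ρ pn ε).Nonempty) :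
    ∃ (F : Type) (_ : Finite F) (Y : RootedMap F) (j : F → D) (k l m : ℕ),
      Completion q r.map Y (q.idxMinus ρ pn ε) k l m i j ∧ Y.IsSimpleQuad Y.area (m + k) ∧
      q.idxPlus ρ pn ε = q.idxMinus ρ pn ε + m ∧ q.per = q.idxMinus ρ pn ε + m + l ∧
      r.map.Connected ∧ r.map.Planar ∧
      (∀ d, r.map.face d ≠ r.map.extFace ↔ q.face (i d) ∈ q.innerCompl (q.outFaces ρ pn ε)) ∧
      ∀ t, t < k → q.face (i (r.map.bEdge (q.idxMinus ρ pn ε + t))) ∈ q.outFaces ρ pn ε := by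
  have hs := hq.simpleBoundary
  have cut := h.restrictable.arcCut hq.connected hs hne
  have hcompl := cut.side_compl hq.planar hq.connected hs
  have hab := cut.a_lt
  have hbp := cut.b_lt
  have := r.finite
  set T := q.outFaces ρ pn ε
  set a := q.idxMinus ρ pn ε
  set b := q.idxPlus ρ pn ε
  have hmem : ∀ d, i d ∈ q.edgesOf (q.innerCompl T) := fun d => by
    have : i d ∈ q.kept ρ pn ε := by
      rw [← h.range]
      exact ⟨d, rfl⟩
    exact this
  let e : r.Dart ≃ q.edgesOf (q.innerCompl T) := Equiv.ofBijective (fun d => ⟨i d, hmem d⟩)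
    ⟨fun d d' hd => h.inj (congrArg Subtype.val hd), fun z => by
      obtain ⟨d, hd⟩ : (z : D) ∈ Set.range i := by
        rw [h.range]
        exact z.2
      exact ⟨d, Subtype.ext hd⟩⟩
  have he : ∀ d, (e d : D) = i d := fun _ => rfl
  set X := q.sub (q.innerCompl T) (e r.map.root) with hX
  have hiso : r.map.IsIso X e := by
    refine ⟨fun d => Subtype.ext ?_, fun d => Subtype.ext (h.i_α d), rfl⟩
    have := h.returns d
    rw [h.range] at this
    exact (firstReturn_eq_of_returns (x := e d) this (hmem _)).symm
  let eb : q.edgesOf (q.innerCompl T) := ⟨q.bEdge b, Or.inr (hcompl.arc 0 hcompl.L_pos)⟩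
  let e' : q.edgesOf T := ⟨q.bEdge a, Or.inr (cut.arc_mem a le_rfl hab)⟩
  obtain ⟨k, hk1, hk2, g⟩ := cut.gluing hq.planar hq.connected hs (r := e r.map.root) (e := eb) rfl
    (r' := e') (e' := e') rfl
  rw [← hX] at hk1 g
  set Y := q.sub T e' with hY
  have hside : q.Side (q.innerCompl T) (eb : D) (q.per - (b - a)) := hcompl
  -- the last boundary edge is kept
  have hlast : X.φ.symm X.root = (X.φ ^ (q.per - 1 - b)) eb := by
    have h1 : i (e.symm ((X.φ ^ (q.per - 1 - b)) eb)) = q.bEdge (q.per - 1) := by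
      rw [← he, Equiv.apply_symm_apply, hX, hside.φ_pow_eq (by omega)]
      change (q.φ ^ (q.per - 1 - b)) (q.bEdge b) = _
      rw [q.φ_pow_bEdge, Nat.sub_add_cancel (by omega)]
    have h2 := h.root_eq (d := e.symm ((X.φ ^ (q.per - 1 - b)) eb)) (by
      rw [h1, q.φ_bEdge, Nat.sub_add_cancel (by omega), q.bEdge_per])
    rw [Equiv.symm_apply_eq, ← hiso.root, ← h2, hiso.φ, Equiv.apply_symm_apply]
  have hext : X.face eb = X.extFace := by
    rw [← X.face_φ_symm_root, hlast, X.face_φ_pow]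
  have hXper : X.per = q.per - (b - a) + k := by
    rw [RootedMap.per, ← hext, hk1]
  have hYper : Y.per = b - a + k := hk2
  have comp : Completion q X Y a k (q.per - b) (b - a) Subtype.val Subtype.val :=
    { gluing := by
        have h1 : (X.φ ^ a) (X.φ.symm X.root) = (X.φ ^ (q.per - (b - a) - 1)) eb := by
          rw [hlast, ← X.φ_pow_add]
          congr 2
          omega
        have h2 : (Y.φ ^ (b - a)) (Y.φ.symm Y.root) = (Y.φ ^ (b - a - 1)) e' := by
          rw [show b - a = b - a - 1 + 1 by omega, Y.φ_pow_φ_symm_root]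
          rfl
        rw [h1, h2]
        exact g
      root := by
        rw [hlast, hX, hside.φ_pow_eq (by omega)]
        change _ = q.φ ((q.φ ^ (q.per - 1 - b)) (q.bEdge b))
        rw [q.φ_pow_bEdge, q.φ_bEdge, show q.per - 1 - b + b + 1 = q.per by omega, q.bEdge_per]
      per_X := by omega
      per_Y := by omega
      l_pos := by omega
      m_pos := by omega }
  have hXc : X.Connected := RootedMap.sub_connected cut.conn_compl
  have hYc : Y.Connected := RootedMap.sub_connected cut.conn
  have hplanar := (comp.gluing.planar_iff (Completion.face_x a) (Completion.face_x _) comp.face_i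
    hXc hYc).1 hq.planar
  have hXin : ∀ d, X.face d ≠ X.extFace ↔ q.face (d : D) ∈ q.innerCompl T := fun d => by
    constructor
    · intro hd
      by_contra h1
      exact hd (by rw [← hext, hside.face_eq (r := e r.map.root) h1])
    · intro hd hd'
      rw [← hext] at hd'
      exact ((RootedMap.sub_mem_iff_of_face_eq hd').1 hd).1 (q.face_bEdge b)
  have hYside : q.Side T (e' : D) (b - a) := cut.side hq.planar hq.connected hs
  have comp' := comp.congr_left hiso.symm
  have hrin : ∀ d, r.map.face d ≠ r.map.extFace ↔ q.face (i d) ∈ q.innerCompl T := fun d => by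
    rw [← he, ← hXin, Ne, Ne, hiso.face_ext_iff]
  refine ⟨q.edgesOf T, inferInstance, Y, Subtype.val, k, q.per - b, b - a, comp',
    ⟨hYc, hplanar.2, fun f hf => ?_, by omega, rfl, cut.simpleBoundary_sub hq.planar hq.connected hs
      rfl⟩, by omega, by omega, hiso.symm.connected hXc, hiso.symm.planar hplanar.1, hrin,
    fun t ht => ?_⟩
  · obtain ⟨d, rfl⟩ := Y.face_surjective f
    have hd := hYside.face_mem_of_ne (r := e') hf
    rw [hY, RootedMap.sub_degree hd]
    exact hq.degree_inner _ fun h' => cut.ext_notMem (h' ▸ hd)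
  · have h1 : (i (r.map.bEdge (a + t)) : D) = _ := comp'.glue ht
    have h2 : i (r.map.bEdge (a + t)) = ((X.φ ^ (q.per - (b - a) + t)) eb : D) := by
      rw [← he, hiso.bEdge, ← X.φ_pow_φ_symm_root, hlast, ← X.φ_pow_add]
      congr 3
      omega
    have h3 : (X.degree (X.face eb)) = X.per := by rw [hext]; rfl
    have h4 := hside.crossing (r := e r.map.root) (t := t) (by
      have : (q.sub (q.innerCompl T) (e r.map.root)).degree
        ((q.sub (q.innerCompl T) (e r.map.root)).face eb) = X.per := h3
      omega)
    rw [h2]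
    by_contra h5
    exact h4.1 ⟨h4.2.1, h5⟩

/-- The case where nothing is suppressed: the boundary edge from `v⁻` to `v⁺` is then opened. -/
lemma exists_completion_of_eq_empty {n p : ℕ} (hq : q.IsSimpleQuad n p)
    (h : Carries q ρ pn ε r i) (hT : q.outFaces ρ pn ε = ∅) :
    ∃ (j : Bool → D) (l : ℕ), Completion q r.map edgeMap (q.idxMinus ρ pn ε) 1 l 1 i j ∧
      q.per = q.idxMinus ρ pn ε + 1 + l ∧ r.map.Connected ∧ r.map.Planar ∧
      ∀ d, r.map.face d ≠ r.map.extFace ↔ q.face (i d) ∈ q.innerCompl (q.outFaces ρ pn ε) := by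
  have hs := hq.simpleBoundary
  have hb := h.restrictable.idxPlus_eq hq.connected hs hT
  have hbp := h.restrictable.idxPlus_mem.2.1
  obtain ⟨x₀, hx₀⟩ := h.restrictable.exists_inner
  have hin : q.innerCompl (q.outFaces ρ pn ε) = {f | f ≠ q.extFace} := by
    rw [hT]
    ext f
    exact and_iff_left (Set.notMem_empty f)
  have hsurj : Function.Surjective i := fun z => by
    have : z ∈ Set.range i := by
      rw [h.range, RootedMap.kept_eq, RootedMap.edgesOf, hin]
      by_cases hz : q.face z = q.extFace
      · exact Or.inr (hs.face_α_ne hq.connected hx₀ hz)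
      · exact Or.inl hz
    exact this
  let e : r.Dart ≃ D := Equiv.ofBijective i ⟨h.inj, hsurj⟩
  have he : ∀ d, e d = i d := fun _ => rfl
  have hrange : ∀ z, z ∈ Set.range i := hsurj
  have hiso : r.map.IsIso q e := by
    refine ⟨fun d => ?_, h.i_α, ?_⟩
    · have h1 := firstReturn_eq_of_returns (K := Set.range i) (x := ⟨i d, ⟨_, rfl⟩⟩)
        (h.returns d) (hrange _)
      rw [firstReturn_eq_apply (hrange _)] at h1
      exact h1.symm
    · obtain ⟨n, hn, hn'⟩ := h.root
      rcases Nat.eq_zero_or_pos n with rfl | hpos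
      · exact hn.symm
      · exact absurd (hrange _) (hn' 0 hpos)
  set a := q.idxMinus ρ pn ε
  have hbE : ∀ t, i (r.map.bEdge t) = q.bEdge t := hiso.bEdge
  have hrper : r.map.per = q.per := hiso.per.symm
  let j : Bool → D := fun s => if s then q.bEdge a else q.α (q.bEdge a)
  have ha : q.bEdge a ≠ q.α (q.bEdge a) := (q.α_ne _).symm
  have hx : ∀ t, ((r.map.φ ^ (t + 1)) ((r.map.φ ^ a) (r.map.φ.symm r.map.root))) =
    r.map.bEdge (a + t) := Completion.pow_x a
  have hix : q.φ (i ((r.map.φ ^ a) (r.map.φ.symm r.map.root))) = q.bEdge a := by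
    rw [← he, ← hiso.φ, ← r.map.φ_pow_succ, r.map.φ_pow_φ_symm_root, he, hbE]
  have hj : Function.Injective j := fun s s' hss => by
    cases s <;> cases s' <;> first | rfl | exact absurd hss ha | exact absurd hss.symm ha
  refine ⟨j, q.per - q.idxPlus ρ pn ε, ⟨?_, ?_, by omega, edgeMap_isSimpleQuad.per_eq, by omega,
    one_pos⟩, by omega, hiso.symm.connected hq.connected, hiso.symm.planar hq.planar, fun d => ?_⟩
  · exact
      { k_pos := one_pos
        i_inj := h.inj
        j_inj := hj
        i_α := h.i_α
        j_α := fun s => by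
          cases s
          · exact (q.α_α _).symm
          · rfl
        cover := fun z => Or.inl (hsurj z)
        overlap := fun d s hds => by
          refine ⟨0, one_pos, ?_⟩
          rw [hx]
          cases s
          · refine Or.inr ⟨h.inj ?_, rfl⟩
            rw [h.i_α, add_zero, hbE, hds]
            rfl
          · refine Or.inl ⟨h.inj ?_, rfl⟩
            rw [add_zero, hbE, hds]
            rfl
        glue := fun t ht => by
          obtain rfl : t = 0 := by omega
          rw [hx, add_zero, hbE]
          rfl
        φ_i := fun d _ => (hiso.φ d).symm
        φ_j := fun s hs' => by
          cases s
          · exact absurd rfl (hs' 1 le_rfl)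
          · exact absurd rfl (hs' 0 zero_le_one)
        φ_i_start := hix
        φ_j_start := by
          rw [hx, hbE]
          exact q.φ_bEdge a
        tail_X := fun s t hs' ht hst => by
          rw [hx, hx, ← hiso.tail_iff, he, he, hbE, hbE] at hst
          have := q.bEdge_injOn (by omega) (by omega)
            (hs _ _ (q.face_bEdge _) (q.face_bEdge _) hst)
          omega
        tail_Y := fun s t hs' ht hst => by
          have h1 := edgeMap_tail_injective hst
          interval_cases s <;> interval_cases t <;> first | rfl | cases h1 }
  · rw [← he, hiso.φ_symm_root, Equiv.apply_symm_apply]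
  · rw [hin, Ne, ← hiso.face_ext_iff]
    rfl

/-- A quadrangulation is obtained by filling its restriction with a quadrangulation with a simple
boundary. Either the filling is reduced to an edge, or the path along which it is glued is incident
to suppressed faces. -/
theorem exists_completion {n p : ℕ} (hq : q.IsSimpleQuad n p) (h : Carries q ρ pn ε r i) :
    ∃ (F : Type) (_ : Finite F) (Y : RootedMap F) (j : F → D) (k l m : ℕ),
      Completion q r.map Y (q.idxMinus ρ pn ε) k l m i j ∧ Y.IsSimpleQuad Y.area (m + k) ∧
      q.idxPlus ρ pn ε = q.idxMinus ρ pn ε + m ∧ q.per = q.idxMinus ρ pn ε + m + l ∧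
      r.map.Connected ∧ r.map.Planar ∧
      (∀ d, r.map.face d ≠ r.map.extFace ↔ q.face (i d) ∈ q.innerCompl (q.outFaces ρ pn ε)) ∧
      ((q.outFaces ρ pn ε = ∅ ∧ k = 1 ∧
          i (r.map.bEdge (q.idxMinus ρ pn ε)) = q.bEdge (q.idxMinus ρ pn ε)) ∨
        ∀ t, t < k → q.face (i (r.map.bEdge (q.idxMinus ρ pn ε + t))) ∈ q.outFaces ρ pn ε) := by
  rcases Set.eq_empty_or_nonempty (q.outFaces ρ pn ε) with hT | hT
  · obtain ⟨j, l, h1, hper, h2, h3, h4⟩ := h.exists_completion_of_eq_empty hq hT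
    refine ⟨Bool, inferInstance, edgeMap, j, 1, l, 1, h1, ?_,
      h.restrictable.idxPlus_eq hq.connected hq.simpleBoundary hT, hper, h2, h3, h4,
      Or.inl ⟨hT, rfl, ?_⟩⟩
    · rw [edgeMap_isSimpleQuad.area_eq]
      exact edgeMap_isSimpleQuad
    · have := r.finite
      exact (h1.glue one_pos).trans (h1.bEdge_mid one_pos).symm
  · obtain ⟨F, hF, Y, j, k, l, m, h1, h2, h3, h4, h5, h6, h7, h8⟩ :=
      h.exists_completion_of_nonempty hq hT
    exact ⟨F, hF, Y, j, k, l, m, h1, h2, h3, h4, h5, h6, h7, Or.inr h8⟩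

end Carries

/-! ### Balls in a completion -/

namespace RootedMap

variable {D : Type} {q : RootedMap D}

/-- A function that grows by at most one along the edges is at most the distance to its zero. -/
lemma Connected.le_dist (hq : q.Connected) {ρ : q.Vertex} {f : D → ℕ} (hσ : ∀ z, f (q.σ z) = f z)
    (hα : ∀ z, f (q.α z) ≤ f z + 1) (h0 : ∀ z, q.tail z = ρ → f z = 0) (z : D) :
    f z ≤ q.dist ρ (q.tail z) := by
  refine hq.dist_induction (ρ := ρ) (Q := fun v => ∀ z, q.tail z = v → f z ≤ q.dist ρ v)
    (fun z hz => (h0 z hz).le.trans (Nat.zero_le _)) (fun d hd _ ih z hz => ?_) (q.tail z)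
    (Nat.lt_succ_self _) z rfl
  rw [← hd, q.apply_eq_of_tail_eq hσ hz]
  exact (hα d).trans (Nat.succ_le_succ (ih d rfl))

end RootedMap

namespace Completion

variable {D E F : Type} {q : RootedMap D} {X : RootedMap E} {Y : RootedMap F} {a k l m : ℕ}
  {i : E → D} {j : F → D} {ρ : q.Vertex} {ρ' : X.Vertex} {R : ℕ}

lemma dist_le [Finite F] (c : Completion q X Y a k l m i j) (hq : q.Connected) (hX : X.Connected)
    (hρ : ∀ d, X.tail d = ρ' ↔ q.tail (i d) = ρ) (d : E) :
    q.dist ρ (q.tail (i d)) ≤ X.dist ρ' (X.tail d) := by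
  refine hX.dist_induction (ρ := ρ')
    (Q := fun v => ∀ d, X.tail d = v → q.dist ρ (q.tail (i d)) ≤ X.dist ρ' v)
    (fun d hd => ?_) (fun d hd _ ih d' hd' => ?_) (X.tail d) (Nat.lt_succ_self _) d rfl
  · rw [(hρ d).1 hd, q.dist_self]
    exact Nat.zero_le _
  · rw [c.gluing.tail_i hd', c.gluing.i_α, ← hd]
    exact (hq.dist_tail_α_le ρ _).trans (Nat.succ_le_succ (ih d rfl))

/-- If the path is at distance at least `R` from `ρ`, then the distances smaller than `R` are not
changed by the gluing, and the filling is at distance at least `R`. -/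
lemma le_dist (c : Completion q X Y a k l m i j) (hq : q.Connected) (hX : X.Connected)
    (hρ : ∀ d, X.tail d = ρ' ↔ q.tail (i d) = ρ)
    (hfar : ∀ t, t ≤ k → R ≤ X.dist ρ' (X.bVert (a + t))) :
    (∀ d, min R (X.dist ρ' (X.tail d)) ≤ q.dist ρ (q.tail (i d))) ∧
      ∀ e, R ≤ q.dist ρ (q.tail (j e)) := by
  obtain ⟨f, h1, h2, h3⟩ := c.gluing.exists_desc (f₁ := fun d => min R (X.dist ρ' (X.tail d)))
    (f₂ := fun _ => R) (fun d => by rw [X.tail_σ]) (fun _ => rfl) (fun t ht => by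
      rw [pow_x]
      exact min_eq_left (hfar t ht))
  have key := hq.le_dist (ρ := ρ) (f := f) h1 (fun z => by
    rcases c.gluing.cover z with ⟨d, rfl⟩ | ⟨e, rfl⟩
    · rw [← c.gluing.i_α, h2, h2]
      have := hX.dist_tail_α_le ρ' d
      omega
    · rw [← c.gluing.j_α, h3, h3]
      omega) (fun z hz => by
    have h0 : ∀ d, q.tail (i d) = ρ → f (i d) = 0 := fun d hd => by
      rw [h2, (hρ d).2 hd, X.dist_self]
      exact min_eq_right (Nat.zero_le _)
    obtain ⟨d, hd⟩ := X.tail_surjective ρ'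
    have hd' := (hρ d).1 hd
    rw [q.apply_eq_of_tail_eq h1 (hz.trans hd'.symm)]
    exact h0 d hd')
  exact ⟨fun d => h2 d ▸ key (i d), fun e => h3 e ▸ key (j e)⟩

variable [Finite E] [Finite F]

lemma face_j_notMem_ballFaces (c : Completion q X Y a k l m i j) (hq : q.Connected)
    (hX : X.Connected) (hρ : ∀ d, X.tail d = ρ' ↔ q.tail (i d) = ρ)
    (hfar : ∀ t, t ≤ k → R ≤ X.dist ρ' (X.bVert (a + t))) {s : ℕ} (hs : s ≤ R) {e : F}
    (he : Y.face e ≠ Y.extFace) : q.face (j e) ∉ q.ballFaces ρ s := by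
  rintro ⟨h1, z, hz, hz'⟩
  rcases c.inner_iff.1 (hz ▸ h1) with ⟨d, rfl, hd⟩ | ⟨e', rfl, -⟩
  · exact c.gluing.face_i_ne_face_j (face_x a) (face_x m) hd he hz
  · have := (c.le_dist hq hX hρ hfar).2 e'
    omega

lemma face_i_mem_ballFaces_iff (c : Completion q X Y a k l m i j) (hq : q.Connected)
    (hX : X.Connected) (hρ : ∀ d, X.tail d = ρ' ↔ q.tail (i d) = ρ)
    (hfar : ∀ t, t ≤ k → R ≤ X.dist ρ' (X.bVert (a + t))) {s : ℕ} (hs : s ≤ R) {d : E}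
    (hd : X.face d ≠ X.extFace) :
    q.face (i d) ∈ q.ballFaces ρ s ↔ X.face d ∈ X.ballFaces ρ' s := by
  have hle := c.le_dist hq hX hρ hfar
  constructor
  · rintro ⟨h1, z, hz, hz'⟩
    refine ⟨hd, ?_⟩
    rcases c.inner_iff.1 (hz ▸ h1) with ⟨d', rfl, hd'⟩ | ⟨e, rfl, -⟩
    · refine ⟨d', (c.gluing.face_i_iff (face_x a) (face_x m) hd' hd).1 hz, ?_⟩
      have := hle.1 d'
      omega
    · have := hle.2 e
      omega
  · rintro ⟨-, d', hd', hdist⟩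
    refine ⟨c.inner_iff.2 (Or.inl ⟨d, rfl, hd⟩), i d',
      (c.gluing.face_i_iff (face_x a) (face_x m) (hd' ▸ hd) hd).2 hd', ?_⟩
    exact (c.dist_le hq hX hρ d').trans_lt hdist

lemma exists_of_mem_ballFaces (c : Completion q X Y a k l m i j) (hq : q.Connected)
    (hX : X.Connected) (hρ : ∀ d, X.tail d = ρ' ↔ q.tail (i d) = ρ)
    (hfar : ∀ t, t ≤ k → R ≤ X.dist ρ' (X.bVert (a + t))) {s : ℕ} (hs : s ≤ R) {z : D}
    (hz : q.face z ∈ q.ballFaces ρ s) : ∃ d, i d = z ∧ X.face d ∈ X.ballFaces ρ' s := by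
  rcases c.inner_iff.1 hz.1 with ⟨d, rfl, hd⟩ | ⟨e, rfl, he⟩
  · exact ⟨d, rfl, (c.face_i_mem_ballFaces_iff hq hX hρ hfar hs hd).1 hz⟩
  · exact absurd hz (c.face_j_notMem_ballFaces hq hX hρ hfar hs he)

lemma tail_i_mem_ballVerts_iff (c : Completion q X Y a k l m i j) (hq : q.Connected)
    (hX : X.Connected) (hρ : ∀ d, X.tail d = ρ' ↔ q.tail (i d) = ρ)
    (hfar : ∀ t, t ≤ k → R ≤ X.dist ρ' (X.bVert (a + t))) {s : ℕ} (hs : s ≤ R) {d : E} :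
    q.tail (i d) ∈ q.ballVerts ρ s ↔ X.tail d ∈ X.ballVerts ρ' s := by
  constructor
  · rintro ⟨z, hz, hz'⟩
    obtain ⟨d', rfl, hd'⟩ := c.exists_of_mem_ballFaces hq hX hρ hfar hs hz'
    exact ⟨d', c.gluing.tail_i_iff.1 hz, hd'⟩
  · rintro ⟨d', hd', hd''⟩
    exact ⟨i d', c.gluing.tail_i hd',
      (c.face_i_mem_ballFaces_iff hq hX hρ hfar hs hd''.1).2 hd''⟩

end Completion

/-- The properties of a restriction map `X` that can be read on `X` itself: `a` is the index
of `v⁻`, the index of `v⁺` on the boundary of `X` is `a + k`, and `R` is the radius of the ball. -/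
structure Core {E : Type} (X : RootedMap E) (ρ : X.Vertex) (a k l R pn : ℕ) (ε : ℝ) : Prop where
  connected : X.Connected
  planar : X.Planar
  degree_inner : ∀ f, f ≠ X.extFace → X.degree f = 4
  edge_inner : ∀ d, X.face d = X.extFace → X.face (X.α d) ≠ X.extFace
  far : ∀ t, t ≤ k → R ≤ X.dist ρ (X.bVert (a + t))
  hit : ∀ t, t < k → X.face (X.α (X.bEdge (a + t))) ∈ X.ballFaces ρ R
  target : a ∈ RootedMap.targetIdx pn ε
  miss : ∀ s, s < R → ∀ t, t ≤ a → t ∈ RootedMap.targetIdx pn ε → X.bVert t ∉ X.ballVerts ρ s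
  outer_inj : ∀ s t, s < a + k + l → t < a + k + l → (s ≤ a ∨ a + k ≤ s) → (t ≤ a ∨ a + k ≤ t) →
    X.bVert s = X.bVert t → s = t

namespace Core

variable {E : Type} {X : RootedMap E} {ρ : X.Vertex} {a k l R pn : ℕ} {ε : ℝ}

lemma bVert_mem (h : Core X ρ a k l R pn ε) (hk : 0 < k) : X.bVert a ∈ X.ballVerts ρ R := by
  refine ⟨X.σ (X.bEdge a), X.tail_σ _, ?_⟩
  rw [X.face_σ]
  exact h.hit 0 hk

lemma bVert_add_mem (h : Core X ρ a k l R pn ε) (hk : 0 < k) :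
    X.bVert (a + k) ∈ X.ballVerts ρ R := by
  refine ⟨X.α (X.bEdge (a + (k - 1))), ?_, h.hit _ (by omega)⟩
  rw [X.tail_α_bEdge, show a + (k - 1) + 1 = a + k by omega]

end Core

/-- The boundary vertices of `X` that are not in the interior of the path are distinct. -/
lemma Completion.outer_inj {D E F : Type} [Finite D] [Finite E] [Finite F] {q : RootedMap D}
    {X : RootedMap E} {Y : RootedMap F} {a k l m : ℕ} {i : E → D} {j : F → D}
    (c : Completion q X Y a k l m i j) (hs : q.SimpleBoundary) (hper : q.per = a + m + l) {s t : ℕ}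
    (hs1 : s < a + k + l) (ht1 : t < a + k + l) (hs2 : s ≤ a ∨ a + k ≤ s) (ht2 : t ≤ a ∨ a + k ≤ t)
    (hst : X.bVert s = X.bVert t) : s = t := by
  -- the corresponding vertices of `q`
  have hmp := c.m_pos
  have hcode : ∀ s, s < a + k + l → (s ≤ a ∨ a + k ≤ s) →
      ∃ s', s' < a + m + l ∧ q.bVert s' = q.tail (i (X.bEdge s)) ∧
        (s ≤ a ∧ s' = s ∨ a + k ≤ s ∧ s' + k = s + m) := by
    rintro s hs1 (hs2 | hs2)
    · exact ⟨s, by omega, c.bVert_left hs2, Or.inl ⟨hs2, rfl⟩⟩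
    · obtain ⟨u, rfl⟩ := Nat.exists_eq_add_of_le hs2
      exact ⟨a + m + u, by omega, c.bVert_right (by omega), Or.inr ⟨hs2, by omega⟩⟩
  obtain ⟨s', hs3, hs4, hs5⟩ := hcode s hs1 hs2
  obtain ⟨t', ht3, ht4, ht5⟩ := hcode t ht1 ht2
  have h1 : q.bVert s' = q.bVert t' := by
    rw [hs4, ht4]
    exact c.gluing.tail_i hst
  have h2 := q.bEdge_injOn (by omega) (by omega)
    (hs _ _ (q.face_bEdge _) (q.face_bEdge _) h1)
  omega

/-- The marked vertices `v⁻` and `v⁺` of `r` are on its boundary, at the positions `a` and `a + k`,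
with `l` edges after them; no vertex is visited twice by the path between them, nor by the rest of
the boundary. -/
structure Frame (r : MarkedMap) (a k l : ℕ) : Prop where
  per : r.map.per = a + k + l
  k_pos : 0 < k
  l_pos : 0 < l
  vm : r.vm = r.map.bVert a
  vp : r.vp = r.map.bVert (a + k)
  path_inj : ∀ s t, s ≤ k → t ≤ k → r.map.bVert (a + s) = r.map.bVert (a + t) → s = t
  outer_inj : ∀ s t, s < a + k + l → t < a + k + l → (s ≤ a ∨ a + k ≤ s) → (t ≤ a ∨ a + k ≤ t) →
    r.map.bVert s = r.map.bVert t → s = t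

namespace Carries

variable {D : Type} [Finite D] {q : RootedMap D} {ρ : q.Vertex} {pn : ℕ} {ε : ℝ} {r : MarkedMap}
  {i : r.Dart → D}

lemma frame {n p : ℕ} (hq : q.IsSimpleQuad n p) (h : Carries q ρ pn ε r i) {F : Type} [Finite F]
    {Y : RootedMap F} {j : F → D} {k l m : ℕ}
    (c : Completion q r.map Y (q.idxMinus ρ pn ε) k l m i j)
    (hplus : q.idxPlus ρ pn ε = q.idxMinus ρ pn ε + m)
    (hper : q.per = q.idxMinus ρ pn ε + m + l) : Frame r (q.idxMinus ρ pn ε) k l := by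
  have := r.finite
  refine ⟨c.per_X, c.gluing.k_pos, c.l_pos, Eq.symm ((h.vm_iff _).2 ?_),
    Eq.symm ((h.vp_iff _).2 ?_), fun s t hs ht hst => ?_,
    fun s t hs ht => c.outer_inj hq.simpleBoundary hper hs ht⟩
  · exact (c.bVert_left le_rfl).symm
  · rw [RootedMap.vPlus, hplus]
    exact (c.bVert_right (t := 0) (Nat.zero_le _)).symm
  · exact c.gluing.tail_X s t hs ht (by rw [Completion.pow_x, Completion.pow_x]; exact hst)

/-- The intrinsic properties of a restriction map, read on a quadrangulation of which it is the
restriction. -/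
theorem core {n p : ℕ} (hq : q.IsSimpleQuad n p) (h : Carries q ρ pn ε r i) {F : Type} [Finite F]
    {Y : RootedMap F} {j : F → D} {k l m : ℕ}
    (c : Completion q r.map Y (q.idxMinus ρ pn ε) k l m i j)
    (hplus : q.idxPlus ρ pn ε = q.idxMinus ρ pn ε + m) (hc : r.map.Connected)
    (hp : r.map.Planar) (hper : q.per = q.idxMinus ρ pn ε + m + l)
    (hin : ∀ d, r.map.face d ≠ r.map.extFace ↔
      q.face (i d) ∈ q.innerCompl (q.outFaces ρ pn ε))
    (hpath : (q.outFaces ρ pn ε = ∅ ∧ k = 1 ∧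
        i (r.map.bEdge (q.idxMinus ρ pn ε)) = q.bEdge (q.idxMinus ρ pn ε)) ∨
      ∀ t, t < k → q.face (i (r.map.bEdge (q.idxMinus ρ pn ε + t))) ∈ q.outFaces ρ pn ε)
    (hm : q.hitRadius ρ pn ε ≤ q.dist ρ (q.vMinus ρ pn ε))
    (hp' : q.hitRadius ρ pn ε ≤ q.dist ρ (q.vPlus ρ pn ε)) :
    Core r.map r.ρ (q.idxMinus ρ pn ε) k l (q.hitRadius ρ pn ε) pn ε := by
  have := r.finite
  have hs := hq.simpleBoundary
  set a := q.idxMinus ρ pn ε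
  set R := q.hitRadius ρ pn ε
  have hk := c.gluing.k_pos
  have hdist : ∀ d, q.face d ≠ q.extFace → q.face d ∉ q.hitFaces ρ pn ε →
      R ≤ q.dist ρ (q.tail d) := by
    intro d h1 h2
    by_contra h3
    exact h2 (q.mem_hitFaces_of_dist h1 (not_le.1 h3))
  have hedge : ∀ d, r.map.face d = r.map.extFace → r.map.face (r.map.α d) ≠ r.map.extFace := by
    intro d hd
    have h1 : i d ∈ q.kept ρ pn ε := by
      rw [← h.range]
      exact ⟨d, rfl⟩
    rw [hin, h.i_α]
    exact RootedMap.face_α_mem_of_mem_edgesOf (S := q.innerCompl (q.outFaces ρ pn ε)) h1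
      fun h2 => (hin d).2 h2 hd
  have hfar : ∀ t, t ≤ k → R ≤ r.map.dist r.ρ (r.map.bVert (a + t)) := by
    intro t ht
    refine le_trans ?_ (c.dist_le hq.connected hc h.ρ_iff (r.map.bEdge (a + t)))
    rcases hpath with ⟨-, rfl, -⟩ | hpath
    · have h0 := c.bVert_left le_rfl
      have h1 := c.bVert_right (t := 0) (Nat.zero_le _)
      rw [add_zero, add_zero] at h1
      interval_cases t
      · rw [add_zero, ← h0]
        exact hm
      · rw [← h1, ← hplus]
        exact hp'
    · rcases ht.lt_or_eq with ht | rfl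
      · have h1 := RootedMap.mem_outFaces (hpath t ht)
        exact hdist _ h1.1 h1.2
      · have h1 := RootedMap.mem_outFaces (hpath (t - 1) (by omega))
        rw [← q.face_φ] at h1
        have h2 := hdist _ h1.1 h1.2
        rw [q.tail_φ, ← h.i_α] at h2
        rw [c.gluing.tail_i (d' := r.map.α (r.map.bEdge (a + (t - 1)))) ?_]
        · exact h2
        · rw [r.map.tail_α_bEdge, show a + (t - 1) + 1 = a + t by omega]
          rfl
  refine ⟨hc, hp, fun f hf => ?_, hedge, hfar, fun t ht => ?_,
    h.restrictable.idxMinus_mem.1, fun s hs' t ht htI hmem => ?_, ?_⟩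
  · obtain ⟨d, rfl⟩ := r.map.face_surjective f
    rw [← c.gluing.degree_inner (Completion.face_x _) hf]
    exact hq.degree_inner _ ((hin d).1 hf).1
  · have h1 : r.map.face (r.map.α (r.map.bEdge (a + t))) ≠ r.map.extFace :=
      hedge _ (r.map.face_bEdge _)
    refine (c.face_i_mem_ballFaces_iff hq.connected hc h.ρ_iff hfar le_rfl h1).1 ?_
    rcases hpath with ⟨hT, rfl, hbE⟩ | hpath
    · obtain rfl : t = 0 := by omega
      by_contra h2
      have h3 : q.face (q.α (q.bEdge a)) ∈ q.outFaces ρ pn ε := by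
        refine ⟨a, le_rfl, by have := c.m_pos; omega, ?_⟩
        have h4 : q.face (q.α (q.bEdge a)) = q.face (i (r.map.α (r.map.bEdge (a + 0)))) := by
          rw [h.i_α, add_zero, hbE]
        rw [h4]
        exact ⟨((hin _).1 h1).1, h2, Relation.ReflTransGen.refl⟩
      rw [hT] at h3
      exact h3
    · by_contra h2
      rw [h.i_α] at h2
      have h3 := (hin _).1 h1
      rw [h.i_α] at h3
      exact h3.2 (RootedMap.mem_outFaces_of_adj (hpath t ht) h3.1 h2)
  · have h1 : r.map.bVert t ∈ r.map.ballVerts r.ρ s := hmem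
    have h2 := (c.tail_i_mem_ballVerts_iff hq.connected hc h.ρ_iff hfar hs'.le).2 h1
    rw [← c.bVert_left ht] at h2
    exact absurd (Nat.sInf_le (show s ∈ q.hitRadii ρ pn ε from ⟨t, htI, h2⟩)) (not_le.2 hs')
  · exact fun s t h1 h2 => c.outer_inj hs hper h1 h2

end Carries

namespace Frame

variable {r : MarkedMap} {a k l : ℕ}

lemma pRight_eq (h : Frame r a k l) : r.pRight = a := by
  have hk := h.k_pos
  have hl := h.l_pos
  refine le_antisymm (Nat.sInf_le h.vm.symm) ?_
  by_contra hcon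
  have h1 : r.map.bVert r.pRight = r.vm :=
    Nat.sInf_mem (s := {i | r.map.tail ((r.map.φ ^ i) r.map.root) = r.vm}) ⟨a, h.vm.symm⟩
  have := h.outer_inj r.pRight a (by omega) (by omega) (by omega) (by omega) (h1.trans h.vm)
  omega

lemma pIn_eq (h : Frame r a k l) : r.pIn = k := by
  rw [MarkedMap.pIn, h.pRight_eq]
  refine le_antisymm (Nat.sInf_le h.vp.symm) (le_csInf ⟨k, h.vp.symm⟩ fun s hs => ?_)
  by_contra hcon
  have h1 : r.map.bVert (a + s) = r.vp := hs
  exact hcon (h.path_inj s k (by omega) le_rfl (h1.trans h.vp)).ge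

lemma pLeft_eq (h : Frame r a k l) : r.pLeft = l := by
  have := r.finite
  have hk := h.k_pos
  have hl := h.l_pos
  have hinv : ∀ s, s ≤ l → (r.map.φ⁻¹ ^ s) r.map.root = r.map.bEdge (a + k + (l - s)) := by
    intro s hs
    rw [inv_pow, Equiv.Perm.inv_eq_iff_eq, r.map.φ_pow_bEdge,
      show s + (a + k + (l - s)) = r.map.per by rw [h.per]; omega, r.map.bEdge_per]
  have hmem : l ∈ {s | r.map.tail ((r.map.φ⁻¹ ^ s) r.map.root) = r.vp} := by
    rw [Set.mem_ofPred_eq, hinv l le_rfl, h.vp, Nat.sub_self]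
    rfl
  refine le_antisymm (Nat.sInf_le hmem) (le_csInf ⟨l, hmem⟩ fun s hs => ?_)
  by_contra hcon
  rw [Set.mem_ofPred_eq, hinv s (by omega)] at hs
  rcases Nat.eq_zero_or_pos s with rfl | hpos
  · rw [Nat.sub_zero, ← h.per, r.map.bEdge_per] at hs
    have h1 : r.map.bVert 0 = r.map.bVert (a + k) := hs.trans h.vp
    have := h.outer_inj 0 (a + k) (by omega) (by omega) (by omega) (by omega) h1
    omega
  · have h1 : r.map.bVert (a + k + (l - s)) = r.map.bVert (a + k) := hs.trans h.vp
    have := h.outer_inj (a + k + (l - s)) (a + k) (by omega) (by omega) (by omega) (by omega) h1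
    omega

end Frame

/-! ### The restriction of a completion -/

namespace Completion

variable {D E F : Type} [Finite E] [Finite F] {q : RootedMap D} {X : RootedMap E}
  {Y : RootedMap F} {a k l m : ℕ} {i : E → D} {j : F → D} {R pn : ℕ} {ε : ℝ}

lemma degree_inner [Finite D] (c : Completion q X Y a k l m i j)
    (hX : ∀ f, f ≠ X.extFace → X.degree f = 4) (hY : ∀ f, f ≠ Y.extFace → Y.degree f = 4)
    (f : q.Face) (hf : f ≠ q.extFace) : q.degree f = 4 := by
  obtain ⟨z, rfl⟩ := q.face_surjective f
  rcases c.inner_iff.1 hf with ⟨d, rfl, hd⟩ | ⟨e, rfl, he⟩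
  · rw [c.gluing.degree_inner (face_x a) hd, hX _ hd]
  · rw [c.gluing.symm.degree_inner (face_x m) he, hY _ he]

lemma area [Finite D] (c : Completion q X Y a k l m i j) : q.area = X.area + Y.area :=
  c.gluing.area_eq (face_x a) (face_x m) c.face_i

lemma per [Finite D] (c : Completion q X Y a k l m i j)
    (hX : ∀ f, f ≠ X.extFace → X.degree f = 4) (hY : ∀ f, f ≠ Y.extFace → Y.degree f = 4) :
    q.per = a + m + l := by
  have h1 := q.card_eq_of_degree_inner (c.degree_inner hX hY)
  have h2 := X.card_eq_of_degree_inner hX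
  have h3 := Y.card_eq_of_degree_inner hY
  have h4 := c.gluing.card_dart
  have h5 := c.area
  have := c.per_X
  have := c.per_Y
  omega

/-- Filling a restriction map with a quadrangulation with a simple boundary gives a quadrangulation
with a simple boundary. -/
theorem isSimpleQuad [Finite D] {ρ' : X.Vertex} (c : Completion q X Y a k l m i j)
    (h : Core X ρ' a k l R pn ε) {n p : ℕ} (hY : Y.IsSimpleQuad n p) :
    q.IsSimpleQuad (X.area + n) (a + m + l) where
  connected := c.gluing.connected h.connected hY.connected
  planar := (c.gluing.planar_iff (face_x a) (face_x m) c.face_i h.connected hY.connected).2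
    ⟨h.planar, hY.planar⟩
  degree_inner := c.degree_inner h.degree_inner hY.degree_inner
  per_eq := c.per h.degree_inner hY.degree_inner
  area_eq := by rw [c.area, hY.area_eq]
  simple := by
    have hYs := hY.simpleBoundary
    have hper := c.per h.degree_inner hY.degree_inner
    have hYper := c.per_Y
    have hk := c.gluing.k_pos
    -- a boundary vertex is on `X`, or in the interior of the boundary part that comes from `Y`
    have hcode : ∀ s, s < q.per → (∃ s', s' < a + k + l ∧ q.bVert s = q.tail (i (X.bEdge s')) ∧
        (s ≤ a ∧ s' = s ∨ a + k ≤ s' ∧ s' + m = s + k)) ∨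
        ∃ t, 0 < t ∧ t < m ∧ s = a + t := by
      intro s hs
      by_cases h1 : s ≤ a
      · exact Or.inl ⟨s, by have := c.l_pos; omega, c.bVert_left h1, Or.inl ⟨h1, rfl⟩⟩
      · by_cases h2 : a + m ≤ s
        · obtain ⟨u, rfl⟩ := Nat.exists_eq_add_of_le h2
          exact Or.inl ⟨a + k + u, by omega, c.bVert_right (by omega), Or.inr (by omega)⟩
        · exact Or.inr ⟨s - a, by omega, by omega, by omega⟩
    intro d d' hd hd' hdd
    obtain ⟨s, hs, rfl⟩ := q.exists_bEdge hd
    obtain ⟨t, ht, rfl⟩ := q.exists_bEdge hd'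
    change q.bVert s = q.bVert t at hdd
    rcases hcode s hs with ⟨s', hs1, hs2, hs3⟩ | ⟨s', hs1, hs2, rfl⟩ <;>
      rcases hcode t ht with ⟨t', ht1, ht2, ht3⟩ | ⟨t', ht1, ht2, rfl⟩
    · have h1 : X.bVert s' = X.bVert t' := c.gluing.tail_i_iff.1 (by rw [← hs2, hdd, ht2])
      have := h.outer_inj s' t' hs1 ht1 (by omega) (by omega) h1
      congr 1
      omega
    · exact absurd (hdd.symm.trans hs2) (c.bVert_mid_ne hYs ht1 ht2 _)
    · exact absurd (hdd.trans ht2) (c.bVert_mid_ne hYs hs1 hs2 _)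
    · rw [c.bVert_mid hs2.le, c.bVert_mid ht2.le] at hdd
      have h1 : Y.bVert s' = Y.bVert t' := c.gluing.symm.tail_i_iff.1 hdd
      have := Y.bEdge_injOn (by omega) (by omega) (hYs _ _ (Y.face_bEdge _) (Y.face_bEdge _) h1)
      rw [this]

variable {ρ : q.Vertex} {ρ' : X.Vertex}

lemma bVert_mid_notMem (c : Completion q X Y a k l m i j) (h : Core X ρ' a k l R pn ε)
    (hρ : ∀ d, X.tail d = ρ' ↔ q.tail (i d) = ρ) (hc : Y.Connected) (hs : Y.SimpleBoundary)
    {s : ℕ} (hsR : s ≤ R) {t : ℕ} (h0 : 0 < t) (ht : t < m) :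
    q.bVert (a + t) ∉ q.ballVerts ρ s := by
  rintro ⟨z, hz, hz'⟩
  obtain ⟨d, rfl, -⟩ := c.exists_of_mem_ballFaces (c.gluing.connected h.connected hc) h.connected hρ
    h.far hsR hz'
  exact c.bVert_mid_ne hs h0 ht d hz.symm

/-- The balls and the vertices `v⁻` and `v⁺` of a completion of a restriction map are those of the
restriction map. -/
lemma hit [Finite D] (c : Completion q X Y a k l m i j) (h : Core X ρ' a k l R pn ε)
    (hρ : ∀ d, X.tail d = ρ' ↔ q.tail (i d) = ρ) {n p : ℕ} (hY : Y.IsSimpleQuad n p)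
    (hε : ε < 1 / 3) (hpn : (pn : ℝ) / 2 ≤ q.per) (hb : ⌊(pn : ℝ) / 3⌋₊ < a + m) :
    q.Restrictable ρ pn ε ∧ q.hitRadius ρ pn ε = R ∧ q.idxMinus ρ pn ε = a ∧
      q.idxPlus ρ pn ε = a + m := by
  have hq := c.gluing.connected h.connected hY.connected
  have hYs := hY.simpleBoundary
  have hper := c.per h.degree_inner hY.degree_inner
  have hl := c.l_pos
  have hmem : ∀ {s d}, s ≤ R → (q.tail (i d) ∈ q.ballVerts ρ s ↔ X.tail d ∈ X.ballVerts ρ' s) :=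
    fun hs => c.tail_i_mem_ballVerts_iff hq h.connected hρ h.far hs
  have hnot : ∀ {s t}, s ≤ R → a < t → t < a + m → q.bVert t ∉ q.ballVerts ρ s :=
    fun {s t} hs h1 h2 => by
      have := c.bVert_mid_notMem h hρ hY.connected hYs hs (t := t - a) (by omega) (by omega)
      rwa [Nat.add_sub_cancel' h1.le] at this
  have hta : a ≤ ⌊(pn : ℝ) / 3⌋₊ := h.target.2
  have ha : q.bVert a ∈ q.ballVerts ρ R := by
    rw [c.bVert_left le_rfl]
    exact (hmem le_rfl).2 (h.bVert_mem c.gluing.k_pos)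
  have hb' : q.bVert (a + m) ∈ q.ballVerts ρ R := by
    rw [← add_zero (a + m), c.bVert_right (Nat.zero_le _), add_zero]
    exact (hmem le_rfl).2 (h.bVert_add_mem c.gluing.k_pos)
  have hR : q.hitRadius ρ pn ε = R := by
    refine le_antisymm (Nat.sInf_le ⟨a, h.target, ha⟩) ?_
    by_contra hcon
    obtain ⟨t, htI, ht⟩ : q.hitRadius ρ pn ε ∈ q.hitRadii ρ pn ε :=
      Nat.sInf_mem ⟨R, a, h.target, ha⟩
    have hlt := not_le.1 hcon
    rcases le_or_gt t a with h1 | h1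
    · rw [c.bVert_left h1, hmem hlt.le] at ht
      exact h.miss _ hlt t h1 htI ht
    · exact hnot hlt.le h1 (lt_of_le_of_lt htI.2 hb) ht
  have hverts : q.hitVerts ρ pn ε = q.ballVerts ρ R := by rw [RootedMap.hitVerts, hR]
  have hother : a + m ∈ q.otherSide ρ pn ε := ⟨hb, by omega, by rw [hverts]; exact hb'⟩
  refine ⟨⟨hε, hpn, ⟨R, a, h.target, ha⟩, ⟨a + m, hother⟩⟩, hR, ?_, ?_⟩
  · refine le_antisymm (csSup_le ⟨a, h.target, by rw [hverts]; exact ha⟩ ?_)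
      (le_csSup ⟨⌊(pn : ℝ) / 3⌋₊, fun t ht => ht.1.2⟩ ⟨h.target, by rw [hverts]; exact ha⟩)
    rintro t ⟨htI, ht⟩
    rw [hverts] at ht
    by_contra hcon
    exact hnot le_rfl (not_le.1 hcon) (lt_of_le_of_lt htI.2 hb) ht
  · refine le_antisymm (Nat.sInf_le hother) ?_
    by_contra hcon
    obtain ⟨h1, -, h2⟩ : q.idxPlus ρ pn ε ∈ q.otherSide ρ pn ε := Nat.sInf_mem ⟨_, hother⟩
    rw [hverts] at h2
    exact hnot le_rfl (lt_of_le_of_lt hta h1) (not_le.1 hcon) h2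

/-- The suppressed faces of a completion are those of the filling. -/
lemma mem_outFaces_iff (c : Completion q X Y a k l m i j) (h : Core X ρ' a k l R pn ε)
    (hρ : ∀ d, X.tail d = ρ' ↔ q.tail (i d) = ρ) {n p : ℕ} (hY : Y.IsSimpleQuad n p)
    (hR : q.hitRadius ρ pn ε = R) (ha : q.idxMinus ρ pn ε = a) (hb : q.idxPlus ρ pn ε = a + m)
    {f : q.Face} : f ∈ q.outFaces ρ pn ε ↔ ∃ e, Y.face e ≠ Y.extFace ∧ q.face (j e) = f := by
  have hq := c.gluing.connected h.connected hY.connected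
  have hYs := hY.simpleBoundary
  have hfaces : q.hitFaces ρ pn ε = q.ballFaces ρ R := by rw [RootedMap.hitFaces, hR]
  have hj : ∀ e, Y.face e ≠ Y.extFace →
      q.face (j e) ≠ q.extFace ∧ q.face (j e) ∉ q.hitFaces ρ pn ε := fun e he =>
    ⟨c.inner_iff.2 (Or.inr ⟨e, rfl, he⟩), by
      rw [hfaces]
      exact c.face_j_notMem_ballFaces hq h.connected hρ h.far le_rfl he⟩
  -- an edge of the filling that is on an inner face out of the ball is on a face of the filling
  have hout : ∀ e, q.face (j e) ≠ q.extFace → q.face (j e) ∉ q.hitFaces ρ pn ε →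
      Y.face e ≠ Y.extFace := by
    intro e h1 h2
    rcases c.inner_iff.1 h1 with ⟨d, hd, hd'⟩ | ⟨e', he, he'⟩
    · exfalso
      obtain ⟨t, ht, ⟨rfl, -⟩ | ⟨rfl, -⟩⟩ := c.overlap hd
      · exact hd' (X.face_bEdge _)
      · refine h2 ?_
        rw [hfaces, ← hd]
        exact (c.face_i_mem_ballFaces_iff hq h.connected hρ h.far le_rfl hd').2 (h.hit t ht)
    · rwa [← c.gluing.j_inj he]
  constructor
  · rintro ⟨t, h1, h2, h3, h4, h5⟩
    rw [ha] at h1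
    rw [hb] at h2
    obtain ⟨u, rfl⟩ := Nat.exists_eq_add_of_le h1
    rw [c.bEdge_mid (by omega), ← c.gluing.j_α] at h3 h4 h5
    clear h2 h1
    have h6 := hout _ h3 h4
    clear h3 h4
    induction h5 with
    | refl => exact ⟨_, h6, rfl⟩
    | tail _ hstep ih =>
      obtain ⟨e, he, rfl⟩ := ih
      obtain ⟨h7, h8, z, hz, rfl⟩ := hstep
      have hz' : q.face z ≠ q.extFace := hz ▸ h7.1
      rcases c.inner_iff.1 hz' with ⟨d, rfl, hd⟩ | ⟨e', rfl, he'⟩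
      · exact absurd hz (c.gluing.face_i_ne_face_j (face_x a) (face_x m) hd he)
      · rw [← c.gluing.j_α] at h8 ⊢
        exact ⟨_, hout _ h8.1 h8.2, rfl⟩
  · rintro ⟨e, he, rfl⟩
    have h1 : Y.face (Y.α (Y.bEdge 0)) ≠ Y.extFace :=
      hYs.face_α_ne hY.connected he (Y.face_bEdge 0)
    have hm := c.m_pos
    have hstart : q.face (j (Y.α (Y.bEdge 0))) ∈ q.outFaces ρ pn ε := by
      refine ⟨a, ha.le, by omega, ?_⟩
      have h2 := c.bEdge_mid hm
      rw [add_zero] at h2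
      rw [h2, ← c.gluing.j_α]
      exact ⟨(hj _ h1).1, (hj _ h1).2, Relation.ReflTransGen.refl⟩
    have hstep : ∀ d, Y.face d ≠ Y.extFace → Y.face (Y.α d) ≠ Y.extFace →
        q.face (j d) ∈ q.outFaces ρ pn ε → q.face (j (Y.α d)) ∈ q.outFaces ρ pn ε := by
      intro d h2 h3 h4
      rw [c.gluing.j_α] at *
      have h5 := hj _ h3
      rw [c.gluing.j_α] at h5
      exact q.mem_outFaces_of_adj h4 h5.1 h5.2
    have hinv : ∀ d d', Y.face d ≠ Y.extFace → Y.face d = Y.face d' →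
        q.face (j d) = q.face (j d') := fun d d' hd hdd =>
      (c.gluing.symm.face_i_iff (face_x m) (face_x a) hd (hdd ▸ hd)).2 hdd
    have hconn := hYs.inner_connected hY.connected
      (P := fun f => ∃ d, Y.face d ≠ Y.extFace ∧ Y.face d = f ∧ q.face (j d) ∈ q.outFaces ρ pn ε)
      (fun d hd hd' => by
        constructor
        · rintro ⟨d₁, h2, h3, h4⟩
          rw [hinv _ _ h2 h3] at h4
          exact ⟨Y.α d, hd', rfl, hstep d hd hd' h4⟩
        · rintro ⟨d₁, h2, h3, h4⟩
          rw [hinv _ _ h2 h3] at h4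
          have := hstep _ hd' (by rwa [Y.α_α]) h4
          rw [Y.α_α] at this
          exact ⟨d, hd, rfl, this⟩) h1 he
    obtain ⟨d, h2, h3, h4⟩ := hconn.1 ⟨_, h1, rfl, hstart⟩
    rwa [hinv _ _ h2 h3] at h4

end Completion

/-- The restriction of a completion of a restriction map is this restriction map. -/
theorem Completion.carries {D F : Type} [Finite D] [Finite F] {q : RootedMap D} {Y : RootedMap F}
    {r : MarkedMap} {a k l m R pn : ℕ} {ε : ℝ} {i : r.Dart → D} {j : F → D} {ρ : q.Vertex}
    (c : Completion q r.map Y a k l m i j) (h : Core r.map r.ρ a k l R pn ε)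
    (hvm : r.vm = r.map.bVert a) (hvp : r.vp = r.map.bVert (a + k))
    (hρ : ∀ d, r.map.tail d = r.ρ ↔ q.tail (i d) = ρ) {n p : ℕ} (hY : Y.IsSimpleQuad n p)
    (hε : ε < 1 / 3) (hpn : (pn : ℝ) / 2 ≤ q.per) (hb : ⌊(pn : ℝ) / 3⌋₊ < a + m) :
    Carries q ρ pn ε r i := by
  have := r.finite
  obtain ⟨h1, h2, h3, h4⟩ := c.hit h hρ hY hε hpn hb
  have hout := fun {f} => c.mem_outFaces_iff h hρ hY h2 h3 h4 (f := f)
  have hin : ∀ d, r.map.face d ≠ r.map.extFace →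
      q.face (i d) ∈ q.innerCompl (q.outFaces ρ pn ε) := fun d hd =>
    ⟨c.inner_iff.2 (Or.inl ⟨d, rfl, hd⟩), fun h5 => by
      obtain ⟨e, he, he'⟩ := hout.1 h5
      exact c.gluing.face_i_ne_face_j (face_x a) (face_x m) hd he he'.symm⟩
  have hin' : ∀ z, q.face z ∈ q.innerCompl (q.outFaces ρ pn ε) → z ∈ Set.range i := by
    rintro z ⟨h5, h6⟩
    rcases c.inner_iff.1 h5 with ⟨d, rfl, -⟩ | ⟨e, rfl, he⟩
    · exact ⟨d, rfl⟩
    · exact absurd (hout.2 ⟨e, he, rfl⟩) h6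
  refine ⟨h1, c.gluing.i_inj, ?_, c.gluing.i_α, c.gluing.returns_i, ?_, hρ, fun d => ?_,
    fun d => ?_⟩
  · rw [RootedMap.kept_eq]
    ext z
    constructor
    · rintro ⟨d, rfl⟩
      by_cases hd : r.map.face d = r.map.extFace
      · refine Or.inr ?_
        rw [← c.gluing.i_α]
        exact hin _ (h.edge_inner d hd)
      · exact Or.inl (hin d hd)
    · rintro (hz | hz)
      · exact hin' z hz
      · obtain ⟨d, hd⟩ := hin' _ hz
        exact ⟨r.map.α d, by rw [c.gluing.i_α, hd, q.α_α]⟩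
  · rcases Nat.eq_zero_or_pos a with rfl | hpos
    · obtain ⟨n, g1, g2, -, g3⟩ := c.gluing.rotate (s := k) le_rfl
      have hroot : q.root = j (((Y.φ) ^ (k + 1)) ((Y.φ ^ m) (Y.φ.symm Y.root))) := by
        rw [c.root, ← c.gluing.φ_i_start]
        rfl
      refine ⟨n, ?_, fun l hl => ?_⟩
      · rw [hroot, g1 n le_rfl, g2]
        have := c.gluing.glue 0 c.gluing.k_pos
        rw [Nat.sub_zero, pow_x] at this
        exact this.symm
      · rintro ⟨d, hd⟩
        rw [hroot, g1 l hl.le] at hd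
        exact g3 l hl (Or.inr rfl) d hd
    · exact ⟨0, c.bEdge_left hpos, fun l hl => absurd hl (Nat.not_lt_zero l)⟩
  · rw [RootedMap.vMinus, h3, c.bVert_left le_rfl, c.gluing.tail_i_iff, hvm]
    rfl
  · have := c.bVert_right (t := 0) (Nat.zero_le _)
    rw [add_zero, add_zero] at this
    rw [RootedMap.vPlus, h4, this, c.gluing.tail_i_iff, hvp]
    rfl

/-! ### Existence of gluings -/

namespace Gluing

variable {E F : Type}

/-- The darts `φ x, …, φ ^ k x` of the path. -/
def OnPath (X : RootedMap E) (k : ℕ) (x d : E) : Prop := ∃ t, t < k ∧ (X.φ ^ (t + 1)) x = d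

/-- The path visits `k + 1` distinct vertices. -/
def SimplePath (X : RootedMap E) (k : ℕ) (x : E) : Prop := ∀ s t, s ≤ k → t ≤ k →
  X.tail ((X.φ ^ (s + 1)) x) = X.tail ((X.φ ^ (t + 1)) x) → s = t

section Path

variable {X : RootedMap E} {k : ℕ} {x : E}

lemma SimplePath.inj (h : SimplePath X k x) {s t : ℕ} (hs : s ≤ k) (ht : t ≤ k)
    (hst : (X.φ ^ (s + 1)) x = (X.φ ^ (t + 1)) x) : s = t := h s t hs ht (congrArg X.tail hst)

lemma SimplePath.not_onPath_α (h : SimplePath X k x) {d : E} (hd : OnPath X k x d) :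
    ¬ OnPath X k x (X.α d) := by
  obtain ⟨s, hs, rfl⟩ := hd
  rintro ⟨t, ht, hst⟩
  have h1 := h (s + 1) t (by omega) (by omega) (by rw [← tail_α_pow, hst])
  have h2 := h (t + 1) s (by omega) (by omega) (by rw [← tail_α_pow, hst, X.α_α])
  omega

lemma SimplePath.not_onPath_start (h : SimplePath X k x) : ¬ OnPath X k x x := by
  rintro ⟨t, ht, hst⟩
  have := h 0 (t + 1) (by omega) (by omega) (by rw [X.φ_pow_succ x (t + 1), hst]; rfl)
  omega

lemma SimplePath.not_onPath_end (h : SimplePath X k x) : ¬ OnPath X k x ((X.φ ^ (k + 1)) x) := by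
  rintro ⟨t, ht, hst⟩
  have := h.inj (by omega) le_rfl hst
  omega

lemma not_onPath_φ {d : E} (hd : ¬ OnPath X k x d) (hdx : d ≠ x) : ¬ OnPath X k x (X.φ d) := by
  rintro ⟨t, ht, hst⟩
  rw [X.φ_pow_succ] at hst
  have h1 := X.φ.injective hst
  rcases t with _ | t
  · exact hdx h1.symm
  · exact hd ⟨t, by omega, h1⟩

end Path

/-- The darts of a gluing: those of the two maps, without those of the external face on the
path. -/
abbrev GlueDart (X : RootedMap E) (Y : RootedMap F) (k : ℕ) (x : E) (y : F) : Type :=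
  {d : E // ¬ OnPath X k x d} ⊕ {e : F // ¬ OnPath Y k y e}

variable {X : RootedMap E} {Y : RootedMap F} {k : ℕ} {x : E} {y : F}

open Classical in
/-- The embedding of the darts of `X`: a dart of the external face on the path is sent to the
reversal of the corresponding dart of `Y`. -/
noncomputable def emb (hY : SimplePath Y k y) (d : E) : GlueDart X Y k x y :=
  if h : OnPath X k x d then
    Sum.inr ⟨Y.α ((Y.φ ^ (k - h.choose)) y), by
      refine hY.not_onPath_α ⟨k - h.choose - 1, ?_, ?_⟩
      · have := h.choose_spec.1
        omega
      · have := h.choose_spec.1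
        congr 2
        omega⟩
  else Sum.inl ⟨d, h⟩

lemma emb_of_not (hY : SimplePath Y k y) {d : E} (h : ¬ OnPath X k x d) :
    emb hY d = (Sum.inl ⟨d, h⟩ : GlueDart X Y k x y) := dif_neg h

lemma onPath_pow {t : ℕ} (ht : t < k) : OnPath Y k y ((Y.φ ^ (k - t)) y) :=
  ⟨k - t - 1, by omega, by congr 2; omega⟩

lemma emb_path (hX : SimplePath X k x) (hY : SimplePath Y k y) {t : ℕ} (ht : t < k) :
    emb hY ((X.φ ^ (t + 1)) x) = (Sum.inr ⟨Y.α ((Y.φ ^ (k - t)) y),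
      hY.not_onPath_α (onPath_pow ht)⟩ : GlueDart X Y k x y) := by
  have h : OnPath X k x ((X.φ ^ (t + 1)) x) := ⟨t, ht, rfl⟩
  rw [emb, dif_pos h]
  have : h.choose = t := hX.inj h.choose_spec.1.le ht.le h.choose_spec.2
  simp only [this]

lemma emb_injective (hX : SimplePath X k x) (hY : SimplePath Y k y) :
    Function.Injective (emb hY : E → GlueDart X Y k x y) := by
  intro d d' hdd
  by_cases hd : OnPath X k x d <;> by_cases hd' : OnPath X k x d'
  · obtain ⟨s, hs, rfl⟩ := hd
    obtain ⟨t, ht, rfl⟩ := hd'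
    rw [emb_path hX hY hs, emb_path hX hY ht, Sum.inr.injEq, Subtype.mk.injEq] at hdd
    have h1 := Y.α.injective hdd
    rw [show k - s = k - s - 1 + 1 by omega, show k - t = k - t - 1 + 1 by omega] at h1
    have := hY.inj (by omega) (by omega) h1
    rw [show s = t by omega]
  · obtain ⟨s, hs, rfl⟩ := hd
    rw [emb_path hX hY hs, emb_of_not hY hd'] at hdd
    cases hdd
  · obtain ⟨s, hs, rfl⟩ := hd'
    rw [emb_path hX hY hs, emb_of_not hY hd] at hdd
    cases hdd
  · rw [emb_of_not hY hd, emb_of_not hY hd', Sum.inl.injEq, Subtype.mk.injEq] at hdd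
    exact hdd

/-- The reversal of a dart of the gluing. -/
noncomputable def glueα (hX : SimplePath X k x) (hY : SimplePath Y k y) :
    GlueDart X Y k x y → GlueDart X Y k x y
  | Sum.inl d => emb hY (X.α d)
  | Sum.inr e => (emb hX (Y.α e) : GlueDart Y X k y x).swap

lemma glueα_swap (hX : SimplePath X k x) (hY : SimplePath Y k y) (z : GlueDart X Y k x y) :
    (glueα hX hY z).swap = glueα hY hX z.swap := by
  rcases z with d | e
  · rfl
  · exact Sum.swap_swap _

lemma glueα_emb (hX : SimplePath X k x) (hY : SimplePath Y k y) (d : E) :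
    glueα hX hY (emb hY d) = (emb hY (X.α d) : GlueDart X Y k x y) := by
  by_cases hd : OnPath X k x d
  · have hd' := hX.not_onPath_α hd
    obtain ⟨t, ht, rfl⟩ := hd
    rw [emb_path hX hY ht, emb_of_not hY hd']
    change (emb hX (Y.α (Y.α ((Y.φ ^ (k - t)) y))) : GlueDart Y X k y x).swap = _
    have h1 := emb_path hY hX (t := k - t - 1) (by omega)
    rw [Y.α_α, show k - t = k - t - 1 + 1 by omega, h1]
    simp only [Sum.swap_inr, Sum.inl.injEq, Subtype.mk.injEq]
    congr 3
    omega
  · rw [emb_of_not hY hd]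
    rfl

lemma glueα_glueα (hX : SimplePath X k x) (hY : SimplePath Y k y) (z : GlueDart X Y k x y) :
    glueα hX hY (glueα hX hY z) = z := by
  rcases z with d | e
  · change glueα hX hY (emb hY (X.α d)) = _
    rw [glueα_emb, X.α_α, emb_of_not hY d.2]
  · change glueα hX hY (emb hX (Y.α e) : GlueDart Y X k y x).swap = _
    rw [← glueα_swap, glueα_emb, Y.α_α, emb_of_not hX e.2]
    rfl

lemma glueα_ne (hX : SimplePath X k x) (hY : SimplePath Y k y) (z : GlueDart X Y k x y) :
    glueα hX hY z ≠ z := by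
  rcases z with d | e
  · intro h
    change emb hY (X.α d) = _ at h
    rw [← emb_of_not hY d.2] at h
    exact X.α_ne _ (emb_injective hX hY h)
  · intro h
    have h' := congrArg Sum.swap h
    change Sum.swap (Sum.swap (emb hX (Y.α e) : GlueDart Y X k y x)) = Sum.inl e at h'
    rw [Sum.swap_swap, ← emb_of_not hX e.2] at h'
    exact Y.α_ne _ (emb_injective hY hX h')

open Classical in
/-- The dart that follows a dart of the gluing along a face: the boundary of the external face of
one map is followed until the beginning of the path, then one moves to the other map. -/
noncomputable def glueφ (hX : SimplePath X k x) (hY : SimplePath Y k y) :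
    GlueDart X Y k x y → GlueDart X Y k x y
  | Sum.inl d => if h : (d : E) = x then Sum.inr ⟨(Y.φ ^ (k + 1)) y, hY.not_onPath_end⟩
      else Sum.inl ⟨X.φ d, not_onPath_φ d.2 h⟩
  | Sum.inr e => if h : (e : F) = y then Sum.inl ⟨(X.φ ^ (k + 1)) x, hX.not_onPath_end⟩
      else Sum.inr ⟨Y.φ e, not_onPath_φ e.2 h⟩

lemma glueφ_injective (hk : 0 < k) (hX : SimplePath X k x) (hY : SimplePath Y k y) :
    Function.Injective (glueφ hX hY) := by
  have hend : ∀ {G : Type} {Z : RootedMap G} {z : G} (d : {d : G // ¬ OnPath Z k z d}),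
      Z.φ d ≠ (Z.φ ^ (k + 1)) z := fun d h => d.2 ⟨k - 1, by omega, by
    rw [Nat.sub_add_cancel hk]
    rw [RootedMap.φ_pow_succ] at h
    exact (Equiv.injective _ h).symm⟩
  have hl : ∀ d : {d : E // ¬ OnPath X k x d}, (d : E) = x →
      glueφ hX hY (Sum.inl d) = Sum.inr ⟨(Y.φ ^ (k + 1)) y, hY.not_onPath_end⟩ :=
    fun d h => dif_pos h
  have hl' : ∀ (d : {d : E // ¬ OnPath X k x d}) (h : (d : E) ≠ x),
      glueφ hX hY (Sum.inl d) = Sum.inl ⟨X.φ d, not_onPath_φ d.2 h⟩ := fun d h => dif_neg h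
  have hr : ∀ e : {e : F // ¬ OnPath Y k y e}, (e : F) = y →
      glueφ hX hY (Sum.inr e) = Sum.inl ⟨(X.φ ^ (k + 1)) x, hX.not_onPath_end⟩ :=
    fun e h => dif_pos h
  have hr' : ∀ (e : {e : F // ¬ OnPath Y k y e}) (h : (e : F) ≠ y),
      glueφ hX hY (Sum.inr e) = Sum.inr ⟨Y.φ e, not_onPath_φ e.2 h⟩ := fun e h => dif_neg h
  rintro (d | e) (d' | e') h
  · by_cases h1 : (d : E) = x <;> by_cases h2 : (d' : E) = x
    · exact congrArg Sum.inl (Subtype.ext (h1.trans h2.symm))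
    · rw [hl d h1, hl' d' h2] at h
      cases h
    · rw [hl' d h1, hl d' h2] at h
      cases h
    · rw [hl' d h1, hl' d' h2, Sum.inl.injEq, Subtype.mk.injEq] at h
      exact congrArg Sum.inl (Subtype.ext (X.φ.injective h))
  · by_cases h1 : (d : E) = x <;> by_cases h2 : (e' : F) = y
    · rw [hl d h1, hr e' h2] at h
      cases h
    · rw [hl d h1, hr' e' h2, Sum.inr.injEq, Subtype.mk.injEq] at h
      exact absurd h.symm (hend e')
    · rw [hl' d h1, hr e' h2, Sum.inl.injEq, Subtype.mk.injEq] at h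
      exact absurd h (hend d)
    · rw [hl' d h1, hr' e' h2] at h
      cases h
  · by_cases h1 : (e : F) = y <;> by_cases h2 : (d' : E) = x
    · rw [hr e h1, hl d' h2] at h
      cases h
    · rw [hr e h1, hl' d' h2, Sum.inl.injEq, Subtype.mk.injEq] at h
      exact absurd h.symm (hend d')
    · rw [hr' e h1, hl d' h2, Sum.inr.injEq, Subtype.mk.injEq] at h
      exact absurd h (hend e)
    · rw [hr' e h1, hl' d' h2] at h
      cases h
  · by_cases h1 : (e : F) = y <;> by_cases h2 : (e' : F) = y
    · exact congrArg Sum.inr (Subtype.ext (h1.trans h2.symm))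
    · rw [hr e h1, hr' e' h2] at h
      cases h
    · rw [hr' e h1, hr e' h2] at h
      cases h
    · rw [hr' e h1, hr' e' h2, Sum.inr.injEq, Subtype.mk.injEq] at h
      exact congrArg Sum.inr (Subtype.ext (Y.φ.injective h))

lemma glueφ_swap (hX : SimplePath X k x) (hY : SimplePath Y k y) (z : GlueDart X Y k x y) :
    (glueφ hX hY z).swap = glueφ hY hX z.swap := by
  rcases z with d | e
  · by_cases h : (d : E) = x
    · simp [glueφ, h]
    · simp [glueφ, h]
  · by_cases h : (e : F) = y
    · simp [glueφ, h]
    · simp [glueφ, h]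

lemma glueφ_emb (hX : SimplePath X k x) (hY : SimplePath Y k y) {d : E}
    (hd : ∀ t, t ≤ k → d ≠ (X.φ ^ t) x) :
    glueφ hX hY (emb hY d) = (emb hY (X.φ d) : GlueDart X Y k x y) := by
  have h1 : ¬ OnPath X k x d := fun ⟨t, ht, h⟩ => hd (t + 1) ht h.symm
  have h2 : d ≠ x := hd 0 (Nat.zero_le _)
  rw [emb_of_not hY h1, emb_of_not hY (not_onPath_φ h1 h2)]
  exact dif_neg h2

lemma glueφ_emb_start (hX : SimplePath X k x) (hY : SimplePath Y k y) :
    glueφ hX hY (emb hY x) = (emb hX ((Y.φ ^ (k + 1)) y) : GlueDart Y X k y x).swap := by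
  rw [emb_of_not hY hX.not_onPath_start, emb_of_not hX hY.not_onPath_end]
  exact dif_pos rfl

/-- The gluing of two maps along simple paths. -/
noncomputable def glueMap [Finite E] [Finite F] (hk : 0 < k) (hX : SimplePath X k x)
    (hY : SimplePath Y k y) : RootedMap (GlueDart X Y k x y) :=
  have hα : Function.Involutive (glueα hX hY) := glueα_glueα hX hY
  { σ := Equiv.ofBijective (glueφ hX hY)
      (Finite.injective_iff_bijective.1 (glueφ_injective hk hX hY)) * hα.toPerm
    α := hα.toPerm
    root := emb hY x
    α_α := hα
    α_ne := glueα_ne hX hY }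

lemma glueMap_φ [Finite E] [Finite F] (hk : 0 < k) (hX : SimplePath X k x)
    (hY : SimplePath Y k y) (z : GlueDart X Y k x y) :
    (glueMap hk hX hY).φ z = glueφ hX hY z :=
  congrArg (glueφ hX hY) (glueα_glueα hX hY z)

/-- Two maps can be glued along simple paths of the same length of their external faces. -/
theorem gluing_glueMap [Finite E] [Finite F] (hk : 0 < k) (hX : SimplePath X k x)
    (hY : SimplePath Y k y) :
    Gluing (glueMap hk hX hY) X Y k x y (emb hY) (fun e => (emb hX e).swap) where
  k_pos := hk
  i_inj := emb_injective hX hY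
  j_inj := Sum.swap_leftInverse.injective.comp (emb_injective hY hX)
  i_α d := (glueα_emb hX hY d).symm
  j_α e := by
    change (emb hX (Y.α e)).swap = glueα hX hY (emb hX e).swap
    rw [← glueα_swap, glueα_emb]
  cover z := by
    rcases z with d | e
    · exact Or.inl ⟨d, emb_of_not hY d.2⟩
    · exact Or.inr ⟨e, by rw [emb_of_not hX e.2]; rfl⟩
  overlap d e hde := by
    by_cases hd : OnPath X k x d
    · obtain ⟨t, ht, rfl⟩ := hd
      refine ⟨t, ht, Or.inl ⟨rfl, ?_⟩⟩
      have h2 := hY.not_onPath_α (onPath_pow ht)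
      have h1 := congrArg Sum.swap hde
      rw [emb_path hX hY ht, Sum.swap_swap, Sum.swap_inr, ← emb_of_not hX h2] at h1
      exact (emb_injective hY hX h1).symm
    · by_cases he : OnPath Y k y e
      · obtain ⟨t, ht, rfl⟩ := he
        refine ⟨k - t - 1, by omega, Or.inr ⟨?_, by congr 2; omega⟩⟩
        have h2 := hX.not_onPath_α (onPath_pow ht)
        rw [emb_path hY hX ht, Sum.swap_inr, ← emb_of_not hY h2] at hde
        rw [show k - t - 1 + 1 = k - t by omega]
        exact emb_injective hX hY hde
      · rw [emb_of_not hY hd, emb_of_not hX he] at hde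
        cases hde
  glue t ht := by
    rw [emb_path hX hY ht, emb_of_not hX (hY.not_onPath_α (onPath_pow ht))]
    rfl
  φ_i d hd := by rw [glueMap_φ, glueφ_emb hX hY hd]
  φ_j e he := by rw [glueMap_φ, ← glueφ_swap, glueφ_emb hY hX he]
  φ_i_start := by rw [glueMap_φ, glueφ_emb_start]
  φ_j_start := by rw [glueMap_φ, ← glueφ_swap, glueφ_emb_start, Sum.swap_swap]
  tail_X := hX
  tail_Y := hY

lemma reroot {D : Type} {q : RootedMap D} {i : E → D} {j : F → D} (g : Gluing q X Y k x y i j)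
    (z : D) : Gluing { q with root := z } X Y k x y i j :=
  ⟨g.k_pos, g.i_inj, g.j_inj, g.i_α, g.j_α, g.cover, g.overlap, g.glue, g.φ_i, g.φ_j, g.φ_i_start,
    g.φ_j_start, g.tail_X, g.tail_Y⟩

end Gluing

/-- A map with a path of `k` edges on its boundary can be completed with any quadrangulation with a
simple boundary of perimeter larger than `k`. -/
theorem exists_completion {E F : Type} [Finite E] [Finite F] {X : RootedMap E}
    {a k l m : ℕ} (hper : X.per = a + k + l)
    (hk : 0 < k) (hl : 0 < l) (hm : 0 < m) (hpath : ∀ s t, s ≤ k → t ≤ k →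
      X.bVert (a + s) = X.bVert (a + t) → s = t) {Y : RootedMap F} {n : ℕ}
    (hY : Y.IsSimpleQuad n (m + k)) :
    ∃ (D : Type) (_ : Finite D) (q : RootedMap D) (i : E → D) (j : F → D),
      Completion q X Y a k l m i j := by
  have h1 : Gluing.SimplePath X k ((X.φ ^ a) (X.φ.symm X.root)) := fun s t hs ht hst => by
    rw [Completion.pow_x, Completion.pow_x] at hst
    exact hpath s t hs ht hst
  have h2 : Gluing.SimplePath Y k ((Y.φ ^ m) (Y.φ.symm Y.root)) := fun s t hs ht hst => by
    rw [Completion.pow_x, Completion.pow_x] at hst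
    have h3 := hY.simple _ _ (Y.face_bEdge _) (Y.face_bEdge _) hst
    have hYp := hY.per_eq
    -- the last vertex of the path may be the origin of the root
    have hmod : ∀ u, u ≤ k → ∃ u', u' < m + k ∧ Y.bEdge (m + u) = Y.bEdge u' ∧
        (u < k ∧ u' = m + u ∨ u = k ∧ u' = 0) := fun u hu => by
      rcases hu.lt_or_eq with hu | rfl
      · exact ⟨m + u, by omega, rfl, Or.inl ⟨hu, rfl⟩⟩
      · exact ⟨0, by omega, by rw [← hYp, ← zero_add Y.per, Y.bEdge_add_per], Or.inr ⟨rfl, rfl⟩⟩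
    obtain ⟨s', hs1, hs2, hs3⟩ := hmod s hs
    obtain ⟨t', ht1, ht2, ht3⟩ := hmod t ht
    rw [hs2, ht2] at h3
    have := Y.bEdge_injOn (by omega) (by omega) h3
    omega
  have g := Gluing.gluing_glueMap hk h1 h2
  exact ⟨_, inferInstance, _, _, _, ⟨g.reroot ((Gluing.glueMap hk h1 h2).φ
    (Gluing.emb h2 (X.φ.symm X.root))), rfl, hper, hY.per_eq, hl, hm⟩⟩

/-! ### Uniqueness of gluings -/

namespace Gluing

variable {D D' E F : Type} {q : RootedMap D} {q' : RootedMap D'} {X : RootedMap E}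
  {Y : RootedMap F} {k : ℕ} {x : E} {y : F} {i : E → D} {j : F → D} {i' : E → D'} {j' : F → D'}

/-- The identifications made by a gluing only depend on the two maps and on the paths. -/
lemma eq_of_eq (g : Gluing q X Y k x y i j) (g' : Gluing q' X Y k x y i' j') {d : E} {e : F}
    (h : i d = j e) : i' d = j' e := by
  obtain ⟨t, ht, ⟨rfl, rfl⟩ | ⟨rfl, rfl⟩⟩ := g.overlap d e h
  · exact g'.glue t ht
  · rw [g'.i_α, g'.glue t ht, g'.j_α, q'.α_α]

lemma exists_map (g : Gluing q X Y k x y i j) (g' : Gluing q' X Y k x y i' j') :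
    ∃ f : D → D', (∀ d, f (i d) = i' d) ∧ ∀ e, f (j e) = j' e := by
  classical
  have hj : ∀ z, (¬ ∃ d, i d = z) → ∃ e, j e = z := fun z hz => (g.cover z).resolve_left hz
  let f : D → D' := fun z => if h : ∃ d, i d = z then i' h.choose else j' (hj z h).choose
  have hi : ∀ d, f (i d) = i' d := fun d => by
    have h : ∃ d', i d' = i d := ⟨d, rfl⟩
    rw [show f (i d) = i' h.choose from dif_pos h, g.i_inj h.choose_spec]
  refine ⟨f, hi, fun e => ?_⟩
  by_cases h : ∃ d, i d = j e
  · obtain ⟨d, hd⟩ := h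
    rw [← hd, hi, g.eq_of_eq g' hd]
  · rw [show f (j e) = j' (hj _ h).choose from dif_neg h, g.j_inj (hj _ h).choose_spec]

/-- Two gluings of the same maps along the same paths are isomorphic. -/
theorem exists_iso (g : Gluing q X Y k x y i j) (g' : Gluing q' X Y k x y i' j') :
    ∃ f : D ≃ D', (∀ d, f (i d) = i' d) ∧ (∀ e, f (j e) = j' e) ∧
      (∀ z, f (q.α z) = q'.α (f z)) ∧ ∀ z, f (q.σ z) = q'.σ (f z) := by
  obtain ⟨f, h1, h2⟩ := g.exists_map g'
  obtain ⟨f', h1', h2'⟩ := g'.exists_map g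
  let e : D ≃ D' :=
    { toFun := f
      invFun := f'
      left_inv := fun z => by
        rcases g.cover z with ⟨d, rfl⟩ | ⟨e, rfl⟩
        · rw [h1, h1']
        · rw [h2, h2']
      right_inv := fun z => by
        rcases g'.cover z with ⟨d, rfl⟩ | ⟨e, rfl⟩
        · rw [h1', h1]
        · rw [h2', h2] }
  have hα : ∀ z, f (q.α z) = q'.α (f z) := fun z => by
    rcases g.cover z with ⟨d, rfl⟩ | ⟨e, rfl⟩
    · rw [← g.i_α, h1, h1, g'.i_α]
    · rw [← g.j_α, h2, h2, g'.j_α]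
  -- away from the path, and at its beginning
  have hφi : ∀ d, (∀ t, t < k → d ≠ (X.φ ^ (t + 1)) x) → f (q.φ (i d)) = q'.φ (f (i d)) := by
    intro d hd
    by_cases hdx : d = x
    · rw [hdx, g.φ_i_start, h2, h1, g'.φ_i_start]
    · have hd' : ∀ t, t ≤ k → d ≠ (X.φ ^ t) x := fun t ht => by
        rcases t with _ | t
        · exact hdx
        · exact hd t ht
      rw [g.φ_i d hd', h1, h1, g'.φ_i d hd']
  have hφj : ∀ e, (∀ t, t < k → e ≠ (Y.φ ^ (t + 1)) y) → f (q.φ (j e)) = q'.φ (f (j e)) := by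
    intro e he
    by_cases hey : e = y
    · rw [hey, g.φ_j_start, h1, h2, g'.φ_j_start]
    · have he' : ∀ t, t ≤ k → e ≠ (Y.φ ^ t) y := fun t ht => by
        rcases t with _ | t
        · exact hey
        · exact he t ht
      rw [g.φ_j e he', h2, h2, g'.φ_j e he']
  have hφ : ∀ z, f (q.φ z) = q'.φ (f z) := fun z => by
    rcases g.cover z with ⟨d, rfl⟩ | ⟨e, rfl⟩
    · by_cases hd : ∀ t, t < k → d ≠ (X.φ ^ (t + 1)) x
      · exact hφi d hd
      · push Not at hd
        obtain ⟨t, ht, rfl⟩ := hd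
        rw [g.glue t ht]
        refine hφj _ fun s hs => ?_
        have := g.symm.α_ne (s := k - t - 1) (t := s) (by omega) hs
        rwa [show k - t - 1 + 1 = k - t by omega] at this
    · by_cases he : ∀ t, t < k → e ≠ (Y.φ ^ (t + 1)) y
      · exact hφj e he
      · push Not at he
        obtain ⟨t, ht, rfl⟩ := he
        have h3 := g.symm.glue t ht
        rw [h3]
        refine hφi _ fun s hs => ?_
        have := g.α_ne (s := k - t - 1) (t := s) (by omega) hs
        rwa [show k - t - 1 + 1 = k - t by omega] at this
  refine ⟨e, h1, h2, hα, fun z => ?_⟩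
  change f (q.σ z) = q'.σ (f z)
  rw [← q.φ_α, hφ, hα, q'.φ_α]

end Gluing

namespace RootedMap

variable {D : Type} {q : RootedMap D}

/-- A connected rooted map has no symmetries. -/
lemma IsIso.apply_eq_self (hc : q.Connected) {e : D ≃ D} (h : q.IsIso q e) (z : D) : e z = z := by
  have := hc.apply_eq (f := fun z => e z = z) (fun d => by rw [h.σ, q.σ.injective.eq_iff])
    (fun d => by rw [h.α, q.α.injective.eq_iff]) q.root z
  exact this.mp h.root

end RootedMap

namespace Completion

variable {D D' E F F' : Type} {q : RootedMap D} {q' : RootedMap D'} {X : RootedMap E}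
  {Y : RootedMap F} {Y' : RootedMap F'} {a k l m : ℕ} {i : E → D} {j : F → D}

/-- The completion is determined by the filling. -/
lemma exists_isIso {i' : E → D'} {j' : F → D'} (c : Completion q X Y a k l m i j)
    (c' : Completion q' X Y a k l m i' j') :
    ∃ f : D ≃ D', q.IsIso q' f ∧ ∀ d, f (i d) = i' d := by
  obtain ⟨f, h1, -, h2, h3⟩ := c.gluing.exists_iso c'.gluing
  refine ⟨f, ⟨h3, h2, ?_⟩, h1⟩
  rw [c.root, c'.root, RootedMap.φ_apply, h3, h2, h1, RootedMap.φ_apply]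

lemma mem_range_j_iff (c : Completion q X Y a k l m i j) {z : D} :
    z ∈ Set.range j ↔ z ∉ Set.range i ∨
      ∃ t, t < k ∧ (z = i (X.bEdge (a + t)) ∨ z = i (X.α (X.bEdge (a + t)))) := by
  constructor
  · rintro ⟨e, rfl⟩
    by_cases h : j e ∈ Set.range i
    · obtain ⟨d, hd⟩ := h
      obtain ⟨t, ht, ⟨rfl, -⟩ | ⟨rfl, -⟩⟩ := c.overlap hd
      · exact Or.inr ⟨t, ht, Or.inl hd.symm⟩
      · exact Or.inr ⟨t, ht, Or.inr hd.symm⟩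
    · exact Or.inl h
  · rintro (h | ⟨t, ht, rfl | rfl⟩)
    · exact (c.gluing.cover z).resolve_left h
    · exact ⟨_, (c.glue ht).symm⟩
    · exact ⟨Y.α _, by rw [c.gluing.j_α, ← c.glue ht, c.gluing.i_α]⟩

/-- The filling is determined by the completion. -/
lemma exists_isIso_filling [Finite D] [Finite E] [Finite F] [Finite F'] {j' : F' → D}
    (c : Completion q X Y a k l m i j) (c' : Completion q X Y' a k l m i j') : Y.Iso Y' := by
  have hr : Set.range j = Set.range j' := Set.ext fun z => by
    rw [c.mem_range_j_iff, c'.mem_range_j_iff]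
  have hex : ∀ e, ∃ e', j' e' = j e := fun e => by
    have : j e ∈ Set.range j' := by
      rw [← hr]
      exact ⟨e, rfl⟩
    exact this
  choose f hf using hex
  have hbij : Function.Bijective f := by
    refine ⟨fun e e' h => c.gluing.j_inj ?_, fun e' => ?_⟩
    · rw [← hf, ← hf, h]
    · have : j' e' ∈ Set.range j := by
        rw [hr]
        exact ⟨e', rfl⟩
      obtain ⟨e, he⟩ := this
      exact ⟨e, c'.gluing.j_inj (by rw [hf, he])⟩
  refine ⟨Equiv.ofBijective f hbij, fun e => c'.gluing.j_inj ?_, fun e => c'.gluing.j_inj ?_,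
    c'.gluing.j_inj ?_⟩
  · have h1 := firstReturn_eq_of_returns (K := Set.range j) (x := ⟨j e, ⟨e, rfl⟩⟩)
      (c.gluing.symm.returns_i e) (Set.mem_range_self _)
    have h3 : Returns q.σ (Set.range j) (j e) (j' (Y'.σ (f e))) := by
      rw [hr, ← hf e]
      exact c'.gluing.symm.returns_i (f e)
    have h2 := firstReturn_eq_of_returns (K := Set.range j) (x := ⟨j e, ⟨e, rfl⟩⟩) h3
      (by rw [hr]; exact Set.mem_range_self _)
    exact (hf _).trans (h1.symm.trans h2)
  · change j' (f (Y.α e)) = j' (Y'.α (f e))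
    rw [hf, c.gluing.j_α, c'.gluing.j_α, hf]
  · change j' (f Y.root) = j' Y'.root
    have hroot : ∀ {G : Type} [Finite G] {Z : RootedMap G}, Z.per = m + k →
        (Z.φ ^ (k + 1)) ((Z.φ ^ m) (Z.φ.symm Z.root)) = Z.root := fun {G _ Z} hZ => by
      rw [pow_x, ← hZ, Z.bEdge_per]
    rw [hf, ← hroot c.per_Y, ← c.gluing.φ_i_start, c'.gluing.φ_i_start, hroot c'.per_Y]

end Completion

/-- The embedding of the restriction is unique. -/
lemma Carries.unique {D : Type} [Finite D] {q : RootedMap D} {ρ : q.Vertex} {pn : ℕ} {ε : ℝ}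
    {r : MarkedMap} {i i' : r.Dart → D} (hc : r.map.Connected) (h : Carries q ρ pn ε r i)
    (h' : Carries q ρ pn ε r i') : i = i' := by
  have hr : Set.range i = Set.range i' := h.range.trans h'.range.symm
  have hroot : i r.map.root = i' r.map.root := by
    obtain ⟨n, hn, hn'⟩ := h.root
    obtain ⟨n', hm, hm'⟩ := h'.root
    rw [← hr] at hm'
    have h1 : n = n' := by
      rcases lt_trichotomy n n' with h2 | h2 | h2
      · exact absurd (hn ▸ Set.mem_range_self _) (hm' n h2)
      · exact h2
      · exact absurd (hm ▸ hr ▸ Set.mem_range_self _) (hn' n' h2)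
    rw [← hn, ← hm, h1]
  funext d
  have := hc.apply_eq (f := fun d => i d = i' d) (fun d => ?_) (fun d => ?_) r.map.root d
  · exact this.mp hroot
  · have h1 := firstReturn_eq_of_returns (K := Set.range i) (x := ⟨i d, ⟨d, rfl⟩⟩)
      (h.returns d) (Set.mem_range_self _)
    have h3 : Returns q.σ (Set.range i) (i' d) (i' (r.map.σ d)) := by
      rw [hr]
      exact h'.returns d
    have h2 := firstReturn_eq_of_returns (K := Set.range i)
      (x := ⟨i' d, by rw [hr]; exact ⟨d, rfl⟩⟩)
      h3 (by rw [hr]; exact ⟨_, rfl⟩)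
    rw [eq_iff_iff, ← h1, ← h2]
    constructor
    · intro h3
      exact congrArg Subtype.val ((firstReturn q.σ (Set.range i)).injective (Subtype.ext h3))
    · intro h3
      simp only [h3]
  · rw [h.i_α, h'.i_α, q.α.injective.eq_iff]

/-! ### Counting quadrangulations with a simple boundary -/

namespace RootedMap

variable {D : Type} [Finite D] {m : RootedMap D} {n p : ℕ}

/-- Euler's relation for the number of vertices. -/
lemma IsSimpleQuad.card_vertex (h : m.IsSimpleQuad n p) :
    2 * Nat.card m.Vertex = 2 * n + p + 2 := by
  have h1 := m.card_eq_of_degree_inner h.degree_inner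
  have h2 := m.card_face
  have h3 : 2 * (Nat.card m.Vertex + Nat.card m.Face) = Nat.card D + 4 := h.planar
  have h4 := h.per_eq
  have h5 := h.area_eq
  omega

lemma IsSimpleQuad.even (h : m.IsSimpleQuad n p) : Even p := by
  have h1 := h.card_vertex
  rw [Nat.even_iff]
  omega

/-- The only quadrangulation with a simple boundary without inner faces has a single edge. -/
lemma IsSimpleQuad.iso_edgeMap (h : m.IsSimpleQuad 0 p) : edgeMap.Iso m := by
  have : Finite m.Face := Quotient.finite _
  have hext : ∀ d, m.face d = m.extFace := fun d => by
    by_contra hd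
    have h1 : 0 < Nat.card {f : m.Face // f ≠ m.extFace} :=
      Nat.card_pos_iff.2 ⟨⟨⟨_, hd⟩⟩, inferInstance⟩
    have h2 : Nat.card {f : m.Face // f ≠ m.extFace} = 0 := h.area_eq
    omega
  have hσ : ∀ d, m.σ d = d := fun d => h.simple _ _ (hext _) (hext _) (m.tail_σ d)
  have hsurj : ∀ d, d = m.root ∨ d = m.α m.root := fun d => by
    have := h.connected.apply_eq (f := fun d => d = m.root ∨ d = m.α m.root)
      (fun d => by rw [hσ]) (fun d => by
        rw [eq_iff_iff, m.α.injective.eq_iff, or_comm]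
        refine or_congr Iff.rfl ⟨fun h1 => ?_, fun h1 => ?_⟩
        · rw [← h1, m.α_α]
        · rw [h1, m.α_α]) m.root d
    exact this.mp (Or.inl rfl)
  let f : Bool → D := fun s => if s then m.root else m.α m.root
  have hf : Function.Bijective f := by
    refine ⟨fun s s' hss => ?_, fun d => (hsurj d).elim (fun h => ⟨true, h.symm⟩)
      fun h => ⟨false, h.symm⟩⟩
    cases s <;> cases s' <;>
      first | rfl | exact absurd hss (m.α_ne _) | exact absurd hss.symm (m.α_ne _)
  refine ⟨Equiv.ofBijective f hf, fun s => (hσ _).symm, fun s => ?_, rfl⟩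
  cases s
  · exact (m.α_α _).symm
  · rfl

end RootedMap

namespace SimpleQuad

variable {n p : ℕ}

lemma isSimpleQuad (q : SimpleQuad n p) : q.rep.IsSimpleQuad n p :=
  (Quotient.out (s := LabeledQuad.setoid n p) q).2

lemma eq_of_iso {q q' : SimpleQuad n p} (h : q.rep.Iso q'.rep) : q = q' := by
  have := Quotient.sound (s := LabeledQuad.setoid n p) h
  exact (Quotient.out_eq _).symm.trans (this.trans (Quotient.out_eq _))

/-- Every quadrangulation with a simple boundary has an isomorphism class. -/
lemma exists_isIso {D : Type} [Finite D] {m : RootedMap D} (h : m.IsSimpleQuad n p) :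
    ∃ (q : SimpleQuad n p) (e : D ≃ Fin (4 * n + p)), m.IsIso q.rep e := by
  obtain ⟨q, e, he⟩ := h.exists_labeled
  let Q : SimpleQuad n p := Quotient.mk (LabeledQuad.setoid n p) q
  obtain ⟨e', he'⟩ := RootedMap.iso_iff.1
    (Quotient.exact (s := LabeledQuad.setoid n p) (Quotient.out_eq Q).symm)
  exact ⟨Q, e.trans e', fun d => (congrArg e' (he.σ d)).trans (he'.σ _),
    fun d => (congrArg e' (he.α d)).trans (he'.α _), (congrArg e' he.root).trans he'.root⟩

end SimpleQuad

lemma qt_natCast (n p : ℕ) : qt n p = Nat.card (SimpleQuad n p) := by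
  have hodd : ¬ (1 ≤ p ∧ Even p) → Nat.card (SimpleQuad n p) = 0 := fun h => by
    have : IsEmpty (SimpleQuad n p) := ⟨fun q => h ⟨by
      have h1 := q.rep.per_pos
      rwa [q.isSimpleQuad.per_eq] at h1, q.isSimpleQuad.even⟩⟩
    exact Nat.card_of_isEmpty
  unfold qt
  by_cases hp : 1 ≤ p ∧ Even p
  · by_cases hn : 1 ≤ n
    · rw [if_pos ⟨by exact_mod_cast hn, by exact_mod_cast hp.1, by exact_mod_cast hp.2⟩,
        Int.toNat_natCast, Int.toNat_natCast]
    · obtain rfl : n = 0 := by omega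
      rw [if_neg fun h => by simp at h]
      by_cases h2 : p = 2
      · subst h2
        rw [if_pos ⟨rfl, rfl⟩]
        obtain ⟨q, -, -⟩ := SimpleQuad.exists_isIso edgeMap_isSimpleQuad
        have h3 : ∀ q' : SimpleQuad 0 2, q' = q := fun q' => by
          obtain ⟨e, he⟩ := RootedMap.iso_iff.1 q.isSimpleQuad.iso_edgeMap
          obtain ⟨e', he'⟩ := RootedMap.iso_iff.1 q'.isSimpleQuad.iso_edgeMap
          refine SimpleQuad.eq_of_iso ⟨e'.symm.trans e, fun d => ?_, fun d => ?_, ?_⟩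
          · rw [Equiv.trans_apply, he'.symm.σ, he.σ]
            rfl
          · rw [Equiv.trans_apply, he'.symm.α, he.α]
            rfl
          · rw [Equiv.trans_apply, he'.symm.root, he.root]
        have : Unique (SimpleQuad 0 2) := ⟨⟨q⟩, h3⟩
        exact Nat.card_unique.symm
      · rw [if_neg fun h => h2 (by exact_mod_cast h.2)]
        have : IsEmpty (SimpleQuad 0 p) := ⟨fun q => h2 (by
          obtain ⟨e, he⟩ := RootedMap.iso_iff.1 q.isSimpleQuad.iso_edgeMap
          have := he.per
          rw [q.isSimpleQuad.per_eq, edgeMap_isSimpleQuad.per_eq] at this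
          exact this)⟩
        exact Nat.card_of_isEmpty.symm
  · rw [hodd hp, if_neg fun h => hp ⟨by exact_mod_cast h.2.1, by exact_mod_cast h.2.2⟩,
      if_neg fun h => hp ?_]
    have h2 : p = 2 := by exact_mod_cast h.2
    subst h2
    exact ⟨one_le_two, even_two⟩

/-! ### The law of the restriction -/

/-- The law of the restriction counts pointed quadrangulations: all of them have the same
probability, because all quadrangulations of given area and perimeter have the same number of
vertices. -/
lemma restrictionLaw_toReal (n p : ℕ) [Nonempty (SimpleQuad n p)] (pn : ℕ) (ε : ℝ)
    (b : Option MarkedClass) :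
    (restrictionLaw n p pn ε b).toReal =
      (Nat.card {x : Σ q : SimpleQuad n p, q.rep.Vertex //
        x.1.rep.restrictionClass x.2 pn ε = b} : ℝ) /
        (((n : ℝ) + (p : ℝ) / 2 + 1) * (Nat.card (SimpleQuad n p) : ℝ)) := by
  classical
  obtain ⟨V, hV⟩ : ∃ V, 2 * V = 2 * n + p + 2 := by
    obtain ⟨q⟩ := ‹Nonempty (SimpleQuad n p)›
    exact ⟨_, q.isSimpleQuad.card_vertex⟩
  have hVq : ∀ q : SimpleQuad n p, Fintype.card q.rep.Vertex = V := fun q => by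
    have := q.isSimpleQuad.card_vertex
    rw [Nat.card_eq_fintype_card] at this
    omega
  have hVr : (n : ℝ) + (p : ℝ) / 2 + 1 = V := by
    have : (2 : ℝ) * V = 2 * n + p + 2 := by exact_mod_cast hV
    linarith
  have hlaw : restrictionLaw n p pn ε b = ∑ q : SimpleQuad n p, ∑ ρ : q.rep.Vertex,
      if q.rep.restrictionClass ρ pn ε = b then
        ((Nat.card (SimpleQuad n p) : ℝ≥0∞)⁻¹ * (V : ℝ≥0∞)⁻¹) else 0 := by
    rw [restrictionLaw, pointedLaw, PMF.map_bind, PMF.bind_apply, tsum_fintype]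
    refine Finset.sum_congr rfl fun q _ => ?_
    have hcomp : PMF.map (fun q : PointedQuad n p => q.1.rep.restrictionClass q.2 pn ε)
        (PMF.map (fun ρ => (⟨q, ρ⟩ : PointedQuad n p)) (PMF.uniformOfFintype q.rep.Vertex)) =
        PMF.map (fun ρ => q.rep.restrictionClass ρ pn ε) (PMF.uniformOfFintype q.rep.Vertex) :=
      PMF.map_comp _ _ _
    rw [hcomp, PMF.map_apply, tsum_fintype, PMF.uniformOfFintype_apply, Finset.mul_sum,
      Nat.card_eq_fintype_card]
    refine Finset.sum_congr rfl fun ρ _ => ?_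
    rw [PMF.uniformOfFintype_apply, hVq]
    simp only [mul_ite, mul_zero, eq_comm (a := b)]
  have hcard : Nat.card {x : Σ q : SimpleQuad n p, q.rep.Vertex //
      x.1.rep.restrictionClass x.2 pn ε = b} = ∑ q : SimpleQuad n p, ∑ ρ : q.rep.Vertex,
      if q.rep.restrictionClass ρ pn ε = b then 1 else 0 := by
    rw [Nat.card_eq_fintype_card, Fintype.card_subtype, Finset.card_filter, Fintype.sum_sigma]
  have : restrictionLaw n p pn ε b = (Nat.card {x : Σ q : SimpleQuad n p, q.rep.Vertex //
      x.1.rep.restrictionClass x.2 pn ε = b} : ℝ≥0∞) *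
      ((Nat.card (SimpleQuad n p) : ℝ≥0∞)⁻¹ * (V : ℝ≥0∞)⁻¹) := by
    rw [hlaw, hcard]
    push_cast
    rw [Finset.sum_mul]
    refine Finset.sum_congr rfl fun q _ => ?_
    rw [Finset.sum_mul]
    refine Finset.sum_congr rfl fun ρ _ => ?_
    split_ifs <;> simp
  rw [this, hVr, ENNReal.toReal_mul, ENNReal.toReal_mul, ENNReal.toReal_inv, ENNReal.toReal_inv,
    ENNReal.toReal_natCast, ENNReal.toReal_natCast, ENNReal.toReal_natCast, div_eq_mul_inv,
    mul_inv_rev]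

/-! ### Quadrangulations with a given restriction -/

/-- The intrinsic description of a restriction map. -/
lemma IsRestrictionMap.exists_core {pn : ℕ} {ε : ℝ} {r : MarkedMap}
    (hr : IsRestrictionMap pn ε r) :
    ε < 1 / 3 ∧ ∃ a k l R, Core r.map r.ρ a k l R pn ε ∧ Frame r a k l := by
  obtain ⟨n, p, q, ρ, hq, hm, hp⟩ := hr
  obtain ⟨i, hi⟩ := RootedMap.restrictionClass_eq_some_iff.1 hq
  obtain ⟨F, hF, Y, j, k, l, m, c, hY, hplus, hper, hc, hpl, hin, hpath⟩ := hi.exists_completion q.2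
  exact ⟨hi.restrictable.1, _, k, l, _,
    hi.core q.2 c hplus hc hpl hper hin hpath (by omega) (by omega), hi.frame q.2 c hplus hper⟩

variable {pn : ℕ} {ε : ℝ} {r : MarkedMap} {a k l R : ℕ}

/-- A quadrangulation is obtained by filling its restriction. -/
lemma Carries.exists_filling {n p : ℕ} {q : SimpleQuad n p} {ρ : q.rep.Vertex} {i : r.Dart → _}
    (h : Carries q.rep ρ pn ε r i) (hf : Frame r a k l) :
    ∃ (m N : ℕ), p = a + m + l ∧ n = r.area + N ∧ ⌊(pn : ℝ) / 3⌋₊ < a + m ∧ 0 < m ∧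
      ∃ (c : SimpleQuad N (m + k)) (j : Fin (4 * N + (m + k)) → _),
        Completion q.rep r.map c.rep a k l m i j := by
  have := r.finite
  obtain ⟨F, hF, Y, j, k', l', m, c, hY, hplus, hper, -⟩ := h.exists_completion q.isSimpleQuad
  have hf' := h.frame q.isSimpleQuad c hplus hper
  have h1 : q.rep.idxMinus ρ pn ε = a := hf'.pRight_eq.symm.trans hf.pRight_eq
  obtain rfl : k' = k := hf'.pIn_eq.symm.trans hf.pIn_eq
  obtain rfl : l' = l := hf'.pLeft_eq.symm.trans hf.pLeft_eq
  have h2 := h.restrictable.idxPlus_mem.1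
  rw [h1] at c hplus hper
  obtain ⟨Q, e, he⟩ := SimpleQuad.exists_isIso hY
  refine ⟨m, Y.area, by rw [← hper, q.isSimpleQuad.per_eq], ?_, by omega, c.m_pos, Q, _,
    c.congr_right he⟩
  rw [← q.isSimpleQuad.area_eq, c.area]
  rfl

/-- The quadrangulations whose restriction is `r` are in bijection with the quadrangulations with a
simple boundary with which `r` can be filled. -/
theorem card_restriction_eq (hc : Core r.map r.ρ a k l R pn ε) (hf : Frame r a k l) (hε : ε < 1 / 3)
    {m N : ℕ} (hm : 0 < m) (hb : ⌊(pn : ℝ) / 3⌋₊ < a + m) {n p : ℕ} (hn : n = r.area + N)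
    (hp : p = a + m + l) (hpn : (pn : ℝ) / 2 ≤ p) :
    Nat.card {x : Σ q : SimpleQuad n p, q.rep.Vertex //
      x.1.rep.restrictionClass x.2 pn ε = some (Quotient.mk MarkedMap.setoid r)} =
      Nat.card (SimpleQuad N (m + k)) := by
  have := r.finite
  let Rel (x : Σ q : SimpleQuad n p, q.rep.Vertex) (c : SimpleQuad N (m + k)) : Prop :=
    ∃ i j, Carries x.1.rep x.2 pn ε r i ∧ Completion x.1.rep r.map c.rep a k l m i j
  have hex : ∀ x : {x : Σ q : SimpleQuad n p, q.rep.Vertex //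
      x.1.rep.restrictionClass x.2 pn ε = some (Quotient.mk MarkedMap.setoid r)},
      ∃ c, Rel x.1 c := fun ⟨x, hx⟩ => by
    obtain ⟨i, hi⟩ := RootedMap.restrictionClass_eq_some_iff.1 hx
    obtain ⟨m', N', h1, h2, -, -, c, j, hcomp⟩ := hi.exists_filling hf
    obtain rfl : m' = m := by omega
    obtain rfl : N' = N := by omega
    exact ⟨c, i, j, hi, hcomp⟩
  choose f hfRel using hex
  refine Nat.card_congr (Equiv.ofBijective f ⟨?_, fun c => ?_⟩)
  · rintro ⟨⟨q, ρ⟩, hx⟩ ⟨⟨q', ρ'⟩, hx'⟩ hff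
    obtain ⟨i, j, hi, hcomp⟩ := hfRel ⟨⟨q, ρ⟩, hx⟩
    obtain ⟨i', j', hi', hcomp'⟩ := hfRel ⟨⟨q', ρ'⟩, hx'⟩
    rw [← hff] at hcomp'
    obtain ⟨e, he, hei⟩ := hcomp.exists_isIso hcomp'
    obtain rfl : q = q' := SimpleQuad.eq_of_iso (RootedMap.iso_iff.2 ⟨e, he⟩)
    -- a rooted map has no symmetries, so that the two embeddings of `r` agree
    have hii : ∀ d, i d = i' d := fun d =>
      (he.apply_eq_self q.isSimpleQuad.connected _).symm.trans (hei d)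
    obtain ⟨d, hd⟩ := r.map.tail_surjective r.ρ
    have h1 := (hi.ρ_iff d).1 hd
    have h2 := (hi'.ρ_iff d).1 hd
    rw [hii] at h1
    obtain rfl : ρ = ρ' := h1.symm.trans h2
    rfl
  · obtain ⟨D, hD, q, i, j, hcomp⟩ := exists_completion hf.per hf.k_pos hf.l_pos hm hf.path_inj
      c.isSimpleQuad
    have hq := hcomp.isSimpleQuad hc c.isSimpleQuad
    have h1 : r.map.area + N = n := hn.symm
    rw [h1, ← hp] at hq
    obtain ⟨Q, e, he⟩ := SimpleQuad.exists_isIso hq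
    have hcomp' := hcomp.congr_map he
    obtain ⟨d, hd⟩ := r.map.tail_surjective r.ρ
    have hρ : ∀ d', r.map.tail d' = r.ρ ↔ Q.rep.tail ((e ∘ i) d') = Q.rep.tail ((e ∘ i) d) :=
      fun d' => by rw [hcomp'.gluing.tail_i_iff, hd]
    have hcar := hcomp'.carries hc hf.vm hf.vp hρ c.isSimpleQuad hε
      (by rw [Q.isSimpleQuad.per_eq]; exact hpn) hb
    have hx := RootedMap.restrictionClass_eq_some_iff.2 ⟨_, hcar⟩
    refine ⟨⟨⟨Q, _⟩, hx⟩, ?_⟩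
    obtain ⟨i', j', hcar', hcomp''⟩ := hfRel ⟨⟨Q, _⟩, hx⟩
    obtain rfl := hcar.unique hc.connected hcar'
    exact (SimpleQuad.eq_of_iso (hcomp'.exists_isIso_filling hcomp'')).symm

end PlaneQuad

theorem lemma4 (p : ℕ → ℕ) (hp : ∀ n, 1 ≤ n → 0 < p n ∧ Even (p n))
    (ε : ℝ) (hε : 0 < ε) (n : ℕ) (hn : 1 ≤ n)
    (n' p' : ℕ) (hn' : 1 ≤ n') (hp'_pos : 0 < p') (hp'_even : Even p')
    (hp' : (p n : ℝ) / 2 ≤ p')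
    [Nonempty (PlaneQuad.SimpleQuad n' p')]
    (r : PlaneQuad.MarkedMap) (hr : PlaneQuad.IsRestrictionMap (p n) ε r) :
    (PlaneQuad.restrictionLaw n' p' (p n) ε
        (some (Quotient.mk PlaneQuad.MarkedMap.setoid r))).toReal =
      (PlaneQuad.qt ((n' : ℤ) - r.area) ((p' : ℤ) - r.per + 2 * r.pIn) : ℝ) /
          (((n' : ℝ) + (p' : ℝ) / 2 + 1) * (PlaneQuad.qt n' p' : ℝ)) *
        (if (p n : ℝ) / 3 < (p' : ℝ) - r.pLeft then 1 else 0) := by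
  obtain ⟨hε', a, k, l, R, hc, hf⟩ := hr.exists_core
  have hper : r.per = a + k + l := hf.per
  have hfloor : (a : ℝ) ≤ (p n : ℝ) / 3 :=
    (Nat.le_floor_iff (by positivity)).1 hc.target.2
  rw [PlaneQuad.restrictionLaw_toReal, PlaneQuad.qt_natCast, hf.pIn_eq, hf.pLeft_eq, hper]
  -- outside of the cases of a positive probability, no quadrangulation has the restriction `r`
  have hzero : ¬ ((p n : ℝ) / 3 < (p' : ℝ) - l ∧ r.area ≤ n') →
      Nat.card {x : Σ q : PlaneQuad.SimpleQuad n' p', q.rep.Vertex //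
        x.1.rep.restrictionClass x.2 (p n) ε =
          some (Quotient.mk PlaneQuad.MarkedMap.setoid r)} = 0 := by
    intro h
    rw [Nat.card_eq_zero]
    refine Or.inl ⟨fun ⟨x, hx⟩ => h ?_⟩
    obtain ⟨i, hi⟩ := PlaneQuad.RootedMap.restrictionClass_eq_some_iff.1 hx
    obtain ⟨m, N, h1, h2, h3, -⟩ := hi.exists_filling hf
    refine ⟨?_, by omega⟩
    have h4 := (Nat.floor_lt (by positivity)).1 h3
    rw [h1]
    push_cast at h4 ⊢
    linarith
  by_cases hind : (p n : ℝ) / 3 < (p' : ℝ) - l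
  · rw [if_pos hind, mul_one]
    by_cases harea : r.area ≤ n'
    · obtain ⟨N, hN⟩ := Nat.exists_eq_add_of_le harea
      have hal : a + l < p' := by
        have : (a : ℝ) + l < p' := by linarith
        exact_mod_cast this
      obtain ⟨m, hm⟩ := Nat.exists_eq_add_of_lt hal
      have hb : ⌊(p n : ℝ) / 3⌋₊ < a + (m + 1) := by
        rw [Nat.floor_lt (by positivity)]
        rw [hm] at hind
        push_cast at hind ⊢
        linarith
      rw [PlaneQuad.card_restriction_eq hc hf hε' (Nat.succ_pos m) hb hN (by omega) hp',
        show (n' : ℤ) - r.area = N by omega,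
        show (p' : ℤ) - ((a + k + l : ℕ) : ℤ) + 2 * k = ((m + 1 + k : ℕ) : ℤ) by omega,
        PlaneQuad.qt_natCast]
    · rw [hzero fun h => harea h.2, PlaneQuad.qt, if_neg (by omega), if_neg (by omega)]
  · rw [if_neg hind, mul_zero, hzero fun h => hind h.1, Nat.cast_zero, zero_div]
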